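/- Computation is on a deterministic word RAM: registers and memory cells hold words of $W$ bits, and constants, register and memory accesses (direct and indirect), arithmetic, bitwise and comparison operations modulo $2^W$ cost one time step each. A \emph{board of width $w$} is the region above the $x$-axis between the lines $x=0$ and $x=w$. Two rectangles are independent if their interiors are disjoint. Given a finite set $S$ of independent axis-aligned rectangles with integer coordinates on the board, \emph{dropping} an $a\times b$ rectangle (width $a$, height $b$) at position $x_d$ lets it fall vertically from above, with left border at $x=x_d$, until it lands on a rectangle of $S$ or on the $x$-axis; it is then added to $S$. A \emph{Rectangle Dropping Data Structure} (RDDS) maintains a set $S$ of $O(n)$ independent axis-aligned rectangles on the board and supports: * (Construction) Given $n$, $w$ and an initial, possibly empty, set of $O(n)$ independent rectangles on the board, build the data structure. * (Update) Given $a,b\ge 1$ and $x_d\ge 0$ with $x_d+a\le w$, drop an $a\times b$ rectangle at position $x_d$, and return the height of the highest point of the new set. * (Query) Given $a,b\ge 1$ with $a\le w$, return an integer position $x_d\ge 0$ with $x_d+a\le w$ at which an $a\times b$ rectangle dropped on $S$ ends up as low as possible, and the height of the highest point of the set that would result from that move. \textbf{Theorem.} There is an RDDS with $O(n\log n)$ construction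 time which supports every update and every query in $O(n^{1/2}\log^{3/2}n)$ worst-case time. Precisely: there are three fixed programs (construction, update, query), and for every constant $c\in\mathbb N$ there are constants $k\in\mathbb N$ and $C$ such that the following holds for all integers $n\ge 2$, all word lengths $W\ge k\log_2 n$ and all $w\le n^c$. For every initial set of at most $cn$ independent rectangles of positive width and height with coordinates at most $n^c$ on the board of width $w$, the construction program halts within $C\,n\log n$ steps. After that, throughout any sequence of queries and updates in which the heights of the given rectangles are at most $n^c$ and the updates keep the number of rectangles at most $cn$, every operation halts within $C\,n^{1/2}\log^{3/2}n$ steps with a correct answer. -/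

import Mathlib

/-! # The word RAM

A machine with word length `W`: registers and memory cells hold words, that is, natural numbers
below `2 ^ W`, and every operation is performed modulo `2 ^ W` at unit cost.  Programs are
deterministic, written in structured form, and cannot mention `W`. -/

namespace WordRAM

/-- The unit-cost binary operations on words. Comparisons return `0` or `1`. -/
inductive BinOp where
  | add | sub | mul | div | mod | band | bor | bxor | shl | shr | lt | eq

/-- The value of a binary operation on words of length `W`. Subtraction wraps around. -/
def BinOp.eval (W : ℕ) (o : BinOp) (u v : ℕ) : ℕ :=
  (match o with
    | .add => u + v
    | .sub => u + 2 ^ W - v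
    | .mul => u * v
    | .div => u / v
    | .mod => u % v
    | .band => u &&& v
    | .bor => u ||| v
    | .bxor => u ^^^ v
    | .shl => u <<< v
    | .shr => u >>> v
    | .lt => if u < v then 1 else 0
    | .eq => if u = v then 1 else 0) % 2 ^ W

/-- The contents of the registers and of the memory. -/
structure State where
  reg : ℕ → ℕ
  mem : ℕ → ℕ

/-- Expressions: constants, registers, indirect memory reads, binary operations. -/
inductive Expr where
  | const (k : ℕ)
  | reg (i : ℕ)
  | load (addr : Expr)
  | op (o : BinOp) (e f : Expr)

def Expr.eval (W : ℕ) (s : State) : Expr → ℕ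
  | .const k => k % 2 ^ W
  | .reg i => s.reg i
  | .load e => s.mem (e.eval W s)
  | .op o e f => o.eval W (e.eval W s) (f.eval W s)

/-- One time step for every constant, register access, memory read and operation. -/
def Expr.cost : Expr → ℕ
  | .const _ => 1
  | .reg _ => 1
  | .load e => e.cost + 1
  | .op _ e f => e.cost + f.cost + 1

/-- Programs. A condition holds when its value is not `0`. -/
inductive Prog where
  | skip
  | assign (i : ℕ) (e : Expr)
  | store (addr val : Expr)
  | seq (p q : Prog)
  | ite (e : Expr) (p q : Prog)
  | loop (e : Expr) (p : Prog)

/-- `Exec W p s s' t`: started in state `s` on a machine with word length `W`, the program `p`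
halts in state `s'` after exactly `t` time steps. -/
inductive Exec (W : ℕ) : Prog → State → State → ℕ → Prop
  | skip (s : State) : Exec W .skip s s 0
  | assign (s : State) (i : ℕ) (e : Expr) :
      Exec W (.assign i e) s { s with reg := Function.update s.reg i (e.eval W s) } (e.cost + 1)
  | store (s : State) (e f : Expr) :
      Exec W (.store e f) s { s with mem := Function.update s.mem (e.eval W s) (f.eval W s) }
        (e.cost + f.cost + 1)
  | seq {p q : Prog} {s₁ s₂ s₃ : State} {t₁ t₂ : ℕ} :
      Exec W p s₁ s₂ t₁ → Exec W q s₂ s₃ t₂ → Exec W (.seq p q) s₁ s₃ (t₁ + t₂)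
  | ite_true {e : Expr} {p q : Prog} {s₁ s₂ : State} {t : ℕ} :
      e.eval W s₁ ≠ 0 → Exec W p s₁ s₂ t → Exec W (.ite e p q) s₁ s₂ (e.cost + 1 + t)
  | ite_false {e : Expr} {p q : Prog} {s₁ s₂ : State} {t : ℕ} :
      e.eval W s₁ = 0 → Exec W q s₁ s₂ t → Exec W (.ite e p q) s₁ s₂ (e.cost + 1 + t)
  | loop_exit {e : Expr} {p : Prog} {s : State} :
      e.eval W s = 0 → Exec W (.loop e p) s s (e.cost + 1)
  | loop_step {e : Expr} {p : Prog} {s₁ s₂ s₃ : State} {t₁ t₂ : ℕ} :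
      e.eval W s₁ ≠ 0 → Exec W p s₁ s₂ t₁ → Exec W (.loop e p) s₂ s₃ t₂ →
        Exec W (.loop e p) s₁ s₃ (e.cost + 1 + t₁ + t₂)

/-- The machine is deterministic: a program has at most one halting run from a given state. -/
theorem Exec.unique {W : ℕ} {p : Prog} {s s₁ s₂ : State} {t₁ t₂ : ℕ}
    (h₁ : Exec W p s s₁ t₁) (h₂ : Exec W p s s₂ t₂) : s₁ = s₂ ∧ t₁ = t₂ := by
  induction h₁ generalizing s₂ t₂ with
  | skip => cases h₂; exact ⟨rfl, rfl⟩
  | assign => cases h₂; exact ⟨rfl, rfl⟩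
  | store => cases h₂; exact ⟨rfl, rfl⟩
  | seq _ _ ih₁ ih₂ =>
    cases h₂ with
    | seq k₁ k₂ =>
      obtain ⟨rfl, rfl⟩ := ih₁ k₁
      obtain ⟨rfl, rfl⟩ := ih₂ k₂
      exact ⟨rfl, rfl⟩
  | ite_true h _ ih =>
    cases h₂ with
    | ite_true _ k => obtain ⟨rfl, rfl⟩ := ih k; exact ⟨rfl, rfl⟩
    | ite_false h' _ => exact absurd h' h
  | ite_false h _ ih =>
    cases h₂ with
    | ite_true h' _ => exact absurd h h'
    | ite_false _ k => obtain ⟨rfl, rfl⟩ := ih k; exact ⟨rfl, rfl⟩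
  | loop_exit h =>
    cases h₂ with
    | loop_exit => exact ⟨rfl, rfl⟩
    | loop_step h' _ _ => exact absurd h h'
  | loop_step h _ _ ih₁ ih₂ =>
    cases h₂ with
    | loop_exit h' => exact absurd h' h
    | loop_step _ k₁ k₂ =>
      obtain ⟨rfl, rfl⟩ := ih₁ k₁
      obtain ⟨rfl, rfl⟩ := ih₂ k₂
      exact ⟨rfl, rfl⟩

/-- All registers and memory cells hold words of length `W`. -/
def State.IsWords (W : ℕ) (s : State) : Prop :=
  (∀ i, s.reg i < 2 ^ W) ∧ ∀ i, s.mem i < 2 ^ W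

theorem Expr.eval_lt {W : ℕ} {s : State} (hs : s.IsWords W) (e : Expr) :
    e.eval W s < 2 ^ W := by
  cases e with
  | const k => exact Nat.mod_lt _ (by positivity)
  | reg i => exact hs.1 i
  | load e => exact hs.2 _
  | op o e f => exact Nat.mod_lt _ (by positivity)

/-- A run that starts with words in all cells keeps words in all cells. -/
theorem Exec.isWords {W : ℕ} {p : Prog} {s s' : State} {t : ℕ}
    (h : Exec W p s s' t) (hs : s.IsWords W) : s'.IsWords W := by
  induction h with
  | skip => exact hs
  | assign s i e =>
    refine ⟨fun j => ?_, hs.2⟩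
    by_cases hj : j = i
    · subst hj; simpa using e.eval_lt hs
    · simpa [Function.update_of_ne hj] using hs.1 j
  | store s e f =>
    refine ⟨hs.1, fun j => ?_⟩
    by_cases hj : j = e.eval W s
    · subst hj; simpa using f.eval_lt hs
    · simpa [Function.update_of_ne hj] using hs.2 j
  | seq _ _ ih₁ ih₂ => exact ih₂ (ih₁ hs)
  | ite_true _ _ ih => exact ih hs
  | ite_false _ _ ih => exact ih hs
  | loop_exit => exact hs
  | loop_step _ _ _ ih₁ ih₂ => exact ih₂ (ih₁ hs)

end WordRAM

/-! # Dropping rectangles -/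

namespace RectDrop

open WordRAM

/-- The axis-aligned rectangle `[x, x + width] × [y, y + height]`. -/
@[ext]
structure Rect where
  x : ℕ
  y : ℕ
  width : ℕ
  height : ℕ
  deriving DecidableEq

def Rect.right (r : Rect) : ℕ := r.x + r.width

def Rect.top (r : Rect) : ℕ := r.y + r.height

/-- Two (nondegenerate) rectangles are independent when their interiors are disjoint. -/
def Independent (r s : Rect) : Prop :=
  r.right ≤ s.x ∨ s.right ≤ r.x ∨ r.top ≤ s.y ∨ s.top ≤ r.y

/-- The height at which a rectangle of width `a` comes to rest when it is dropped from above with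
its left border at `x`: the highest top of the rectangles below it, or `0` (the ground). -/
def restHeight (S : Finset Rect) (a x : ℕ) : ℕ :=
  (S.filter fun r => x < r.right ∧ r.x < x + a).sup Rect.top

/-- `restHeight` is the lowest height that an `a × b` rectangle reaches by a vertical fall from
above, without its interior ever meeting the interior of a rectangle of `S`. -/
theorem restHeight_le_iff {S : Finset Rect} (hS : ∀ r ∈ S, 0 < r.height) {a b x : ℕ} (hb : 0 < b)
    (y : ℕ) : restHeight S a x ≤ y ↔
      ∀ z, y ≤ z → ∀ r ∈ S, Independent ⟨x, z, a, b⟩ r := by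
  rw [restHeight, Finset.sup_le_iff]
  simp only [Finset.mem_filter]
  simp only [Independent, Rect.right, Rect.top]
  constructor
  · intro h z hz r hr
    have := h r
    by_contra hc
    push Not at hc
    have := this ⟨hr, by omega, by omega⟩
    omega
  · rintro h r ⟨hr, h₁, h₂⟩
    by_contra hc
    have := hS r hr
    have := h (max y (r.y + r.height - 1)) (le_max_left _ _) r hr
    omega

/-- The set of rectangles after an `a × b` rectangle was dropped with left border at `x`. -/
def drop (S : Finset Rect) (a b x : ℕ) : Finset Rect :=
  insert ⟨x, restHeight S a x, a, b⟩ S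

/-- The height of the highest point of a set of rectangles. -/
def highest (S : Finset Rect) : ℕ := S.sup Rect.top

/-- On a board of width `w`, dropping a rectangle of width `a` with left border at `x` is
a greedy move: it fits on the board, and no other admissible position makes it end up lower. -/
def IsGreedy (w : ℕ) (S : Finset Rect) (a x : ℕ) : Prop :=
  x + a ≤ w ∧ ∀ x', x' + a ≤ w → restHeight S a x ≤ restHeight S a x'

/-- The rectangles listed in `l` form a legal initial set on a board of width `w`: they are
nondegenerate, pairwise independent, lie between the lines `x = 0` and `x = w`, there are at most
`c * n` of them, and all coordinates are at most `n ^ c`. -/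
structure LegalStart (c n w : ℕ) (l : List Rect) : Prop where
  width_le : w ≤ n ^ c
  length_le : l.length ≤ c * n
  width_pos : ∀ r ∈ l, 0 < r.width
  height_pos : ∀ r ∈ l, 0 < r.height
  right_le : ∀ r ∈ l, r.right ≤ w
  top_le : ∀ r ∈ l, r.top ≤ n ^ c
  independent : l.Pairwise Independent

/-- An `a × b` rectangle that may be handed to the player: it is nondegenerate, fits on the board,
and its height is at most `n ^ c`. -/
structure LegalPiece (c n w a b : ℕ) : Prop where
  width_pos : 0 < a
  width_le : a ≤ w
  height_pos : 0 < b
  height_le : b ≤ n ^ c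

/-- The machine state in which construction starts: registers `0, 1, 2` hold `n`, the board width
and the number of rectangles, memory holds the rectangles, four consecutive cells each, from
address `0` on, and everything else is `0`. -/
def startState (n w : ℕ) (l : List Rect) : State where
  reg i := [n, w, l.length].getD i 0
  mem i := (l.flatMap fun r => [r.x, r.y, r.width, r.height]).getD i 0

/-- Write the arguments `args` into registers `0, 1, …`, and leave everything else as it was. -/
def withArgs (s : State) (args : List ℕ) : State where
  reg i := args.getD i (s.reg i)
  mem := s.mem

/-- The code of a data structure: construction, update and query, all working on the same
registers and memory. -/
structure Code where
  construct : Prog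
  update : Prog
  query : Prog

/-- `Reachable D c n W w S s`: on a machine with word length `W` and a board of width `w`, the
data structure `D` can be in machine state `s` while the current set of rectangles is `S`, after it
was constructed for a legal initial set, and any sequence of queries and of updates that keeps the
number of rectangles at most `c * n`. -/
inductive Reachable (D : Code) (c n W w : ℕ) : Finset Rect → State → Prop
  | construct {l : List Rect} {s : State} {t : ℕ} :
      LegalStart c n w l → Exec W D.construct (startState n w l) s t →
        Reachable D c n W w l.toFinset s
  | update {S : Finset Rect} {s s' : State} {t a b x : ℕ} :
      Reachable D c n W w S s → S.card < c * n → LegalPiece c n w a b → x + a ≤ w →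
        Exec W D.update (withArgs s [a, b, x]) s' t →
        Reachable D c n W w (drop S a b x) s'
  | query {S : Finset Rect} {s s' : State} {t a b : ℕ} :
      Reachable D c n W w S s → LegalPiece c n w a b →
        Exec W D.query (withArgs s [a, b]) s' t →
        Reachable D c n W w S s'

/-- `D` is a Rectangle Dropping Data Structure for parameters `c n W w`, with construction time at
most `T`, update time at most `U`, and query time at most `Q`, in the worst case.  An update gets
the width, the height and the position of the dropped rectangle in registers `0, 1, 2` and returns
the height of the highest point of the new set in register `0`.  A query gets the width and the
height of a rectangle in registers `0, 1`, and returns the position of a greedy move in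
register `0`, and the height of the highest point which that move would lead to in register `1`. -/
structure IsRDDS (D : Code) (c n W w : ℕ) (T U Q : ℝ) : Prop where
  construct : ∀ l : List Rect, LegalStart c n w l →
    ∃ s t, Exec W D.construct (startState n w l) s t ∧ (t : ℝ) ≤ T
  update : ∀ S s, Reachable D c n W w S s → S.card < c * n →
    ∀ a b x, LegalPiece c n w a b → x + a ≤ w →
      ∃ s' t, Exec W D.update (withArgs s [a, b, x]) s' t ∧ (t : ℝ) ≤ U ∧
        s'.reg 0 = highest (drop S a b x)
  query : ∀ S s, Reachable D c n W w S s →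
    ∀ a b, LegalPiece c n w a b →
      ∃ s' t, Exec W D.query (withArgs s [a, b]) s' t ∧ (t : ℝ) ≤ Q ∧
        IsGreedy w S a (s'.reg 0) ∧ s'.reg 1 = highest (drop S a b (s'.reg 0))

end RectDrop

/-! # A loop language with separate arrays

Programs are written in a small language with named registers, unbounded arrays, exact arithmetic
and counted loops.  Its semantics is a total function, together with a predicate saying that no
operation overflows.  A compiler to the word RAM is proved correct. -/

namespace RectDrop

open WordRAM

set_option linter.constructorNameAsVariable false

/-! Everything is governed by the upper contour of the set, a step function with O(n) steps. A
dropped rectangle rests at the maximum of the contour over its window (`restHeight_le_iff_contour`),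
and the drop makes the contour constant on the window and changes nothing else (`contour_drop`).

The contour is cut into consecutive blocks of fewer than 2B steps, where B is least with B² ≥ n ·
size n, so that B is of order (n log n)^(1/2). For a block of z steps and each t ≤ z, a table
records the runs formed by the t lowest steps: where the initial run ends, where the final run
starts, and the length and start of a longest run. The rows come from activating the steps in order
of height. Each activation merges two neighbouring runs and changes only two stored endpoints
(`Runs.insert`, `Best.insert`), so a block takes linear time after a radix sort of its heights, that
is O(B log n) (`mkBlk_ok`).

A query searches by bisection for the least y such that some interval of the given width has contour
at most y. One test scans the blocks from left to right: a binary search among the sorted heights of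
a block selects the row for y, and the row is combined with the run reaching the block from the left
(`ScanInv.step`). With K blocks a query costs O(K log² n). An update finds the blocks e and f at the
two ends of the window. It forms the steps left of the window, the new step and the steps right of
it, at most 4B in all (`gather_ok`), builds blocks from them, and splices these into the directory
in place of the entries e to f. This costs O(K + B log n).

Blocks may become small and are never merged, so K is controlled by a potential, the sum of max(B,
size) over all blocks. It is at least KB, and an update raises it by at most 2, because the new
steps exceed those of the end blocks by at most 2 and `build` creates no surplus. As there are at
most cn rectangles and every drop adds one (`card_drop`), KB = O(n + B), hence K log n = O(B)
(`blocks_mul_le`). Both costs are then O(B log n) = O(n^(1/2) log^(3/2) n) (`block_mul_size_le`).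
Abandoned blocks are not reclaimed either; the memory used stays polynomial in n, so addresses fit
into a word.

Construction sorts the vertical edges of the rectangles, computes the contour on each elementary
interval by a sparse table run backwards (`cover_ok`), and cuts the result into blocks.

All programs are written in a loop language with a total semantics that counts machine steps. It is
compiled once to the word RAM (`Cmd.exec_comp`), provided that no operation overflows. Determinism
of the machine identifies every reachable state with one that the proved runs produce
(`Reachable.represents`). -/

/-- The registers.  The first three receive the arguments; `D` is the first address of the memory
area that holds the arrays. -/
inductive Var where
  | a0 | a1 | a2 | D
  | w | B | LZ | top | K | fp
  | LG | tmp | pw | i | il | g | gl | c | cl | d | dl | q | z | p | o | nch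
  | k | l | r | u | mlen | mst | e | f | x | xe | mx | y | kr
  | lo | hi | best | fnd | res | rs | t | lg
  deriving DecidableEq

/-- The arrays. -/
inductive Arr where
  | PX | PH | SH | TP | TM | TT | TS
  | DP | DS | NP | NS | BX | BH
  | ID | TMP | KEY | LA | LB | RK | RT | XS | T
  deriving DecidableEq

/-- The state of the loop language; `inp` is the input, and `t` counts time steps. -/
structure St where
  reg : Var → ℕ
  arr : Arr → ℕ → ℕ
  inp : ℕ → ℕ
  t : ℕ

/-- Assign `x` to the register `v` in `dt` time steps. -/
def St.setr (s : St) (v : Var) (x dt : ℕ) : St :=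
  { s with reg := Function.update s.reg v x, t := s.t + dt }

/-- Assign `x` to cell `i` of the array `A` in `dt` time steps. -/
def St.seta (s : St) (A : Arr) (i x dt : ℕ) : St :=
  { s with arr := Function.update s.arr A (Function.update (s.arr A) i x), t := s.t + dt }

/-- Let `dt` time steps pass. -/
def St.tick (s : St) (dt : ℕ) : St := { s with t := s.t + dt }

section StSimp
variable (s : St) (v u : Var) (A A' : Arr) (i j x dt : ℕ)
@[simp] theorem St.setr_reg : (s.setr v x dt).reg u = if u = v then x else s.reg u := by
  simp [St.setr, Function.update_apply]
@[simp] theorem St.setr_arr : (s.setr v x dt).arr = s.arr := rfl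
@[simp] theorem St.setr_inp : (s.setr v x dt).inp = s.inp := rfl
@[simp] theorem St.setr_t : (s.setr v x dt).t = s.t + dt := rfl
@[simp] theorem St.seta_reg : (s.seta A i x dt).reg = s.reg := rfl
@[simp] theorem St.seta_arr : (s.seta A i x dt).arr A' =
    if A' = A then Function.update (s.arr A) i x else s.arr A' := by
  by_cases h : A' = A
  · subst h; simp [St.seta]
  · simp [St.seta, h]
@[simp] theorem St.seta_inp : (s.seta A i x dt).inp = s.inp := rfl
@[simp] theorem St.seta_t : (s.seta A i x dt).t = s.t + dt := rfl
@[simp] theorem St.tick_reg : (s.tick dt).reg = s.reg := rfl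
@[simp] theorem St.tick_arr : (s.tick dt).arr = s.arr := rfl
@[simp] theorem St.tick_inp : (s.tick dt).inp = s.inp := rfl
@[simp] theorem St.tick_t : (s.tick dt).t = s.t + dt := rfl
end StSimp

/-! ### Expressions with exact arithmetic on natural numbers -/

inductive Op where
  | add | sub | mul | div | mod | lt | eq

def Op.bin : Op → BinOp
  | .add => .add
  | .sub => .sub
  | .mul => .mul
  | .div => .div
  | .mod => .mod
  | .lt => .lt
  | .eq => .eq

def Op.val : Op → ℕ → ℕ → ℕ
  | .add, u, v => u + v
  | .sub, u, v => u - v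
  | .mul, u, v => u * v
  | .div, u, v => u / v
  | .mod, u, v => u % v
  | .lt, u, v => if u < v then 1 else 0
  | .eq, u, v => if u = v then 1 else 0

/-- The operation neither exceeds the bound `L` nor truncates. -/
def Op.ok (L : ℕ) : Op → ℕ → ℕ → Prop
  | .add, u, v => u + v < L
  | .sub, u, v => v ≤ u
  | .mul, u, v => u * v < L
  | _, _, _ => True

inductive Ex where
  | lit (k : ℕ)
  | var (v : Var)
  | get (A : Arr) (e : Ex)
  | inp (e : Ex)
  | op (o : Op) (e f : Ex)

namespace Ex

instance : Add Ex := ⟨.op .add⟩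
instance : Sub Ex := ⟨.op .sub⟩
instance : Mul Ex := ⟨.op .mul⟩
instance : Div Ex := ⟨.op .div⟩
instance : Mod Ex := ⟨.op .mod⟩
instance (n : ℕ) : OfNat Ex n := ⟨.lit n⟩
def lt (e f : Ex) : Ex := .op .lt e f
def eq (e f : Ex) : Ex := .op .eq e f

def val (s : St) : Ex → ℕ
  | .lit k => k
  | .var v => s.reg v
  | .get A e => s.arr A (e.val s)
  | .inp e => s.inp (e.val s)
  | .op o e f => o.val (e.val s) (f.val s)

def safe (L : ℕ) (s : St) : Ex → Prop
  | .lit k => k < L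
  | .var _ => True
  | .get _ e => e.safe L s ∧ e.val s < L
  | .inp e => e.safe L s ∧ e.val s < s.reg .D
  | .op o e f => e.safe L s ∧ f.safe L s ∧ o.ok L (e.val s) (f.val s)

def cost : Ex → ℕ
  | .lit _ => 1
  | .var _ => 1
  | .get _ e => e.cost + 7
  | .inp e => e.cost + 1
  | .op _ e f => e.cost + f.cost + 1

section Simp
variable (L : ℕ) (s : St) (e f : Ex) (v : Var) (A : Arr) (n : ℕ)
@[simp] theorem val_lit : (ofNat(n) : Ex).val s = OfNat.ofNat n := rfl
@[simp] theorem val_lit' : (Ex.lit n).val s = n := rfl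
@[simp] theorem val_var : (Ex.var v).val s = s.reg v := rfl
@[simp] theorem val_get : (Ex.get A e).val s = s.arr A (e.val s) := rfl
@[simp] theorem val_inp : (Ex.inp e).val s = s.inp (e.val s) := rfl
@[simp] theorem val_add : (e + f).val s = e.val s + f.val s := rfl
@[simp] theorem val_sub : (e - f).val s = e.val s - f.val s := rfl
@[simp] theorem val_mul : (e * f).val s = e.val s * f.val s := rfl
@[simp] theorem val_div : (e / f).val s = e.val s / f.val s := rfl
@[simp] theorem val_mod : (e % f).val s = e.val s % f.val s := rfl
@[simp] theorem val_lt : (e.lt f).val s = if e.val s < f.val s then 1 else 0 := rfl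
@[simp] theorem val_eq : (e.eq f).val s = if e.val s = f.val s then 1 else 0 := rfl
@[simp] theorem safe_lit : (ofNat(n) : Ex).safe L s ↔ OfNat.ofNat n < L := Iff.rfl
@[simp] theorem safe_lit' : (Ex.lit n).safe L s ↔ n < L := Iff.rfl
@[simp] theorem safe_var : (Ex.var v).safe L s := trivial
@[simp] theorem safe_get : (Ex.get A e).safe L s ↔ e.safe L s ∧ e.val s < L := Iff.rfl
@[simp] theorem safe_inp : (Ex.inp e).safe L s ↔ e.safe L s ∧ e.val s < s.reg .D := Iff.rfl
@[simp] theorem safe_add : (e + f).safe L s ↔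
    e.safe L s ∧ f.safe L s ∧ e.val s + f.val s < L := Iff.rfl
@[simp] theorem safe_sub : (e - f).safe L s ↔
    e.safe L s ∧ f.safe L s ∧ f.val s ≤ e.val s := Iff.rfl
@[simp] theorem safe_mul : (e * f).safe L s ↔
    e.safe L s ∧ f.safe L s ∧ e.val s * f.val s < L := Iff.rfl
@[simp] theorem safe_div : (e / f).safe L s ↔ e.safe L s ∧ f.safe L s := by
  change _ ∧ _ ∧ True ↔ _; simp
@[simp] theorem safe_mod : (e % f).safe L s ↔ e.safe L s ∧ f.safe L s := by
  change _ ∧ _ ∧ True ↔ _; simp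
@[simp] theorem safe_lt : (e.lt f).safe L s ↔ e.safe L s ∧ f.safe L s := by
  change _ ∧ _ ∧ True ↔ _; simp
@[simp] theorem safe_eq : (e.eq f).safe L s ↔ e.safe L s ∧ f.safe L s := by
  change _ ∧ _ ∧ True ↔ _; simp
@[simp] theorem cost_lit : (ofNat(n) : Ex).cost = 1 := rfl
@[simp] theorem cost_lit' : (Ex.lit n).cost = 1 := rfl
@[simp] theorem cost_var : (Ex.var v).cost = 1 := rfl
@[simp] theorem cost_get : (Ex.get A e).cost = e.cost + 7 := rfl
@[simp] theorem cost_inp : (Ex.inp e).cost = e.cost + 1 := rfl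
@[simp] theorem cost_add : (e + f).cost = e.cost + f.cost + 1 := rfl
@[simp] theorem cost_sub : (e - f).cost = e.cost + f.cost + 1 := rfl
@[simp] theorem cost_mul : (e * f).cost = e.cost + f.cost + 1 := rfl
@[simp] theorem cost_div : (e / f).cost = e.cost + f.cost + 1 := rfl
@[simp] theorem cost_mod : (e % f).cost = e.cost + f.cost + 1 := rfl
@[simp] theorem cost_lt : (e.lt f).cost = e.cost + f.cost + 1 := rfl
@[simp] theorem cost_eq : (e.eq f).cost = e.cost + f.cost + 1 := rfl
end Simp

end Ex

/-! ### Programs, their semantics and their running time -/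

/-- Programs of the loop language.  `rep i lim e p` runs `p` for `i = 0, 1, …, e - 1`, with the
bound kept in `lim`; `size v tmp e` computes the number of binary digits of `e`. -/
inductive Cmd where
  | skip
  | set (v : Var) (e : Ex)
  | put (A : Arr) (e f : Ex)
  | seq (p q : Cmd)
  | ite (e : Ex) (p q : Cmd)
  | rep (i lim : Var) (e : Ex) (p : Cmd)
  | size (v tmp : Var) (e : Ex)

infixr:60 " ;; " => Cmd.seq

/-- The state after `n` rounds of the loop body `f`, started in state `s`. -/
def iter (f : ℕ → St → St) (s : St) : ℕ → St
  | 0 => s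
  | n + 1 => f n (iter f s n)

namespace Cmd

def run : Cmd → St → St
  | .skip, s => s
  | .set v e, s => s.setr v (e.val s) (e.cost + 1)
  | .put A e f, s => s.seta A (e.val s) (f.val s) (e.cost + f.cost + 7)
  | .seq p q, s => q.run (p.run s)
  | .ite e p q, s =>
    if e.val s ≠ 0 then p.run (s.tick (e.cost + 1)) else q.run (s.tick (e.cost + 1))
  | .rep i lim e p, s =>
    (iter (fun k s' => (p.run (s'.tick 4)).setr i (k + 1) 4)
      ((s.setr lim (e.val s) (e.cost + 1)).setr i 0 2) (e.val s)).tick 4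
  | .size v tmp e, s =>
    (s.setr tmp 0 (e.cost + 5)).setr v (Nat.size (e.val s)) (10 * Nat.size (e.val s))

def safe (L : ℕ) : Cmd → St → Prop
  | .skip, _ => True
  | .set _ e, s => e.safe L s
  | .put _ e f, s => e.safe L s ∧ f.safe L s ∧ e.val s < L
  | .seq p q, s => p.safe L s ∧ q.safe L (p.run s)
  | .ite e p q, s => e.safe L s ∧
    if e.val s ≠ 0 then p.safe L (s.tick (e.cost + 1)) else q.safe L (s.tick (e.cost + 1))
  | .rep i lim e p, s => e.safe L s ∧ e.val s < L ∧ ∀ k < e.val s,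
      p.safe L ((iter (fun k s' => (p.run (s'.tick 4)).setr i (k + 1) 4)
      ((s.setr lim (e.val s) (e.cost + 1)).setr i 0 2) k).tick 4)
  | .size _ _ e, s => e.safe L s ∧ Nat.size (e.val s) < L

/-- The register may be changed by the program. -/
def mods : Cmd → Var → Bool
  | .skip, _ => false
  | .set v _, u => decide (u = v)
  | .put _ _ _, _ => false
  | .seq p q, u => p.mods u || q.mods u
  | .ite _ p q, u => p.mods u || q.mods u
  | .rep i lim _ p, u => decide (u = i) || decide (u = lim) || p.mods u
  | .size v tmp _, u => decide (u = v) || decide (u = tmp)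

/-- The array may be changed by the program. -/
def amods : Cmd → Arr → Bool
  | .skip, _ => false
  | .set _ _, _ => false
  | .put A _ _, B => decide (B = A)
  | .seq p q, B => p.amods B || q.amods B
  | .ite _ p q, B => p.amods B || q.amods B
  | .rep _ _ _ p, B => p.amods B
  | .size _ _ _, _ => false

/-- Loop bodies do not touch the loop counter, and `D` is never changed. -/
def wf : Cmd → Bool
  | .seq p q => p.wf && q.wf
  | .ite _ p q => p.wf && q.wf
  | .rep i lim _ p => p.wf && !p.mods i && !p.mods lim && decide (i ≠ lim) &&
    decide (i ≠ .D) && decide (lim ≠ .D)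
  | .size v tmp _ => decide (v ≠ tmp) && decide (v ≠ .D) && decide (tmp ≠ .D)
  | .set v _ => decide (v ≠ .D)
  | _ => true

end Cmd

/-! ### Frames: what a program leaves unchanged -/

/-- `s'` agrees with `s` on everything that the program `c` cannot change. -/
structure Same (c : Cmd) (s s' : St) : Prop where
  reg' : ∀ v, c.mods v = false → s'.reg v = s.reg v
  arr' : ∀ A, c.amods A = false → s'.arr A = s.arr A
  inp : s'.inp = s.inp

/-- The set of registers that a concrete program may change is computable from its syntax, so the
side condition is proved by `rfl`. The frame facts below rest on this, as do those for arrays. -/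
theorem Same.reg {c : Cmd} {s s' : St} (h : Same c s s') (v : Var)
    (hv : c.mods v = false := by rfl) : s'.reg v = s.reg v := h.reg' v hv

theorem Same.arr {c : Cmd} {s s' : St} (h : Same c s s') (A : Arr)
    (hA : c.amods A = false := by rfl) : s'.arr A = s.arr A := h.arr' A hA

theorem iter_same {p : Cmd} {i lim : Var} {e : Ex} {s s₀ : St}
    (hp : ∀ s, Same p s (p.run s)) (h : Same (.rep i lim e p) s s₀) (n : ℕ) :
    Same (.rep i lim e p) s (iter (fun k s' => (p.run (s'.tick 4)).setr i (k + 1) 4) s₀ n) := by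
  induction n with
  | zero => exact h
  | succ n ih =>
    rw [iter]
    set s₁ := iter (fun k s' => (p.run (s'.tick 4)).setr i (k + 1) 4) s₀ n
    have h₁ := hp (s₁.tick 4)
    refine ⟨fun v hv => ?_, fun A hA => ?_, ?_⟩
    · have hv' := hv
      simp only [Cmd.mods, Bool.or_eq_false_iff, decide_eq_false_iff_not] at hv'
      simp [hv'.1.1, h₁.reg' v hv'.2, ih.reg' v hv]
    · simpa [ih.arr' A hA] using h₁.arr' A hA
    · simpa [ih.inp] using h₁.inp

theorem Cmd.run_same (c : Cmd) : ∀ s, Same c s (c.run s) := by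
  induction c with
  | skip => exact fun s => ⟨fun _ _ => rfl, fun _ _ => rfl, rfl⟩
  | set v e =>
    refine fun s => ⟨fun u hu => ?_, fun _ _ => rfl, rfl⟩
    have : u ≠ v := by simpa [Cmd.mods] using hu
    simp [Cmd.run, this]
  | put A e f =>
    refine fun s => ⟨fun _ _ => rfl, fun B hB => ?_, rfl⟩
    have : B ≠ A := by simpa [Cmd.amods] using hB
    simp [Cmd.run, this]
  | seq p q ihp ihq =>
    refine fun s => ⟨fun u hu => ?_, fun B hB => ?_, ?_⟩
    · simp only [Cmd.mods, Bool.or_eq_false_iff] at hu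
      exact ((ihq _).reg' u hu.2).trans ((ihp _).reg' u hu.1)
    · simp only [Cmd.amods, Bool.or_eq_false_iff] at hB
      exact ((ihq _).arr' B hB.2).trans ((ihp _).arr' B hB.1)
    · exact (ihq _).inp.trans (ihp _).inp
  | ite e p q ihp ihq =>
    intro s
    by_cases hc : e.val s = 0
    · simp only [Cmd.run, hc, ne_eq, not_true, if_false]
      exact ⟨fun u hu => ((ihq _).reg' u (by simp_all [Cmd.mods])), fun B hB =>
        ((ihq _).arr' B (by simp_all [Cmd.amods])), (ihq _).inp⟩
    · simp only [Cmd.run, hc, ne_eq, not_false_eq_true, if_true]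
      exact ⟨fun u hu => ((ihp _).reg' u (by simp_all [Cmd.mods])), fun B hB =>
        ((ihp _).arr' B (by simp_all [Cmd.amods])), (ihp _).inp⟩
  | rep i lim e p ihp =>
    intro s
    have h₀ : Same (.rep i lim e p) s
        ((s.setr lim (e.val s) (e.cost + 1)).setr i 0 2) := by
      refine ⟨fun v hv => ?_, fun _ _ => rfl, rfl⟩
      simp only [Cmd.mods, Bool.or_eq_false_iff, decide_eq_false_iff_not] at hv
      simp [hv.1.1, hv.1.2]
    have := iter_same ihp h₀ (e.val s)
    exact ⟨this.1, this.2, this.3⟩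
  | size v tmp e =>
    refine fun s => ⟨fun u hu => ?_, fun _ _ => rfl, rfl⟩
    simp only [Cmd.mods, Bool.or_eq_false_iff, decide_eq_false_iff_not] at hu
    simp [Cmd.run, hu.1, hu.2]

/-! ## Compilation to the word RAM -/

/-- The arrays are interleaved: cell i of `A` has address D + 32 i + `A.ctorIdx`. This keeps
unbounded arrays disjoint, since there are fewer than 32 of them, and leaves the input below D
intact. -/
def Ex.comp : Ex → Expr
  | .lit k => .const k
  | .var v => .reg v.ctorIdx
  | .get A e => .load (.op .add (.reg Var.D.ctorIdx)
      (.op .add (.op .mul (.const 32) e.comp) (.const A.ctorIdx)))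
  | .inp e => .load e.comp
  | .op o e f => .op o.bin e.comp f.comp

def Cmd.comp : Cmd → Prog
  | .skip => .skip
  | .set v e => .assign v.ctorIdx e.comp
  | .put A e f => .store (.op .add (.reg Var.D.ctorIdx)
      (.op .add (.op .mul (.const 32) e.comp) (.const A.ctorIdx))) f.comp
  | .seq p q => .seq p.comp q.comp
  | .ite e p q => .ite e.comp p.comp q.comp
  | .rep i lim e p => .seq (.assign lim.ctorIdx e.comp) (.seq (.assign i.ctorIdx (.const 0))
      (.loop (.op .lt (.reg i.ctorIdx) (.reg lim.ctorIdx))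
        (.seq p.comp (.assign i.ctorIdx (.op .add (.reg i.ctorIdx) (.const 1))))))
  | .size v tmp e => .seq (.assign tmp.ctorIdx e.comp) (.seq (.assign v.ctorIdx (.const 0))
      (.loop (.reg tmp.ctorIdx)
        (.seq (.assign tmp.ctorIdx (.op .div (.reg tmp.ctorIdx) (.const 2)))
          (.assign v.ctorIdx (.op .add (.reg v.ctorIdx) (.const 1))))))

theorem Var.ctorIdx_inj {u v : Var} : u.ctorIdx = v.ctorIdx ↔ u = v :=
  ⟨fun h => by rw [← Var.ofNat_ctorIdx u, h, Var.ofNat_ctorIdx], fun h => h ▸ rfl⟩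

theorem Arr.ctorIdx_inj {u v : Arr} : u.ctorIdx = v.ctorIdx ↔ u = v :=
  ⟨fun h => by rw [← Arr.ofNat_ctorIdx u, h, Arr.ofNat_ctorIdx], fun h => h ▸ rfl⟩

theorem Arr.ctorIdx_lt (A : Arr) : A.ctorIdx < 32 := by cases A <;> decide

/-- The machine state `σ` represents the state `s`, as far as array cells below `L` go. -/
structure Rel (W L : ℕ) (s : St) (σ : State) : Prop where
  words : σ.IsWords W
  base : s.reg .D < L
  reg : ∀ v : Var, σ.reg v.ctorIdx = s.reg v
  arr : ∀ (A : Arr) i, i < L → σ.mem (s.reg .D + (32 * i + A.ctorIdx)) = s.arr A i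
  inp : ∀ i < s.reg .D, σ.mem i = s.inp i

section Compile
variable {W L : ℕ}

theorem Ex.cost_comp (e : Ex) : e.comp.cost = e.cost := by
  induction e <;> simp_all [Ex.comp, Ex.cost, Expr.cost]; omega

/-- The base D and the index are below L and the array number is below 32, so the address is below
33 L. The hypothesis 64 L ≤ 2^W therefore prevents any wraparound in computing it. -/
theorem addr_eval {s : St} {σ : State} (hL : 64 * L ≤ 2 ^ W) (h : Rel W L s σ) {e : Ex}
    (he : e.comp.eval W σ = e.val s) (hl : e.val s < L) (A : Arr) :
    (Expr.op .add (.reg Var.D.ctorIdx)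
      (.op .add (.op .mul (.const 32) e.comp) (.const A.ctorIdx))).eval W σ =
      s.reg .D + (32 * e.val s + A.ctorIdx) := by
  have hA := A.ctorIdx_lt
  have hD := h.base
  have h32 : 32 % 2 ^ W = 32 := Nat.mod_eq_of_lt (by omega)
  have hA' : A.ctorIdx % 2 ^ W = A.ctorIdx := Nat.mod_eq_of_lt (by omega)
  have h₁ : (32 * e.val s) % 2 ^ W = 32 * e.val s := Nat.mod_eq_of_lt (by omega)
  have h₂ : (32 * e.val s + A.ctorIdx) % 2 ^ W = 32 * e.val s + A.ctorIdx :=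
    Nat.mod_eq_of_lt (by omega)
  simp only [Expr.eval, BinOp.eval, h.reg, he, h32, hA', h₁, h₂]
  exact Nat.mod_eq_of_lt (by omega)

theorem Ex.comp_eval {s : St} {σ : State} (hL : 64 * L ≤ 2 ^ W) (h : Rel W L s σ) (e : Ex)
    (he : e.safe L s) : e.comp.eval W σ = e.val s := by
  induction e with
  | lit k =>
    have : k < L := he
    exact Nat.mod_eq_of_lt (by omega)
  | var v => exact h.reg v
  | get A e ih =>
    obtain ⟨h₁, h₂⟩ := he
    rw [Ex.comp, Expr.eval, addr_eval hL h (ih h₁) h₂, h.arr A _ h₂]; rfl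
  | inp e ih =>
    obtain ⟨h₁, h₂⟩ := he
    rw [Ex.comp, Expr.eval, ih h₁, h.inp _ h₂]; rfl
  | op o e f ihe ihf =>
    obtain ⟨h₁, h₂, h₃⟩ := he
    have hu := e.comp.eval_lt h.words
    have hv := f.comp.eval_lt h.words
    rw [ihe h₁] at hu
    rw [ihf h₂] at hv
    have hp : 0 < 2 ^ W := by positivity
    have hb := h.base
    rw [Ex.comp, Expr.eval, ihe h₁, ihf h₂, Ex.val]
    cases o <;> simp only [Op.bin, BinOp.eval, Op.val, Op.ok] at h₃ ⊢
    · exact Nat.mod_eq_of_lt (by omega)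
    -- The machine computes u + 2^W - v. Safety gives v ≤ u, so the reduction modulo 2^W leaves the
    -- true difference.
    · rw [Nat.add_comm, Nat.add_sub_assoc h₃, Nat.add_mod_left]
      exact Nat.mod_eq_of_lt (by omega)
    · exact Nat.mod_eq_of_lt (by omega)
    · exact Nat.mod_eq_of_lt ((Nat.div_le_self _ _).trans_lt hu)
    · exact Nat.mod_eq_of_lt ((Nat.mod_le _ _).trans_lt hu)
    · split_ifs
      · exact Nat.mod_eq_of_lt (by omega)
      · exact Nat.mod_eq_of_lt (by omega)
    · split_ifs
      · exact Nat.mod_eq_of_lt (by omega)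
      · exact Nat.mod_eq_of_lt (by omega)

theorem Rel.tick {s : St} {σ : State} (h : Rel W L s σ) (dt : ℕ) : Rel W L (s.tick dt) σ :=
  ⟨h.1, h.2, h.3, h.4, h.5⟩

theorem Rel.assign {s : St} {σ : State} (h : Rel W L s σ) {v : Var} (hv : v ≠ .D) {x : ℕ}
    (hx : x < 2 ^ W) (dt : ℕ) :
    Rel W L (s.setr v x dt) { σ with reg := Function.update σ.reg v.ctorIdx x } := by
  refine ⟨⟨fun i => ?_, h.words.2⟩, ?_, fun u => ?_, ?_, ?_⟩
  · by_cases hi : i = v.ctorIdx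
    · subst hi; simpa using hx
    · simpa [Function.update_of_ne hi] using h.words.1 i
  · simpa [hv.symm] using h.base
  · simp [Function.update_apply, Var.ctorIdx_inj, h.reg]
  · simpa [hv.symm] using h.arr
  · simpa [hv.symm] using h.inp

/-- Array numbers are below 32, so different pairs of array and index have different addresses, and
no such address is below D. A store thus changes one cell of one array and none of the input. -/
theorem Rel.store {s : St} {σ : State} (h : Rel W L s σ) {A : Arr} {i x : ℕ}
    (hx : x < 2 ^ W) (dt : ℕ) :
    Rel W L (s.seta A i x dt)
      { σ with mem := Function.update σ.mem (s.reg .D + (32 * i + A.ctorIdx)) x } := by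
  refine ⟨⟨h.words.1, fun j => ?_⟩, h.base, h.reg, fun A' j hj => ?_, fun j hj => ?_⟩
  · by_cases hj : j = s.reg .D + (32 * i + A.ctorIdx)
    · subst hj; simpa using hx
    · simpa [Function.update_of_ne hj] using h.words.2 j
  · have h₁ := A.ctorIdx_lt
    have h₂ := A'.ctorIdx_lt
    by_cases hA : A' = A
    · subst hA
      by_cases hij : j = i
      · subst hij; simp
      · simp only [St.seta_reg, St.seta_arr, if_true]
        rw [Function.update_of_ne (by omega), Function.update_of_ne hij]
        exact h.arr A' j hj
    · have : A'.ctorIdx ≠ A.ctorIdx := fun h => hA (Arr.ctorIdx_inj.1 h)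
      simp only [St.seta_reg, St.seta_arr, hA, if_false]
      rw [Function.update_of_ne (by omega)]
      exact h.arr A' j hj
  · simp only [St.seta_reg] at hj
    simp only [St.seta_inp]
    rw [Function.update_of_ne (by omega)]
    exact h.inp j hj

theorem Nat.size_eq_succ {x : ℕ} (hx : x ≠ 0) : Nat.size x = Nat.size (x / 2) + 1 := by
  have h₁ := Nat.lt_size_self (x / 2)
  apply le_antisymm
  · rw [Nat.size_le, pow_succ]; omega
  · rw [Nat.succ_le_iff, Nat.lt_size]
    rcases Nat.eq_zero_or_pos (x / 2).size with h | h
    · rw [h]; simp; omega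
    · obtain ⟨k, hk⟩ := Nat.exists_eq_succ_of_ne_zero h.ne'
      have : 2 ^ k ≤ x / 2 := by rw [← Nat.lt_size]; omega
      rw [hk, pow_succ]; omega

theorem size_loop (hL : 64 * L ≤ 2 ^ W) {v tmp : Var} (hvt : v ≠ tmp) (hv : v ≠ .D)
    (ht : tmp ≠ .D) (x : ℕ) : ∀ (s : St) (σ : State), Rel W L s σ → s.reg tmp = x →
    s.reg v + Nat.size x < L →
    ∃ σ', Exec W (.loop (.reg tmp.ctorIdx)
        (.seq (.assign tmp.ctorIdx (.op .div (.reg tmp.ctorIdx) (.const 2)))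
          (.assign v.ctorIdx (.op .add (.reg v.ctorIdx) (.const 1))))) σ σ' (10 * Nat.size x + 2) ∧
      Rel W L ((s.setr tmp 0 0).setr v (s.reg v + Nat.size x) 0) σ' := by
  induction x using Nat.strong_induction_on with
  | _ x ih =>
  intro s σ h hx hl
  by_cases h0 : x = 0
  · subst h0
    refine ⟨σ, ?_, ?_⟩
    · simpa [Expr.cost] using Exec.loop_exit (W := W) (e := .reg tmp.ctorIdx)
        (p := (.seq (.assign tmp.ctorIdx (.op .div (.reg tmp.ctorIdx) (.const 2)))
          (.assign v.ctorIdx (.op .add (.reg v.ctorIdx) (.const 1))))) (s := σ)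
        (by simp [Expr.eval, h.reg, hx])
    · refine ⟨h.1, ?_, fun u => ?_, ?_, ?_⟩
      · simpa [hv.symm, ht.symm] using h.base
      · rw [h.reg]; simp only [St.setr_reg]; split_ifs with h1 h2 <;> simp_all
      · simpa [hv.symm, ht.symm] using h.arr
      · simpa [hv.symm, ht.symm] using h.inp
  · have hs := Nat.size_eq_succ h0
    have hxW : x < 2 ^ W := by rw [← hx, ← h.reg]; exact h.words.1 _
    have h1W : 2 < 2 ^ W := by omega
    have hr1 := h.assign ht (x := x / 2) (by omega) 0
    have hr2 := hr1.assign hv (x := s.reg v + 1) (by omega) 0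
    obtain ⟨σ', he, hr⟩ := ih (x / 2) (by omega) _ _ hr2 (by simp [hvt.symm]) (by simp; omega)
    refine ⟨σ', ?_, ?_⟩
    · have hc : (Expr.reg tmp.ctorIdx).eval W σ ≠ 0 := by simpa [Expr.eval, h.reg, hx] using h0
      have v1 : (Expr.op .div (.reg tmp.ctorIdx) (.const 2)).eval W σ = x / 2 := by
        simp only [Expr.eval, BinOp.eval, h.reg, hx, Nat.mod_eq_of_lt h1W]
        exact Nat.mod_eq_of_lt (by omega)
      have e1 := Exec.assign (W := W) σ tmp.ctorIdx (.op .div (.reg tmp.ctorIdx) (.const 2))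
      have e2 := Exec.assign (W := W) { σ with reg := Function.update σ.reg tmp.ctorIdx (x / 2) }
        v.ctorIdx (.op .add (.reg v.ctorIdx) (.const 1))
      rw [v1] at e1
      have v2 : (Expr.op .add (.reg v.ctorIdx) (.const 1)).eval W
          { σ with reg := Function.update σ.reg tmp.ctorIdx (x / 2) } = s.reg v + 1 := by
        have : v.ctorIdx ≠ tmp.ctorIdx := fun h => hvt (Var.ctorIdx_inj.1 h)
        simp only [Expr.eval, BinOp.eval, Function.update_of_ne this, h.reg,
          Nat.mod_eq_of_lt (show 1 < 2 ^ W by omega)]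
        exact Nat.mod_eq_of_lt (by omega)
      rw [v2] at e2
      have := Exec.loop_step hc (e1.seq e2) he
      convert this using 1
      simp only [Expr.cost, hs]; ring
    · refine ⟨hr.1, ?_, fun u => ?_, ?_, ?_⟩
      · simpa [hv.symm, ht.symm] using h.base
      · rw [hr.reg]; simp only [St.setr_reg]; split_ifs <;> omega
      · simpa [hv.symm, ht.symm] using hr.arr
      · simpa [hv.symm, ht.symm] using hr.inp

/-- The compiler is correct on programs that run without overflow. -/
theorem Cmd.exec_comp (hL : 64 * L ≤ 2 ^ W) (c : Cmd) (hw : c.wf = true) : ∀ (s : St) (σ : State),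
    Rel W L s σ → c.safe L s →
    ∃ σ' t, Exec W c.comp σ σ' t ∧ (c.run s).t = s.t + t ∧ Rel W L (c.run s) σ' := by
  induction c with
  | skip => exact fun s σ h _ => ⟨σ, 0, .skip σ, rfl, h⟩
  | set v e =>
    intro s σ h hs
    have hv := e.comp_eval hL h hs
    have := h.assign (v := v) (by simpa [Cmd.wf] using hw) (hv ▸ e.comp.eval_lt h.words)
      (e.cost + 1)
    refine ⟨_, _, .assign σ v.ctorIdx e.comp, ?_, ?_⟩
    · simp [Cmd.run, e.cost_comp]
    · rw [hv]; exact this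
  | put A e f =>
    intro s σ h ⟨h₁, h₂, h₃⟩
    have hv := f.comp_eval hL h h₂
    have ha := addr_eval hL h (e.comp_eval hL h h₁) h₃ A
    have := h.store (A := A) (i := e.val s) (hv ▸ f.comp.eval_lt h.words) (e.cost + f.cost + 7)
    refine ⟨_, _, .store σ _ f.comp, ?_, ?_⟩
    · simp only [Cmd.run, St.seta_t, Expr.cost, e.cost_comp, f.cost_comp]; ring
    · rw [hv, ha]; exact this
  | seq p q ihp ihq =>
    intro s σ h ⟨h₁, h₂⟩
    simp only [Cmd.wf, Bool.and_eq_true] at hw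
    obtain ⟨σ₁, t₁, e₁, ht₁, r₁⟩ := ihp hw.1 s σ h h₁
    obtain ⟨σ₂, t₂, e₂, ht₂, r₂⟩ := ihq hw.2 _ _ r₁ h₂
    exact ⟨σ₂, t₁ + t₂, e₁.seq e₂, by rw [Cmd.run, ht₂, ht₁, Nat.add_assoc], r₂⟩
  | ite e p q ihp ihq =>
    intro s σ h ⟨h₁, h₂⟩
    simp only [Cmd.wf, Bool.and_eq_true] at hw
    have hv := e.comp_eval hL h h₁
    by_cases hc : e.val s = 0
    · simp only [hc, ne_eq, not_true, if_false] at h₂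
      obtain ⟨σ₂, t₂, e₂, ht₂, r₂⟩ := ihq hw.2 _ _ (h.tick _) h₂
      refine ⟨σ₂, _, .ite_false (hv.trans hc) e₂, ?_, ?_⟩
      · simp only [Cmd.run, hc, ne_eq, not_true, if_false, ht₂, e.cost_comp, St.tick_t]; ring
      · simpa [Cmd.run, hc] using r₂
    · simp only [hc, ne_eq, not_false_eq_true, if_true] at h₂
      obtain ⟨σ₂, t₂, e₂, ht₂, r₂⟩ := ihp hw.1 _ _ (h.tick _) h₂
      refine ⟨σ₂, _, .ite_true (by rwa [hv]) e₂, ?_, ?_⟩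
      · simp only [Cmd.run, hc, ne_eq, not_false_eq_true, if_true, ht₂, e.cost_comp, St.tick_t]
        ring
      · simpa [Cmd.run, hc] using r₂
  | rep i lim e p ihp =>
    intro s σ h ⟨h₁, h₂, h₃⟩
    simp only [Cmd.wf, Bool.and_eq_true, Bool.not_eq_true', decide_eq_true_eq] at hw
    obtain ⟨⟨⟨⟨⟨hw, hmi⟩, hml⟩, hil⟩, hiD⟩, hlD⟩ := hw
    have hv := e.comp_eval hL h h₁
    have r₁ := h.assign (v := lim) hlD (hv ▸ e.comp.eval_lt h.words) (e.cost + 1)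
    have e₁ := Exec.assign (W := W) σ lim.ctorIdx e.comp
    rw [hv, e.cost_comp] at e₁
    have r₂ := r₁.assign (v := i) hiD (x := 0) (by positivity) 2
    have e₂ := Exec.assign (W := W) { σ with reg := Function.update σ.reg lim.ctorIdx (e.val s) }
      i.ctorIdx (.const 0)
    rw [show (Expr.const 0).eval W { σ with reg := Function.update σ.reg lim.ctorIdx (e.val s) } = 0
      from Nat.zero_mod _] at e₂
    generalize hn : e.val s = n at *
    set s₀ := (s.setr lim n (e.cost + 1)).setr i 0 2 with hs₀
    generalize { { σ with reg := Function.update σ.reg lim.ctorIdx n } with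
      reg := Function.update (Function.update σ.reg lim.ctorIdx n) i.ctorIdx 0 } = σ₀ at r₂ e₂
    set F : ℕ → St → St := fun k s' => (p.run (s'.tick 4)).setr i (k + 1) 4 with hF
    have hi : ∀ k, (iter F s₀ k).reg i = k ∧ (iter F s₀ k).reg lim = n := by
      intro k
      induction k with
      | zero => simp [iter, hs₀, hil.symm]
      | succ k ih =>
        have := (p.run_same ((iter F s₀ k).tick 4)).reg' lim hml
        simp [iter, hF, hil.symm] at this ⊢
        rw [this, ih.2]
    -- Induction on the number j of rounds still to come, since the machine's loop unfolds from its
    -- first round. That the machine's counter and bound agree with the round number and n is `hi`;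
    -- it needs that the body changes neither.
    have main : ∀ j, j ≤ n → ∀ σ₁, Rel W L (iter F s₀ (n - j)) σ₁ →
        ∃ σ' t, Exec W (.loop (.op .lt (.reg i.ctorIdx) (.reg lim.ctorIdx))
          (.seq p.comp (.assign i.ctorIdx (.op .add (.reg i.ctorIdx) (.const 1))))) σ₁ σ' t ∧
          (iter F s₀ n).t + 4 = (iter F s₀ (n - j)).t + t ∧ Rel W L (iter F s₀ n) σ' := by
      intro j
      induction j with
      | zero =>
        intro _ σ₁ hr
        refine ⟨σ₁, _, .loop_exit ?_, rfl, hr⟩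
        have := hi n
        simp [Expr.eval, BinOp.eval, hr.reg, this.1, this.2]
      | succ j ih =>
        intro hj σ₁ hr
        have hk : n - j = (n - (j + 1)) + 1 := by omega
        set k := n - (j + 1) with hk'
        have hkn : k < n := by omega
        obtain ⟨σ₂, t₂, ex₂, ht₂, hr₂⟩ := ihp hw _ _ (hr.tick 4) (h₃ k hkn)
        have hreg : σ₂.reg i.ctorIdx = k := by
          rw [hr₂.reg, (p.run_same _).reg' i hmi]; exact (hi k).1
        have hr₃ := hr₂.assign hiD (x := k + 1) (by omega) 4
        have ex₃ := Exec.assign (W := W) σ₂ i.ctorIdx (.op .add (.reg i.ctorIdx) (.const 1))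
        rw [show (Expr.op .add (.reg i.ctorIdx) (.const 1)).eval W σ₂ = k + 1 by
          simp only [Expr.eval, BinOp.eval, hreg, Nat.mod_eq_of_lt (show 1 < 2 ^ W by omega)]
          exact Nat.mod_eq_of_lt (by omega)] at ex₃
        have hit : iter F s₀ (n - j) = (p.run ((iter F s₀ k).tick 4)).setr i (k + 1) 4 := by
          rw [hk, iter]
        rw [← hit] at hr₃
        obtain ⟨σ', t', ex', ht', hr'⟩ := ih (by omega) _ hr₃
        refine ⟨σ', _, .loop_step ?_ (ex₂.seq ex₃) ex', ?_, hr'⟩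
        · simp only [Expr.eval, BinOp.eval, hr.reg, (hi k).1, (hi k).2, hkn, if_true]
          rw [Nat.mod_eq_of_lt (show 1 < 2 ^ W by omega)]; omega
        · rw [ht', hit]
          simp only [St.setr_t, ht₂, Expr.cost, St.tick_t]; ring
    obtain ⟨σ', t, ex, ht, hr⟩ := main n le_rfl σ₀ (by simpa [iter] using r₂)
    refine ⟨σ', _, e₁.seq (e₂.seq ex), ?_, ?_⟩
    · simp only [Cmd.run, St.tick_t, hn]
      rw [ht]
      simp only [Nat.sub_self, iter, hs₀, St.setr_t, Expr.cost]; ring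
    · simp only [Cmd.run, hn]; exact hr.tick 4
  | size v tmp e =>
    intro s σ h ⟨h₁, h₂⟩
    simp only [Cmd.wf, Bool.and_eq_true, decide_eq_true_eq] at hw
    obtain ⟨⟨hvt, hvD⟩, htD⟩ := hw
    have hv := e.comp_eval hL h h₁
    have r₁ := h.assign (v := tmp) htD (hv ▸ e.comp.eval_lt h.words) (e.cost + 1)
    have e₁ := Exec.assign (W := W) σ tmp.ctorIdx e.comp
    rw [hv, e.cost_comp] at e₁
    have r₂ := r₁.assign (v := v) hvD (x := 0) (by positivity) 2
    have e₂ := Exec.assign (W := W) { σ with reg := Function.update σ.reg tmp.ctorIdx (e.val s) }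
      v.ctorIdx (.const 0)
    rw [show (Expr.const 0).eval W { σ with reg := Function.update σ.reg tmp.ctorIdx (e.val s) } = 0
      from Nat.zero_mod _] at e₂
    obtain ⟨σ', ex, hr⟩ := size_loop hL hvt hvD htD (e.val s) _ _ r₂ (by simp [hvt.symm])
      (by simpa using h₂)
    refine ⟨σ', _, e₁.seq (e₂.seq ex), ?_, ?_⟩
    · simp only [Cmd.run, St.setr_t, Expr.cost]; ring
    · refine ⟨hr.1, ?_, fun u => ?_, ?_, ?_⟩
      · simpa [Cmd.run, hvD.symm, htD.symm] using h.base
      · rw [hr.reg]; simp only [Cmd.run, St.setr_reg]; split_ifs <;> simp_all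
      · simpa [Cmd.run, hvD.symm, htD.symm] using hr.arr
      · simpa [Cmd.run, hvD.symm, htD.symm] using hr.inp

end Compile

end RectDrop

/-! # Reasoning about programs of the loop language -/

namespace RectDrop

set_option linter.constructorNameAsVariable false

/-- From state `s`, the program `c` runs without overflow and ends in a state with `Q`. -/
def Ok (L : ℕ) (c : Cmd) (s : St) (Q : St → Prop) : Prop := c.safe L s ∧ Q (c.run s)

section Rules
variable {L : ℕ} {c p q : Cmd} {s : St} {Q R : St → Prop} {e f : Ex} {v i lim tmp : Var} {A : Arr}

@[simp] theorem Ok_skip : Ok L .skip s Q ↔ Q s := by simp [Ok, Cmd.safe, Cmd.run]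

@[simp] theorem Ok_set : Ok L (.set v e) s Q ↔
    e.safe L s ∧ Q (s.setr v (e.val s) (e.cost + 1)) := Iff.rfl

@[simp] theorem Ok_put : Ok L (.put A e f) s Q ↔
    e.safe L s ∧ f.safe L s ∧ e.val s < L ∧
      Q (s.seta A (e.val s) (f.val s) (e.cost + f.cost + 7)) := by
  simp [Ok, Cmd.safe, Cmd.run, and_assoc]

@[simp] theorem Ok_seq : Ok L (p ;; q) s Q ↔ Ok L p s fun s' => Ok L q s' Q := by
  simp [Ok, Cmd.safe, Cmd.run, and_assoc]

@[simp] theorem Ok_ite : Ok L (.ite e p q) s Q ↔ e.safe L s ∧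
    (e.val s ≠ 0 → Ok L p (s.tick (e.cost + 1)) Q) ∧
    (e.val s = 0 → Ok L q (s.tick (e.cost + 1)) Q) := by
  by_cases h : e.val s = 0 <;> simp [Ok, Cmd.safe, Cmd.run, h, and_assoc]

@[simp] theorem Ok_size : Ok L (.size v tmp e) s Q ↔ e.safe L s ∧ Nat.size (e.val s) < L ∧
    Q ((s.setr tmp 0 (e.cost + 5)).setr v (Nat.size (e.val s)) (10 * Nat.size (e.val s))) := by
  simp [Ok, Cmd.safe, Cmd.run, and_assoc]

theorem Ok.mono (h : Ok L c s Q) (hQ : ∀ s', Q s' → R s') : Ok L c s R := ⟨h.1, hQ _ h.2⟩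

theorem Ok.same (h : Ok L c s Q) : Ok L c s fun s' => Q s' ∧ Same c s s' :=
  ⟨h.1, h.2, c.run_same s⟩

theorem Ok.bind (h : Ok L c s Q) (hQ : ∀ s', Q s' → Same c s s' → R s') : Ok L c s R :=
  h.same.mono fun s' h => hQ s' h.1 h.2

/-- Sequencing, with the frame of the first program. -/
theorem Ok.seq (h : Ok L p s Q) (hQ : ∀ s', Q s' → Same p s s' → Ok L q s' R) :
    Ok L (p ;; q) s R := by
  rw [Ok_seq]; exact h.same.mono fun s' h => hQ s' h.1 h.2

/-- The rule for counted loops. -/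
theorem Ok.rep (I : ℕ → St → Prop) (N Tb : ℕ) (he : e.safe L s) (hN : e.val s = N) (hNL : N < L)
    (h0 : I 0 ((s.setr lim N (e.cost + 1)).setr i 0 2))
    (hb : ∀ k < N, ∀ s', I k s' → s'.reg i = k → Same (.rep i lim e p) s s' →
      Ok L p s' fun s'' => s''.t ≤ s'.t + Tb ∧ I (k + 1) (s''.setr i (k + 1) 4))
    (hI : ∀ k s d, I k s → I k (s.tick d) := by exact fun _ _ _ h => h) :
    Ok L (.rep i lim e p) s fun s' => s'.t ≤ s.t + (N * (Tb + 8) + e.cost + 7) ∧ I N s' ∧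
      s'.reg i = N := by
  subst hN
  set s₀ := (s.setr lim (e.val s) (e.cost + 1)).setr i 0 2 with hs₀
  set F : ℕ → St → St := fun k s' => (p.run (s'.tick 4)).setr i (k + 1) 4 with hF
  have hsame : Same (.rep i lim e p) s s₀ := by
    refine ⟨fun v hv => ?_, fun _ _ => rfl, rfl⟩
    simp only [Cmd.mods, Bool.or_eq_false_iff, decide_eq_false_iff_not] at hv
    simp [hs₀, hv.1.1, hv.1.2]
  -- The 8 extra steps of a round are 4 for the loop test and 4 for incrementing the counter.
  have key : ∀ k ≤ e.val s, (iter F s₀ k).t ≤ s₀.t + k * (Tb + 8) ∧ I k (iter F s₀ k) ∧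
      (iter F s₀ k).reg i = k := by
    intro k
    induction k with
    | zero => intro _; simpa [iter, hs₀] using h0
    | succ k ih =>
      intro hk
      obtain ⟨h₁, h₂, h₃⟩ := ih (by omega)
      have h₄ := iter_same p.run_same hsame k
      have := hb k (by omega) ((iter F s₀ k).tick 4) (hI _ _ _ h₂) h₃ ⟨h₄.1, h₄.2, h₄.3⟩
      obtain ⟨-, h₅, h₆⟩ := this
      refine ⟨?_, h₆, by simp [iter, hF]⟩
      simp only [iter, hF, St.setr_t, St.tick_t] at h₁ h₅ ⊢
      rw [Nat.succ_mul]; omega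
  refine ⟨⟨he, hNL, fun k hk => ?_⟩, ?_, ?_, ?_⟩
  · obtain ⟨h₁, h₂, h₃⟩ := key k hk.le
    have h₄ := iter_same p.run_same hsame k
    exact (hb k hk ((iter F s₀ k).tick 4) (hI _ _ _ h₂) h₃ ⟨h₄.1, h₄.2, h₄.3⟩).1
  · have := (key _ le_rfl).1
    simp only [hs₀, St.setr_t] at this
    simp only [Cmd.run, St.tick_t]
    refine (Nat.add_le_add_right this 4).trans ?_
    omega
  · exact hI _ _ _ (key _ le_rfl).2.1
  · exact (key _ le_rfl).2.2

end Rules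

/-! ### Initial segments of arrays as lists -/

/-- The first `n` values of `f`, as a list. -/
def seg (f : ℕ → ℕ) (n : ℕ) : List ℕ := (List.range n).map f

@[simp] theorem seg_length (f : ℕ → ℕ) (n : ℕ) : (seg f n).length = n := by simp [seg]

@[simp] theorem seg_zero (f : ℕ → ℕ) : seg f 0 = [] := rfl

theorem seg_succ (f : ℕ → ℕ) (n : ℕ) : seg f (n + 1) = seg f n ++ [f n] := by
  simp [seg, List.range_succ]

theorem seg_congr {f g : ℕ → ℕ} {n : ℕ} (h : ∀ i < n, f i = g i) : seg f n = seg g n :=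
  List.map_congr_left fun i hi => h i (List.mem_range.1 hi)

@[simp] theorem seg_update (f : ℕ → ℕ) (n x : ℕ) : seg (Function.update f n x) n = seg f n :=
  seg_congr fun i hi => Function.update_of_ne (by omega) _ _

theorem mem_seg {f : ℕ → ℕ} {n x : ℕ} : x ∈ seg f n ↔ ∃ i < n, f i = x := by
  simp [seg]

abbrev V (v : Var) : Ex := .var v
abbrev get (A : Arr) (e : Ex) : Ex := .get A e
abbrev set (v : Var) (e : Ex) : Cmd := .set v e
abbrev put (A : Arr) (e f : Ex) : Cmd := .put A e f

/-! ## Sorting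

Radix sort with base two: the indices in `ID` are sorted by their keys. -/

/-- Append to `TMP` the indices whose key has the digit `b`. -/
def part (b : ℕ) : Cmd :=
  .rep .i .il (V .z) (.ite (((get .KEY (get .ID (V .i)) / V .pw) % 2).eq (.lit b))
    (put .TMP (V .t) (get .ID (V .i)) ;; set .t (V .t + 1)) .skip)

theorem part_ok {L : ℕ} {s : St} (b : ℕ) (hz : s.reg .z < L) (hq : s.reg .t + s.reg .z < L)
    (hID : ∀ i < s.reg .z, s.arr .ID i < L) (hb : b < L) (h2 : 2 < L) :
    Ok L (part b) s fun s' => s'.t ≤ s.t + (s.reg .z * 60 + 10) ∧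
      seg (s'.arr .TMP) (s'.reg .t) = seg (s.arr .TMP) (s.reg .t) ++
        (seg (s.arr .ID) (s.reg .z)).filter (fun j => s.arr .KEY j / s.reg .pw % 2 = b) := by
  refine (Ok.rep (fun k s' => seg (s'.arr .TMP) (s'.reg .t) = seg (s.arr .TMP) (s.reg .t) ++
        (seg (s.arr .ID) k).filter (fun j => s.arr .KEY j / s.reg .pw % 2 = b)) (s.reg .z) 52
      ?_ ?_ ?_ ?_ ?_).mono ?_
  · simp
  · simp
  · exact hz
  · simp
  · intro k hk s' hI hi hs
    have := congrArg List.length hI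
    simp only [seg_length, List.length_append] at this
    have h3 := List.length_filter_le (fun j => s.arr .KEY j / s.reg .pw % 2 = b) (seg (s.arr .ID) k)
    simp only [seg_length] at h3
    have := hID k hk
    simp [hs.arr .KEY, hs.arr .ID, hs.reg .pw, hi]
    refine ⟨by omega, fun h => ⟨by omega, by omega, by omega, ?_⟩, fun h => ?_⟩
    · simp [seg_succ, List.filter_append, hI, h]
    · simp [seg_succ, List.filter_append, hI, h]
  · simp
    intro s' h₁ h₂ h₃
    exact ⟨by omega, h₂⟩

/-- One round of radix sort. Filtering keeps the order, so elements with equal digit j stay sorted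
by their lower digits, while an element with digit 0 precedes one with digit 1 because the lower
part is below 2^j. -/
theorem pairwise_digit {key : ℕ → ℕ} {l : List ℕ} {j : ℕ}
    (h : l.Pairwise fun a b => key a % 2 ^ j ≤ key b % 2 ^ j) :
    (l.filter (fun a => key a / 2 ^ j % 2 = 0) ++
      l.filter (fun a => key a / 2 ^ j % 2 = 1)).Pairwise
      fun a b => key a % 2 ^ (j + 1) ≤ key b % 2 ^ (j + 1) := by
  rw [List.pairwise_append]
  simp only [Nat.mod_pow_succ, List.mem_filter, decide_eq_true_eq]
  refine ⟨?_, ?_, ?_⟩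
  · refine List.Pairwise.imp_of_mem ?_ (h.filter _)
    intro a b ha hb hab
    simp only [List.mem_filter, decide_eq_true_eq] at ha hb
    simpa [ha.2, hb.2] using hab
  · refine List.Pairwise.imp_of_mem ?_ (h.filter _)
    intro a b ha hb hab
    simp only [List.mem_filter, decide_eq_true_eq] at ha hb
    simpa [ha.2, hb.2] using hab
  · intro a ha b hb
    have := Nat.mod_lt (key a) (show 0 < 2 ^ j by positivity)
    rw [ha.2, hb.2]; omega

theorem perm_digit (d : ℕ → ℕ) (l : List ℕ) :
    (l.filter (fun a => d a % 2 = 0) ++ l.filter (fun a => d a % 2 = 1)).Perm l := by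
  have := List.filter_append_perm (fun a => decide (d a % 2 = 0)) l
  convert this using 5 with a
  rcases Nat.mod_two_eq_zero_or_one (d a) with h | h <;> simp [h]

def sort : Cmd :=
  set .pw 1 ;; .rep .g .gl (V .LG) (set .t 0 ;; part 0 ;; part 1 ;;
    .rep .i .il (V .z) (put .ID (V .i) (get .TMP (V .i))) ;; set .pw (V .pw * 2))

/-- After k rounds the indices are sorted by their keys modulo 2^k. All keys are below 2^LG, so
after LG rounds the reduction does nothing. -/
theorem sort_ok {L : ℕ} {s : St} (hz2 : 2 * s.reg .z < L) (hID : ∀ i < s.reg .z, s.arr .ID i < L)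
    (hLG : s.reg .LG < L) (hpw : 2 ^ s.reg .LG < L) (h2 : 2 < L)
    (hkey : ∀ i < s.reg .z, s.arr .KEY (s.arr .ID i) < 2 ^ s.reg .LG) :
    Ok L sort s fun s' => s'.t ≤ s.t + (s.reg .LG * (s.reg .z * 150 + 100) + 20) ∧
      (seg (s'.arr .ID) (s.reg .z)).Perm (seg (s.arr .ID) (s.reg .z)) ∧
      (seg (s'.arr .ID) (s.reg .z)).Pairwise fun a b => s.arr .KEY a ≤ s.arr .KEY b := by
  set zz := s.reg .z with hzz
  have hz : zz < L := by omega
  rw [sort, Ok_seq, Ok_set]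
  refine ⟨by simp; omega, ?_⟩
  refine (Ok.rep (fun k s' => s'.reg .pw = 2 ^ k ∧
      (seg (s'.arr .ID) zz).Perm (seg (s.arr .ID) zz) ∧
      (seg (s'.arr .ID) zz).Pairwise fun a b => s.arr .KEY a % 2 ^ k ≤ s.arr .KEY b % 2 ^ k)
      (s.reg .LG) (zz * 150 + 92) ?_ ?_ ?_ ?_ ?_).mono ?_
  · simp
  · simp
  · exact hLG
  · simp [Nat.mod_one, List.pairwise_iff_getElem]
  · rintro k hk s' ⟨hp, hperm, hpair⟩ hi hs
    have hz' : s'.reg .z = zz := hs.reg .z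
    have hK : s'.arr .KEY = s.arr .KEY := hs.arr .KEY
    have hIDL : ∀ i < zz, s'.arr .ID i < L := fun i hi => by
      obtain ⟨j, hj, h⟩ := mem_seg.1 (hperm.subset (mem_seg.2 ⟨i, hi, rfl⟩))
      rw [← h]; exact hID j hj
    rw [Ok_seq, Ok_set]
    refine ⟨by simp; omega, ?_⟩
    refine (part_ok 0 ?_ ?_ ?_ ?_ h2).seq ?_ <;> (try simp [hz', hK, hp])
    · exact hz
    · exact hz
    · exact hIDL
    · omega
    intro s₁ ht₁ hseg₁ hs₁
    have hz₁ : s₁.reg .z = zz := by simp [hs₁.reg .z, hz']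
    have hID₁ : s₁.arr .ID = s'.arr .ID := by simp [hs₁.arr .ID]
    have hK₁ : s₁.arr .KEY = s.arr .KEY := by simp [hs₁.arr .KEY, hK]
    have hp₁ : s₁.reg .pw = 2 ^ k := by simp [hs₁.reg .pw, hp]
    have hq₁ := congrArg List.length hseg₁
    have hlen := (perm_digit (fun j => s.arr .KEY j / 2 ^ k) (seg (s'.arr .ID) zz)).length_eq
    simp only [seg_length, List.length_append] at hq₁ hlen
    refine (part_ok 1 ?_ ?_ ?_ ?_ h2).bind ?_ <;> (try simp only [hz₁, hID₁, hK₁, hp₁])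
    · exact hz
    · omega
    · exact hIDL
    · omega
    rintro s₂ ⟨ht₂, hseg₂⟩ hs₂
    have hz₂ : s₂.reg .z = zz := by simp [hs₂.reg .z, hz₁]
    have hp₂ : s₂.reg .pw = 2 ^ k := by simp [hs₂.reg .pw, hp₁]
    rw [hseg₁] at hseg₂
    have hq₂ := congrArg List.length hseg₂
    simp only [seg_length, List.length_append, hlen] at hq₂
    rw [hq₂] at hseg₂
    refine (Ok.rep (fun k s' => seg (s'.arr .ID) k = seg (s₂.arr .TMP) k)
      zz 20 ?_ ?_ ?_ ?_ ?_).bind ?_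
    · simp
    · simpa using hz₂
    · exact hz
    · simp
    · intro j hj s' hI hi hs
      simp [hs.arr .TMP, hi, seg_succ, hI]; omega
    rintro s₃ ⟨ht₃, hI₃, hi₃⟩ hs₃
    have hp₃ : s₃.reg .pw = 2 ^ k := by simp [hs₃.reg .pw, hp₂]
    have hkk : 2 ^ (k + 1) ≤ 2 ^ s.reg .LG := Nat.pow_le_pow_right (by norm_num) (by omega)
    rw [hseg₂] at hI₃
    simp [hI₃, hp₃]
    simp at ht₃
    refine ⟨⟨by omega, by rw [pow_succ] at hkk; omega⟩, by omega, by rw [pow_succ], ?_, ?_⟩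
    · exact (perm_digit _ _).trans hperm
    · exact pairwise_digit hpair
  · simp
    intro s' h₁ h₂ h₃ h₄ h₅
    rw [show zz * 150 + 92 + 8 = zz * 150 + 100 from rfl] at h₁
    refine ⟨by omega, h₃, ?_⟩
    refine List.Pairwise.imp_of_mem ?_ h₄
    intro a b ha hb hab
    have hk : ∀ a ∈ seg (s'.arr .ID) zz, s.arr .KEY a < 2 ^ s.reg .LG := fun a ha => by
      obtain ⟨i, hi, rfl⟩ := mem_seg.1 (h₃.subset ha)
      exact hkey i hi
    rwa [Nat.mod_eq_of_lt (hk a ha), Nat.mod_eq_of_lt (hk b hb)] at hab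

end RectDrop

/-! # Step functions and their runs -/

namespace RectDrop

/-- On the interval from `X 0` to `X z`, the function `h` is a step function with breakpoints `X`
and values `H`. -/
structure Pcs (h X H : ℕ → ℕ) (z : ℕ) : Prop where
  lt : ∀ i < z, X i < X (i + 1)
  val : ∀ i < z, ∀ j, X i ≤ j → j < X (i + 1) → h j = H i

theorem Pcs.mono {h X H : ℕ → ℕ} {z : ℕ} (hP : Pcs h X H z) {i j : ℕ} (hij : i ≤ j) (hj : j ≤ z) :
    X i ≤ X j := by
  induction j, hij using Nat.le_induction with
  | base => exact le_rfl
  | succ j hij ih => exact (ih (by omega)).trans (hP.lt j (by omega)).le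

theorem Pcs.prefix {h X H : ℕ → ℕ} {q z : ℕ} (hP : Pcs h X H q) (hz : z ≤ q) : Pcs h X H z :=
  ⟨fun i hi => hP.lt i (by omega), fun i hi => hP.val i (by omega)⟩

theorem Pcs.find {h X H : ℕ → ℕ} {z : ℕ} (hP : Pcs h X H z) {j : ℕ} (h0 : X 0 ≤ j)
    (hz : j < X z) : ∃ i < z, X i ≤ j ∧ j < X (i + 1) := by
  induction z with
  | zero => omega
  | succ z ih =>
    by_cases hj : j < X z
    · obtain ⟨i, hi, h⟩ := ih (hP.prefix (Nat.le_succ z)) hj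
      exact ⟨i, by omega, h⟩
    · exact ⟨z, by omega, by omega, hz⟩

/-- Appending a step. -/
theorem Pcs.push {h X H : ℕ → ℕ} {q : ℕ} (hP : Pcs h X H q) {en v : ℕ} (hen : X q < en)
    (hv : ∀ j, X q ≤ j → j < en → h j = v) :
    Pcs h (Function.update X (q + 1) en) (Function.update H q v) (q + 1) := by
  refine ⟨fun i hi => ?_, fun i hi j => ?_⟩
  · rcases Nat.lt_succ_iff_lt_or_eq.1 hi with hi | rfl
    · rw [Function.update_of_ne (by omega), Function.update_of_ne (by omega)]; exact hP.lt i hi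
    · rw [Function.update_of_ne (by omega), Function.update_self]; exact hen
  · rcases Nat.lt_succ_iff_lt_or_eq.1 hi with hi | rfl
    · rw [Function.update_of_ne (by omega), Function.update_of_ne (by omega),
        Function.update_of_ne (by omega)]
      exact hP.val i hi j
    · rw [Function.update_of_ne (by omega), Function.update_self, Function.update_self]
      exact hv j

theorem Pcs.congr {h X H X' H' : ℕ → ℕ} {z : ℕ} (hP : Pcs h X H z) (hX : ∀ i ≤ z, X' i = X i)
    (hH : ∀ i < z, H' i = H i) : Pcs h X' H' z := by
  refine ⟨fun i hi => ?_, fun i hi j => ?_⟩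
  · rw [hX i hi.le, hX (i + 1) hi]; exact hP.lt i hi
  · rw [hX i hi.le, hX (i + 1) hi, hH i hi]; exact hP.val i hi j

theorem Pcs.congr_fun {h h' X H : ℕ → ℕ} {z : ℕ} (hP : Pcs h X H z)
    (hh : ∀ j, X 0 ≤ j → j < X z → h' j = h j) : Pcs h' X H z := by
  refine ⟨hP.lt, fun i hi j h₁ h₂ => ?_⟩
  rw [hh j ((hP.mono (Nat.zero_le i) hi.le).trans h₁) (h₂.trans_le (hP.mono hi le_rfl))]
  exact hP.val i hi j h₁ h₂

/-- The part of a step function between two breakpoints. -/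
theorem Pcs.sub {h X H : ℕ → ℕ} {q o z : ℕ} (hP : Pcs h X H q) (hz : o + z ≤ q) :
    Pcs h (fun i => X (o + i)) (fun i => H (o + i)) z :=
  ⟨fun i hi => hP.lt (o + i) (by omega), fun i hi => hP.val (o + i) (by omega)⟩

/-- On `[st, en)`: the initial run of values at most `y` ends at `P`, the final one starts at `S`,
and a longest one has length `M` and starts at `ST`. -/
structure RowOK (h : ℕ → ℕ) (st en y P M ST S : ℕ) : Prop where
  st_le_P : st ≤ P
  P_le : P ≤ en
  P_run : ∀ j, st ≤ j → j < P → h j ≤ y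
  P_max : P < en → y < h P
  st_le_S : st ≤ S
  S_le : S ≤ en
  S_run : ∀ j, S ≤ j → j < en → h j ≤ y
  S_max : st < S → y < h (S - 1)
  st_le : st ≤ ST
  le_en : ST + M ≤ en
  run : ∀ j, ST ≤ j → j < ST + M → h j ≤ y
  max : ∀ u v, st ≤ u → u ≤ v → v ≤ en → (∀ j, u ≤ j → j < v → h j ≤ y) → v ≤ u + M

/-! ### Merging runs of active steps -/

/-- The maximal runs of active steps: `a j` is the start of the one that ends at `j`, and `b j` is
the end of the one that starts at `j`. -/
structure Runs (z : ℕ) (act : ℕ → Prop) (a b : ℕ → ℕ) : Prop where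
  a_le : ∀ j ≤ z, (j < z → ¬ act j) → a j ≤ j
  a_run : ∀ j ≤ z, (j < z → ¬ act j) → ∀ i, a j ≤ i → i < j → act i
  a_max : ∀ j ≤ z, (j < z → ¬ act j) → 0 < a j → ¬ act (a j - 1)
  b_ge : ∀ j ≤ z, (0 < j → ¬ act (j - 1)) → j ≤ b j
  b_le : ∀ j ≤ z, (0 < j → ¬ act (j - 1)) → b j ≤ z
  b_run : ∀ j ≤ z, (0 < j → ¬ act (j - 1)) → ∀ i, j ≤ i → i < b j → act i
  b_max : ∀ j ≤ z, (0 < j → ¬ act (j - 1)) → b j < z → ¬ act (b j)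

theorem Runs.init {z : ℕ} {act : ℕ → Prop} {a b : ℕ → ℕ} (ha : ∀ j ≤ z, a j = j)
    (hb : ∀ j ≤ z, b j = j) (hact : ∀ i, ¬ act i) : Runs z act a b := by
  constructor
  · intro j hj _; rw [ha j hj]
  · intro j hj _ i h₁ h₂; rw [ha j hj] at h₁; omega
  · intro j hj _ _; exact hact _
  · intro j hj _; rw [hb j hj]
  · intro j hj _; rw [hb j hj]; exact hj
  · intro j hj _ i h₁ h₂; rw [hb j hj] at h₂; omega
  · intro j hj _ _; exact hact _

/-- Activating a step merges two runs. -/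
theorem Runs.insert {z : ℕ} {act : ℕ → Prop} {a b : ℕ → ℕ} (hR : Runs z act a b) {k : ℕ}
    (hk : k < z) (hact : ¬ act k) :
    Runs z (fun i => act i ∨ i = k) (Function.update a (b (k + 1)) (a k))
      (Function.update b (a k) (b (k + 1))) := by
  have a1 := hR.a_le k hk.le fun _ => hact
  have a2 := hR.a_run k hk.le fun _ => hact
  have a3 := hR.a_max k hk.le fun _ => hact
  have b0 := hR.b_ge (k + 1) hk fun _ => hact
  have b1 := hR.b_le (k + 1) hk fun _ => hact
  have b2 := hR.b_run (k + 1) hk fun _ => hact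
  have b3 := hR.b_max (k + 1) hk fun _ => hact
  -- The new run consists of the run ending at k, step k itself and the run starting at k + 1. Only
  -- the entries at its two outer ends are corrected. The entries inside it become stale, but the
  -- guards in `Runs` demand nothing of them, because their neighbouring step is active.
  have run : ∀ i, a k ≤ i → i < b (k + 1) → act i ∨ i = k := by
    intro i h₁ h₂
    rcases lt_trichotomy i k with h | h | h
    · exact .inl (a2 i h₁ h)
    · exact .inr h
    · exact .inl (b2 i h h₂)
  constructor
  · intro j hj hn
    by_cases h : j = b (k + 1)
    · subst h; simp; omega
    · rw [Function.update_of_ne h]; exact hR.a_le j hj fun h hh => hn h (.inl hh)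
  · intro j hj hn
    by_cases h : j = b (k + 1)
    · subst h; simpa using run
    · rw [Function.update_of_ne h]
      exact fun i h₁ h₂ => .inl (hR.a_run j hj (fun h hh => hn h (.inl hh)) i h₁ h₂)
  · intro j hj hn
    by_cases h : j = b (k + 1)
    · subst h
      simp only [Function.update_self]
      rintro h₁ (h₂ | h₂)
      · exact a3 h₁ h₂
      · omega
    · rw [Function.update_of_ne h]
      rintro h₁ (h₂ | h₂)
      · exact hR.a_max j hj (fun h hh => hn h (.inl hh)) h₁ h₂
      -- Here the old run ending at j starts right after k. By maximality of the run that starts at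
      -- k + 1, its end is j, which is the updated entry.
      · have hj1 := hR.a_run j hj (fun h hh => hn h (.inl hh))
        have hj2 := hR.a_le j hj (fun h hh => hn h (.inl hh))
        have hkj : k + 1 ≤ j := by omega
        rcases lt_trichotomy j (b (k + 1)) with h3 | h3 | h3
        · exact hn (by omega) (.inl (b2 j hkj h3))
        · exact h h3
        · exact b3 (by omega) (hj1 _ (by omega) h3)
  · intro j hj hn
    by_cases h : j = a k
    · subst h; simp; omega
    · rw [Function.update_of_ne h]; exact hR.b_ge j hj fun h hh => hn h (.inl hh)
  · intro j hj hn
    by_cases h : j = a k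
    · subst h; simpa using b1
    · rw [Function.update_of_ne h]; exact hR.b_le j hj fun h hh => hn h (.inl hh)
  · intro j hj hn
    by_cases h : j = a k
    · subst h; simpa using run
    · rw [Function.update_of_ne h]
      exact fun i h₁ h₂ => .inl (hR.b_run j hj (fun h hh => hn h (.inl hh)) i h₁ h₂)
  · intro j hj hn
    by_cases h : j = a k
    · subst h
      simp only [Function.update_self]
      rintro h₁ (h₂ | h₂)
      · exact b3 h₁ h₂
      · omega
    · rw [Function.update_of_ne h]
      rintro h₁ (h₂ | h₂)
      · exact hR.b_max j hj (fun h hh => hn h (.inl hh)) h₁ h₂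
      · have hj1 := hR.b_run j hj (fun h hh => hn h (.inl hh))
        have hj2 := hR.b_ge j hj (fun h hh => hn h (.inl hh))
        have hkj : j ≤ k := by omega
        rcases lt_trichotomy j (a k) with h3 | h3 | h3
        · exact a3 (by omega) (hj1 _ (by omega) (by omega))
        · exact h h3
        · exact hn (by omega) (.inl (a2 (j - 1) (by omega) (by omega)))

/-- A longest run of active steps starts at position `ST` and has length `M`. -/
def Best (X : ℕ → ℕ) (z : ℕ) (act : ℕ → Prop) (M ST : ℕ) : Prop :=
  (∃ l r, l ≤ r ∧ r ≤ z ∧ (∀ i, l ≤ i → i < r → act i) ∧ ST = X l ∧ ST + M = X r) ∧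
  ∀ l r, l ≤ r → r ≤ z → (∀ i, l ≤ i → i < r → act i) → X r ≤ X l + M

/-- A run that avoids k was a run before. A run through k lies inside the merged run from a k to b
(k + 1), by maximality of the two old ones. So only the merged run competes with the previous best.
-/
theorem Best.insert {h X H : ℕ → ℕ} {z : ℕ} (hP : Pcs h X H z) {act : ℕ → Prop} {a b : ℕ → ℕ}
    (hR : Runs z act a b) {k : ℕ} (hk : k < z) (hact : ¬ act k) {M ST : ℕ}
    (hB : Best X z act M ST) :
    X (a k) ≤ X (b (k + 1)) ∧ Best X z (fun i => act i ∨ i = k)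
      (if M < X (b (k + 1)) - X (a k) then X (b (k + 1)) - X (a k) else M)
      (if M < X (b (k + 1)) - X (a k) then X (a k) else ST) := by
  have a1 := hR.a_le k hk.le fun _ => hact
  have a2 := hR.a_run k hk.le fun _ => hact
  have a3 := hR.a_max k hk.le fun _ => hact
  have b0 := hR.b_ge (k + 1) hk fun _ => hact
  have b1 := hR.b_le (k + 1) hk fun _ => hact
  have b2 := hR.b_run (k + 1) hk fun _ => hact
  have b3 := hR.b_max (k + 1) hk fun _ => hact
  have hX : X (a k) ≤ X (b (k + 1)) := hP.mono (by omega) b1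
  have key : ∀ l r, l ≤ r → r ≤ z → (∀ i, l ≤ i → i < r → act i ∨ i = k) →
      X r ≤ X l + M ∨ X r ≤ X l + (X (b (k + 1)) - X (a k)) := by
    intro l r hlr hr hrun
    by_cases hkr : l ≤ k ∧ k < r
    · right
      have h₁ : a k ≤ l := by
        by_contra hc
        rcases hrun (a k - 1) (by omega) (by omega) with h | h
        · exact a3 (by omega) h
        · omega
      have h₂ : r ≤ b (k + 1) := by
        by_contra hc
        rcases hrun (b (k + 1)) (by omega) (by omega) with h | h
        · exact b3 (by omega) h
        · omega
      have := hP.mono h₁ (by omega)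
      have := hP.mono h₂ b1
      omega
    · left
      refine hB.2 l r hlr hr fun i h₁ h₂ => (hrun i h₁ h₂).resolve_right ?_
      rintro rfl
      exact hkr ⟨h₁, h₂⟩
  refine ⟨hX, ?_⟩
  split_ifs with hM
  · refine ⟨⟨a k, b (k + 1), by omega, b1, ?_, rfl, by omega⟩, fun l r hlr hr hrun => ?_⟩
    · intro i h₁ h₂
      rcases lt_trichotomy i k with h | h | h
      · exact .inl (a2 i h₁ h)
      · exact .inr h
      · exact .inl (b2 i h h₂)
    · have := key l r hlr hr hrun; omega
  · obtain ⟨⟨l, r, h₁, h₂, h₃, h₄⟩, -⟩ := hB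
    refine ⟨⟨l, r, h₁, h₂, fun i hi hi' => .inl (h₃ i hi hi'), h₄⟩, fun l r hlr hr hrun => ?_⟩
    have := key l r hlr hr hrun; omega

/-- `P`, `M`, `ST`, `S` describe the runs of active steps. -/
def RowP (X : ℕ → ℕ) (z : ℕ) (act : ℕ → Prop) (P M ST S : ℕ) : Prop :=
  ∃ a b, Runs z act a b ∧ P = X (b 0) ∧ S = X (a z) ∧ Best X z act M ST

/-- Passage from runs of step indices to intervals of positions. The steps met by an interval of
positions with values at most y are consecutive and all active, so the interval is contained in the
union of a run. -/
theorem RowP.rowOK {h X H : ℕ → ℕ} {z : ℕ} (hP : Pcs h X H z) {act : ℕ → Prop} {P M ST S y : ℕ}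
    (hR : RowP X z act P M ST S) (hact : ∀ i < z, (act i ↔ H i ≤ y)) :
    RowOK h (X 0) (X z) y P M ST S := by
  obtain ⟨a, b, hR, rfl, rfl, ⟨l, r, hlr, hr, hrun, rfl, hM⟩, hmax⟩ := hR
  have run : ∀ l r, l ≤ z → r ≤ z → (∀ i, l ≤ i → i < r → act i) → ∀ j, X l ≤ j → j < X r → h j ≤ y := by
    intro l r hl hr hrun j h₁ h₂
    obtain ⟨i, hi, h₃, h₄⟩ := hP.find ((hP.mono (Nat.zero_le l) hl).trans h₁)
      (h₂.trans_le (hP.mono hr le_rfl))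
    rw [hP.val i hi j h₃ h₄, ← hact i hi]
    refine hrun i ?_ ?_
    · by_contra hc
      have := hP.mono (show i + 1 ≤ l by omega) hl; omega
    · by_contra hc
      have := hP.mono (show r ≤ i by omega) (by omega); omega
  have hb := hR.b_ge 0 (Nat.zero_le _) (by omega)
  have hb' := hR.b_le 0 (Nat.zero_le _) (by omega)
  have ha := hR.a_le z le_rfl (by omega)
  constructor
  · exact hP.mono hb hb'
  · exact hP.mono hb' le_rfl
  · exact run 0 _ (Nat.zero_le _) hb' (hR.b_run 0 (Nat.zero_le _) (by omega))
  · intro hlt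
    have hbz : b 0 < z := by
      by_contra hc
      have : b 0 = z := by omega
      rw [this] at hlt; omega
    have := hR.b_max 0 (Nat.zero_le _) (by omega) hbz
    rw [hact _ hbz] at this
    rw [hP.val _ hbz _ le_rfl (hP.lt _ hbz)]; omega
  · exact hP.mono (Nat.zero_le _) ha
  · exact hP.mono ha le_rfl
  · exact run _ z ha le_rfl (hR.a_run z le_rfl (by omega))
  · intro hlt
    have ha0 : 0 < a z := by
      by_contra hc
      have : a z = 0 := by omega
      rw [this] at hlt; omega
    have h₁ := hR.a_max z le_rfl (by omega) ha0
    have h₂ := hP.lt (a z - 1) (by omega)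
    rw [Nat.sub_add_cancel ha0] at h₂
    rw [hact _ (by omega)] at h₁
    rw [hP.val (a z - 1) (by omega) _ (by omega) (by rw [Nat.sub_add_cancel ha0]; omega)]; omega
  · exact hP.mono (Nat.zero_le _) (by omega)
  · rw [hM]; exact hP.mono hr le_rfl
  · rw [hM]; exact run l r (by omega) hr hrun
  · intro u v h₁ h₂ h₃ h₄
    rcases h₂.eq_or_lt with rfl | h₂
    · omega
    obtain ⟨iu, hiu, u₁, u₂⟩ := hP.find h₁ (by omega)
    obtain ⟨iv, hiv, v₁, v₂⟩ := hP.find (j := v - 1) (by omega) (by omega)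
    have huv : iu ≤ iv := by
      by_contra hc
      have := hP.mono (show iv + 1 ≤ iu by omega) (by omega); omega
    have := hmax iu (iv + 1) (by omega) hiv fun i hi hi' => by
      rw [hact i (by omega)]
      have m₁ := hP.mono hi (by omega)
      have m₂ := hP.mono (show i ≤ iv by omega) (by omega)
      have m₃ := hP.mono (show iu + 1 ≤ i + 1 by omega) (by omega)
      have m₄ := hP.lt i (by omega)
      -- The larger of u and X i is a position that lies both in step i and in the interval from u
      -- to v.
      rw [← hP.val i (by omega) (Nat.max u (X i)) (Nat.le_max_right _ _)
        (Nat.max_lt.2 ⟨by omega, m₄⟩)]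
      exact h₄ _ (Nat.le_max_left _ _) (Nat.max_lt.2 ⟨by omega, by omega⟩)
    omega

end RectDrop

/-! # Blocks -/

namespace RectDrop

set_option linter.constructorNameAsVariable false

/-- The arrays that hold the blocks. -/
def Arr.persist : Arr → Bool
  | .PX | .PH | .SH | .TP | .TM | .TT | .TS => true
  | _ => false

/-- The two memories agree on the blocks stored below address `N`. -/
def Below (N : ℕ) (A A' : Arr → ℕ → ℕ) : Prop :=
  ∀ B : Arr, B.persist = true → ∀ i < N, A' B i = A B i

theorem Below.refl (N : ℕ) (A : Arr → ℕ → ℕ) : Below N A A := fun _ _ _ _ => rfl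

theorem Below.trans {N N' : ℕ} {A A' A'' : Arr → ℕ → ℕ} (h : Below N A A') (h' : Below N' A' A'')
    (hN : N ≤ N') : Below N A A'' :=
  fun B hB i hi => (h' B hB i (by omega)).trans (h B hB i hi)

theorem Below.put {N : ℕ} {A : Arr → ℕ → ℕ} {s : St} (h : Below N A s.arr) {B : Arr} {j x dt : ℕ}
    (hB : B.persist = false ∨ N ≤ j) : Below N A (s.seta B j x dt).arr := by
  intro C hC i hi
  rw [← h C hC i hi, St.seta_arr]
  split_ifs with hCB
  · subst hCB
    rw [Function.update_of_ne]
    rcases hB with hB | hB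
    · simp [hB] at hC
    · omega
  · rfl

theorem Same.below {c : Cmd} {s s' : St} (h : Same c s s')
    (hc : ∀ A : Arr, A.persist = true → c.amods A = false) (N : ℕ) : Below N s.arr s'.arr :=
  fun B hB i _ => by rw [h.arr' B (hc B hB)]

/-- Write row `i` of the table of runs of the block. -/
def row : Cmd :=
  put .TP (V .p + V .i) (get .PX (V .p + get .LB 0)) ;;
  put .TS (V .p + V .i) (get .PX (V .p + get .LA (V .z))) ;;
  put .TM (V .p + V .i) (V .mlen) ;;
  put .TT (V .p + V .i) (V .mst)

/-- Activate the `i`-th step in order of height. -/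
def activate : Cmd :=
  set .k (get .ID (V .i)) ;; set .l (get .LA (V .k)) ;; set .r (get .LB (V .k + 1)) ;;
  put .LB (V .l) (V .r) ;; put .LA (V .r) (V .l) ;;
  set .u (get .PX (V .p + V .r) - get .PX (V .p + V .l)) ;;
  .ite ((V .mlen).lt (V .u)) (set .mlen (V .u) ;; set .mst (get .PX (V .p + V .l))) .skip ;;
  put .SH (V .p + V .i) (get .KEY (V .k))

/-- Compute the table of runs of a block. -/
def link : Cmd :=
  set .mlen 0 ;; set .mst (get .PX (V .p)) ;; .rep .i .il (V .z) (row ;; activate) ;; row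

/-- The set of the first `i` values of `f`. -/
def Act (f : ℕ → ℕ) (i j : ℕ) : Prop := ∃ t < i, f t = j

theorem Act.succ (f : ℕ → ℕ) (i : ℕ) : Act f (i + 1) = fun j => Act f i j ∨ j = f i := by
  ext j
  constructor
  · rintro ⟨t, ht, rfl⟩
    rcases Nat.lt_succ_iff_lt_or_eq.1 ht with h | rfl
    · exact .inl ⟨t, h, rfl⟩
    · exact .inr rfl
  · rintro (⟨t, ht, rfl⟩ | rfl)
    · exact ⟨t, by omega, rfl⟩
    · exact ⟨i, by omega, rfl⟩

/-- The invariant of `link`. -/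
structure LinkInv (A : Arr → ℕ → ℕ) (R : Var → ℕ) (p z : ℕ) (A₀ : Arr → ℕ → ℕ) (i : ℕ) :
    Prop where
  runs : Runs z (Act (A₀ .ID) i) (A .LA) (A .LB)
  best : Best (fun j => A₀ .PX (p + j)) z (Act (A₀ .ID) i) (R .mlen) (R .mst)
  rows : ∀ t < i, RowP (fun j => A₀ .PX (p + j)) z (Act (A₀ .ID) t)
    (A .TP (p + t)) (A .TM (p + t)) (A .TT (p + t)) (A .TS (p + t))
  sh : ∀ t < i, A .SH (p + t) = A₀ .KEY (A₀ .ID t)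
  below : Below p A₀ A

theorem row_ok {L p z i : ℕ} {s : St} {A₀ : Arr → ℕ → ℕ} (hI : LinkInv s.arr s.reg p z A₀ i)
    (hp : s.reg .p = p) (hz : s.reg .z = z) (hi : s.reg .i = i) (hiz : i ≤ z) (hL : p + z < L)
    (hL0 : 0 < L) (hPX : s.arr .PX = A₀ .PX) :
    Ok L row s fun s' => s'.t ≤ s.t + 100 ∧ LinkInv s'.arr s'.reg p z A₀ i ∧
      RowP (fun j => A₀ .PX (p + j)) z (Act (A₀ .ID) i)
        (s'.arr .TP (p + i)) (s'.arr .TM (p + i)) (s'.arr .TT (p + i)) (s'.arr .TS (p + i)) := by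
  have hb := hI.runs.b_le 0 (Nat.zero_le _) (by omega)
  have ha := hI.runs.a_le z le_rfl (by omega)
  simp [row, hp, hz, hi]
  and_intros
  all_goals try omega
  · refine ⟨?_, ?_, ?_, ?_, ?_⟩
    · simpa using hI.runs
    · simpa using hI.best
    · intro t ht
      simpa [Function.update_of_ne (show p + t ≠ p + i by omega)] using hI.rows t ht
    · simpa using hI.sh
    · exact (((hI.below.put (.inr (by omega))).put (.inr (by omega))).put (.inr (by omega))).put
        (.inr (by omega))
  · exact ⟨_, _, hI.runs, by simp [hPX], by simp [hPX], by simpa using hI.best⟩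

theorem activate_ok {L p z i : ℕ} {s : St} {h H : ℕ → ℕ} {A₀ : Arr → ℕ → ℕ}
    (hI : LinkInv s.arr s.reg p z A₀ i) (hP : Pcs h (fun j => A₀ .PX (p + j)) H z)
    (hrow : RowP (fun j => A₀ .PX (p + j)) z (Act (A₀ .ID) i)
        (s.arr .TP (p + i)) (s.arr .TM (p + i)) (s.arr .TT (p + i)) (s.arr .TS (p + i)))
    (hID : ∀ t < z, A₀ .ID t < z) (hinj : ∀ t < z, ∀ t' < z, A₀ .ID t = A₀ .ID t' → t = t')
    (hp : s.reg .p = p) (hi : s.reg .i = i) (hiz : i < z) (hL : p + z < L)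
    (hPX : s.arr .PX = A₀ .PX) (hID₀ : s.arr .ID = A₀ .ID) (hKEY : s.arr .KEY = A₀ .KEY) :
    Ok L activate s fun s' => s'.t ≤ s.t + 150 ∧ LinkInv s'.arr s'.reg p z A₀ (i + 1) := by
  have hk := hID i hiz
  have hact : ¬ Act (A₀ .ID) i (A₀ .ID i) := by
    rintro ⟨t, ht, h⟩
    have := hinj t (by omega) i hiz h
    omega
  have hR' := hI.runs.insert hk hact
  obtain ⟨hX, hB'⟩ := hI.best.insert hP hI.runs hk hact
  rw [← Act.succ] at hR' hB'
  have a1 := hI.runs.a_le _ hk.le fun _ => hact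
  have b1 := hI.runs.b_le (A₀ .ID i + 1) hk fun _ => hact
  simp [activate, hp, hi, hPX, hID₀, hKEY]
  set l := s.arr .LA (A₀ .ID i) with hl
  set r := s.arr .LB (A₀ .ID i + 1) with hr
  have rows : ∀ t < i + 1, RowP (fun j => A₀ .PX (p + j)) z (Act (A₀ .ID) t)
      (s.arr .TP (p + t)) (s.arr .TM (p + t)) (s.arr .TT (p + t)) (s.arr .TS (p + t)) := by
    intro t ht
    rcases Nat.lt_succ_iff_lt_or_eq.1 ht with ht | rfl
    · exact hI.rows t ht
    · exact hrow
  have sh : ∀ t < i + 1, Function.update (s.arr .SH) (p + i) (A₀ .KEY (A₀ .ID i)) (p + t) =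
      A₀ .KEY (A₀ .ID t) := by
    intro t ht
    rcases Nat.lt_succ_iff_lt_or_eq.1 ht with ht | rfl
    · rw [Function.update_of_ne (by omega)]; exact hI.sh t ht
    · simp
  and_intros
  all_goals try omega
  · intro hM
    rw [if_pos (by omega), if_pos (by omega)] at hB'
    refine ⟨by omega, by omega, by omega, by omega, ?_, ?_, ?_, ?_, ?_⟩
    · simpa using hR'
    · simpa using hB'
    · simpa using rows
    · simpa using sh
    · refine Below.put ?_ (.inr (by omega))
      exact (hI.below.put (B := .LB) (dt := 0) (j := l) (x := r) (.inl rfl)).put (dt := 0) (.inl rfl)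
  · intro hM
    rw [if_neg (by omega), if_neg (by omega)] at hB'
    refine ⟨by omega, by omega, by omega, ?_, ?_, ?_, ?_, ?_⟩
    · simpa using hR'
    · simpa using hB'
    · simpa using rows
    · simpa using sh
    · refine Below.put ?_ (.inr (by omega))
      exact (hI.below.put (B := .LB) (dt := 0) (j := l) (x := r) (.inl rfl)).put (dt := 0) (.inl rfl)

/-- Row i is written just before the i-th activation and so describes the i lowest steps. Row z,
with all steps active, is written after the loop. Along the way the heights are listed in sorted
order. -/
theorem link_ok {L p z : ℕ} {s : St} {h H : ℕ → ℕ}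
    (hP : Pcs h (fun j => s.arr .PX (p + j)) H z) (hLA : ∀ j ≤ z, s.arr .LA j = j)
    (hLB : ∀ j ≤ z, s.arr .LB j = j) (hID : ∀ t < z, s.arr .ID t < z)
    (hinj : ∀ t < z, ∀ t' < z, s.arr .ID t = s.arr .ID t' → t = t')
    (hp : s.reg .p = p) (hz : s.reg .z = z) (hL : p + z < L) :
    Ok L link s fun s' => s'.t ≤ s.t + (z * 300 + 200) ∧
      (∀ t ≤ z, RowP (fun j => s.arr .PX (p + j)) z (Act (s.arr .ID) t)
        (s'.arr .TP (p + t)) (s'.arr .TM (p + t)) (s'.arr .TT (p + t)) (s'.arr .TS (p + t))) ∧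
      (∀ t < z, s'.arr .SH (p + t) = s.arr .KEY (s.arr .ID t)) ∧ Below p s.arr s'.arr := by
  simp only [link, Ok_seq, Ok_set]
  refine ⟨by simp; omega, by simp [hp]; omega, ?_⟩
  refine (Ok.rep (fun i s' => LinkInv s'.arr s'.reg p z s.arr i) z 250 ?_ ?_ ?_ ?_ ?_).bind ?_
  · simp
  · simpa using hz
  · omega
  · refine ⟨Runs.init hLA hLB (by rintro i ⟨t, ht, -⟩; omega), ⟨⟨0, 0, le_rfl, Nat.zero_le _,
      by omega, by simp [hp], by simp [hp]⟩, fun l r hlr hr hrun => ?_⟩, by omega, by omega,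
      Below.refl _ _⟩
    by_cases hlr' : l < r
    · obtain ⟨t, ht, -⟩ := hrun l le_rfl hlr'; omega
    · simp [show r = l by omega]
  · intro i hi s' hI hi' hs
    have hp' : s'.reg .p = p := by simp [hs.reg .p, hp]
    have hz' : s'.reg .z = z := by simp [hs.reg .z, hz]
    have hPX : s'.arr .PX = s.arr .PX := hs.arr .PX
    refine (row_ok hI hp' hz' hi' hi.le hL (by omega) hPX).seq ?_
    rintro s₁ ⟨ht₁, hI₁, hrow⟩ hs₁
    refine (activate_ok hI₁ hP hrow hID hinj (by rw [hs₁.reg .p, hp'])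
      (by rw [hs₁.reg .i, hi']) hi hL (by rw [hs₁.arr .PX, hPX])
      (by rw [hs₁.arr .ID, hs.arr .ID]; rfl) (by rw [hs₁.arr .KEY, hs.arr .KEY]; rfl)).mono ?_
    rintro s₂ ⟨ht₂, hI₂⟩
    refine ⟨by omega, ⟨hI₂.1, by simpa using hI₂.2, hI₂.3, hI₂.4, hI₂.5⟩⟩
  · rintro s₁ ⟨ht₁, hI₁, hi₁⟩ hs₁
    have hp' : s₁.reg .p = p := by simp [hs₁.reg .p, hp]
    have hz' : s₁.reg .z = z := by simp [hs₁.reg .z, hz]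
    refine (row_ok hI₁ hp' hz' hi₁ le_rfl hL (by omega) (hs₁.arr .PX)).mono ?_
    rintro s₂ ⟨ht₂, hI₂, hrow⟩
    simp [V] at ht₁
    refine ⟨by omega, fun t ht => ?_, hI₂.sh, hI₂.below⟩
    rcases ht.lt_or_eq with ht | rfl
    · exact hI₂.rows t ht
    · exact hrow

end RectDrop

/-! ### What a finished block guarantees -/

namespace RectDrop

set_option linter.constructorNameAsVariable false

/-- The block of size `z` at address `p` describes the function `h`. -/
structure Blk (A : Arr → ℕ → ℕ) (h : ℕ → ℕ) (p z : ℕ) : Prop where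
  pcs : Pcs h (fun j => A .PX (p + j)) (fun j => A .PH (p + j)) z
  sorted : ∀ i i', i ≤ i' → i' < z → A .SH (p + i) ≤ A .SH (p + i')
  le_max : ∀ j, A .PX p ≤ j → j < A .PX (p + z) → h j ≤ A .SH (p + z - 1)
  max_mem : 0 < z → ∃ j, A .PX p ≤ j ∧ j < A .PX (p + z) ∧ h j = A .SH (p + z - 1)
  row : ∀ y, ∀ t ≤ z, (∀ i < t, A .SH (p + i) ≤ y) → (∀ i, t ≤ i → i < z → y < A .SH (p + i)) →
    RowOK h (A .PX p) (A .PX (p + z)) y (A .TP (p + t)) (A .TM (p + t)) (A .TT (p + t))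
      (A .TS (p + t))

/-- Finished blocks are immutable: programs write new blocks only at higher addresses, so a block
below N keeps its meaning. -/
theorem Blk.congr {A A' : Arr → ℕ → ℕ} {h : ℕ → ℕ} {p z N : ℕ} (hB : Blk A h p z)
    (hA : Below N A A') (hN : p + z < N) : Blk A' h p z := by
  have hX : ∀ i ≤ z, A' .PX (p + i) = A .PX (p + i) := fun i hi => hA .PX rfl _ (by omega)
  have hS : ∀ i < z, A' .SH (p + i) = A .SH (p + i) := fun i hi => hA .SH rfl _ (by omega)
  have hX0 : A' .PX p = A .PX p := hX 0 (Nat.zero_le _)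
  constructor
  · exact hB.pcs.congr hX fun i hi => hA .PH rfl _ (by omega)
  · intro i i' h₁ h₂
    rw [hS i (by omega), hS i' h₂]; exact hB.sorted i i' h₁ h₂
  · rw [hX0, hX z le_rfl, hA .SH rfl (p + z - 1) (by omega)]; exact hB.le_max
  · rw [hX0, hX z le_rfl, hA .SH rfl (p + z - 1) (by omega)]; exact hB.max_mem
  · intro y t ht h₁ h₂
    rw [hX0, hX z le_rfl, hA .TP rfl _ (by omega), hA .TM rfl _ (by omega),
      hA .TT rfl _ (by omega), hA .TS rfl _ (by omega)]
    refine hB.row y t ht (fun i hi => ?_) fun i hi hi' => ?_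
    · rw [← hS i (by omega)]; exact h₁ i hi
    · rw [← hS i hi']; exact h₂ i hi hi'

theorem RowOK.congr_fun {h h' : ℕ → ℕ} {st en y P M ST S : ℕ} (hR : RowOK h st en y P M ST S)
    (hh : ∀ j, st ≤ j → j < en → h' j = h j) : RowOK h' st en y P M ST S := by
  obtain ⟨h1, h2, h3, h4, h5, h6, h7, h8, h9, h10, h11, h12⟩ := hR
  refine ⟨h1, h2, fun j a b => ?_, fun a => ?_, h5, h6, fun j a b => ?_, fun a => ?_, h9, h10,
    fun j a b => ?_, fun u v a b c d => ?_⟩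
  · rw [hh j a (by omega)]; exact h3 j a b
  · rw [hh P h1 a]; exact h4 a
  · rw [hh j (by omega) b]; exact h7 j a b
  · rw [hh _ (by omega) (by omega)]; exact h8 a
  · rw [hh j (by omega) (by omega)]; exact h11 j a b
  · refine h12 u v a b c fun j e f => ?_
    rw [← hh j (by omega) (by omega)]; exact d j e f

theorem Blk.congr_fun {A : Arr → ℕ → ℕ} {h h' : ℕ → ℕ} {p z : ℕ} (hB : Blk A h p z)
    (hh : ∀ j, A .PX p ≤ j → j < A .PX (p + z) → h' j = h j) : Blk A h' p z := by
  refine ⟨hB.pcs.congr_fun hh, hB.sorted, fun j h₁ h₂ => ?_, fun hz => ?_, fun y t ht h₁ h₂ =>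
    (hB.row y t ht h₁ h₂).congr_fun hh⟩
  · rw [hh j h₁ h₂]; exact hB.le_max j h₁ h₂
  · obtain ⟨j, h₁, h₂, h₃⟩ := hB.max_mem hz
    exact ⟨j, h₁, h₂, (hh j h₁ h₂).trans h₃⟩

/-- If exactly the first t sorted heights are at most y, then the t steps activated by row t are
exactly the steps of height at most y. Ties do no harm, since a t of this kind never separates equal
heights. -/
theorem Blk.of_link {A : Arr → ℕ → ℕ} {h id : ℕ → ℕ} {p z : ℕ}
    (hP : Pcs h (fun j => A .PX (p + j)) (fun j => A .PH (p + j)) z)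
    (hid : ∀ t < z, id t < z) (hsurj : ∀ i < z, ∃ t < z, id t = i)
    (hsort : ∀ i i', i ≤ i' → i' < z → A .PH (p + id i) ≤ A .PH (p + id i'))
    (hSH : ∀ t < z, A .SH (p + t) = A .PH (p + id t))
    (hrow : ∀ t ≤ z, RowP (fun j => A .PX (p + j)) z (Act id t)
        (A .TP (p + t)) (A .TM (p + t)) (A .TT (p + t)) (A .TS (p + t))) : Blk A h p z := by
  refine ⟨hP, ?_, ?_, ?_, ?_⟩
  · intro i i' h₁ h₂
    rw [hSH i (by omega), hSH i' h₂]; exact hsort i i' h₁ h₂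
  · intro j h₁ h₂
    obtain ⟨i, hi, h₃, h₄⟩ := hP.find h₁ h₂
    obtain ⟨t, ht, rfl⟩ := hsurj i hi
    rw [hP.val _ hi j h₃ h₄, Nat.add_sub_assoc (by omega), hSH _ (by omega)]
    exact hsort t (z - 1) (by omega) (by omega)
  · intro hz
    have h₁ := hid (z - 1) (by omega)
    have h₂ := hP.lt _ h₁
    refine ⟨A .PX (p + id (z - 1)), hP.mono (Nat.zero_le _) h₁.le,
      h₂.trans_le (hP.mono h₁ le_rfl), ?_⟩
    rw [hP.val _ h₁ _ le_rfl h₂, Nat.add_sub_assoc (by omega), hSH _ (by omega)]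
  · intro y t ht h₁ h₂
    refine (hrow t ht).rowOK hP fun i hi => ?_
    constructor
    · rintro ⟨t', ht', rfl⟩
      rw [← hSH t' (by omega)]; exact h₁ t' ht'
    · intro hy
      obtain ⟨t', ht', rfl⟩ := hsurj i hi
      refine ⟨t', ?_, rfl⟩
      by_contra hc
      have := h₂ t' (by omega) ht'
      rw [hSH t' ht'] at this; omega

/-- Copy `z` steps from the buffer, from position `o` on, to address `p`. -/
def copy : Cmd :=
  .rep .i .il (V .z + 1) (
    put .PX (V .p + V .i) (get .BX (V .o + V .i)) ;;
    put .PH (V .p + V .i) (get .BH (V .o + V .i)) ;;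
    put .KEY (V .i) (get .BH (V .o + V .i)) ;;
    put .ID (V .i) (V .i) ;; put .LA (V .i) (V .i) ;; put .LB (V .i) (V .i))

theorem copy_ok {L p z o : ℕ} {s : St} (hp : s.reg .p = p) (hz : s.reg .z = z)
    (ho : s.reg .o = o) (hL : p + z + 1 < L) (hL' : o + z + 1 < L) :
    Ok L copy s fun s' => s'.t ≤ s.t + (z * 150 + 200) ∧ Below p s.arr s'.arr ∧
      ∀ i ≤ z, s'.arr .PX (p + i) = s.arr .BX (o + i) ∧ s'.arr .PH (p + i) = s.arr .BH (o + i) ∧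
        s'.arr .KEY i = s.arr .BH (o + i) ∧ s'.arr .ID i = i ∧ s'.arr .LA i = i ∧
        s'.arr .LB i = i := by
  -- A block of z steps has z + 1 breakpoints, and the run arrays also need their entries at z;
  -- hence one round more than there are steps.
  refine (Ok.rep (fun k s' => Below p s.arr s'.arr ∧
      ∀ i < k, s'.arr .PX (p + i) = s.arr .BX (o + i) ∧ s'.arr .PH (p + i) = s.arr .BH (o + i) ∧
        s'.arr .KEY i = s.arr .BH (o + i) ∧ s'.arr .ID i = i ∧ s'.arr .LA i = i ∧
        s'.arr .LB i = i) (z + 1) 140 ?_ ?_ ?_ ?_ ?_).mono ?_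
  · simp; omega
  · simp [hz]
  · omega
  · exact ⟨Below.refl _ _, by omega⟩
  · rintro k hk s' ⟨hb, hI⟩ hi hs
    have hp' : s'.reg .p = p := by simp [hs.reg .p, hp]
    have ho' : s'.reg .o = o := by simp [hs.reg .o, ho]
    simp [hp', ho', hi, hs.arr .BX, hs.arr .BH]
    and_intros
    all_goals try omega
    · refine Below.put ?_ (.inl rfl)
      refine Below.put ?_ (.inl rfl)
      refine Below.put ?_ (.inl rfl)
      refine Below.put ?_ (.inl rfl)
      refine Below.put ?_ (.inr (by omega))
      exact Below.put hb (.inr (by omega))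
    · intro i hi
      rcases Nat.lt_succ_iff_lt_or_eq.1 (Nat.lt_succ_of_le hi) with hi | rfl
      · simpa [Function.update_of_ne (show p + i ≠ p + k by omega),
          Function.update_of_ne (show i ≠ k by omega)] using hI i hi
      · simp
  · rintro s' ⟨ht, ⟨hb, hI⟩, -⟩
    simp at ht
    exact ⟨by omega, hb, fun i hi => hI i (by omega)⟩

/-- Build a block from the buffer. -/
def mkBlk : Cmd := copy ;; sort ;; link

theorem mkBlk_ok {L p z o : ℕ} {s : St} {h : ℕ → ℕ} (hp : s.reg .p = p) (hz : s.reg .z = z)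
    (ho : s.reg .o = o) (hL : p + 2 * z + 4 < L) (hL' : o + z + 1 < L)
    (hP : Pcs h (fun i => s.arr .BX (o + i)) (fun i => s.arr .BH (o + i)) z)
    (hLG : s.reg .LG < L) (hpw : 2 ^ s.reg .LG < L) (hkey : ∀ i < z, s.arr .BH (o + i) <
      2 ^ s.reg .LG) :
    Ok L mkBlk s fun s' => s'.t ≤ s.t + ((s.reg .LG + 3) * (z * 150 + 200)) ∧ Blk s'.arr h p z ∧
      Below p s.arr s'.arr ∧ s'.arr .PX p = s.arr .BX o ∧ s'.arr .PX (p + z) = s.arr .BX (o + z) := by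
  refine (copy_ok hp hz ho (by omega) hL').seq ?_
  rintro s₁ ⟨ht₁, hb₁, hI₁⟩ hs₁
  have hp₁ : s₁.reg .p = p := by rw [hs₁.reg .p, hp]
  have hz₁ : s₁.reg .z = z := by rw [hs₁.reg .z, hz]
  have hLG₁ : s₁.reg .LG = s.reg .LG := hs₁.reg .LG
  have hseg : seg (s₁.arr .ID) z = List.range z := by
    rw [seg_congr (g := id) fun i hi => (hI₁ i hi.le).2.2.2.1]; simp [seg]
  refine (sort_ok (by omega) ?_ (by omega) (by rwa [hLG₁]) (by omega) ?_).seq ?_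
  · rw [hz₁]; intro i hi; rw [(hI₁ i hi.le).2.2.2.1]; omega
  · rw [hz₁, hLG₁]; intro i hi
    rw [(hI₁ i hi.le).2.2.2.1, (hI₁ i hi.le).2.2.1]; exact hkey i hi
  rw [hz₁, hLG₁, hseg]
  rintro s₂ ⟨ht₂, hperm, hpair⟩ hs₂
  have hp₂ : s₂.reg .p = p := by rw [hs₂.reg .p, hp₁]
  have hz₂ : s₂.reg .z = z := by rw [hs₂.reg .z, hz₁]
  have hPX₂ : ∀ i ≤ z, s₂.arr .PX (p + i) = s.arr .BX (o + i) := fun i hi => by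
    rw [hs₂.arr .PX, (hI₁ i hi).1]
  have hPH₂ : ∀ i ≤ z, s₂.arr .PH (p + i) = s.arr .BH (o + i) := fun i hi => by
    rw [hs₂.arr .PH, (hI₁ i hi).2.1]
  have hKEY₂ : ∀ i ≤ z, s₂.arr .KEY i = s.arr .BH (o + i) := fun i hi => by
    rw [hs₂.arr .KEY, (hI₁ i hi).2.2.1]
  have hP₂ : Pcs h (fun j => s₂.arr .PX (p + j)) (fun j => s₂.arr .PH (p + j)) z :=
    hP.congr hPX₂ fun i hi => hPH₂ i hi.le
  have hid : ∀ t < z, s₂.arr .ID t < z := fun t ht =>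
    List.mem_range.1 (hperm.subset (mem_seg.2 ⟨t, ht, rfl⟩))
  have hsurj : ∀ i < z, ∃ t < z, s₂.arr .ID t = i := fun i hi =>
    mem_seg.1 (hperm.symm.subset (List.mem_range.2 hi))
  have hinj : ∀ t < z, ∀ t' < z, s₂.arr .ID t = s₂.arr .ID t' → t = t' := by
    have hnd : (seg (s₂.arr .ID) z).Nodup := hperm.nodup_iff.2 List.nodup_range
    intro t ht t' ht' he
    exact List.inj_on_of_nodup_map hnd (List.mem_range.2 ht) (List.mem_range.2 ht') he
  have hsort : ∀ i i', i ≤ i' → i' < z →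
      s.arr .BH (o + s₂.arr .ID i) ≤ s.arr .BH (o + s₂.arr .ID i') := by
    intro i i' h₁ h₂
    rcases h₁.eq_or_lt with rfl | h₁
    · exact le_rfl
    have := List.pairwise_iff_getElem.1 hpair i i' (by simp; omega) (by simp; omega) h₁
    simp only [seg, List.getElem_map, List.getElem_range] at this
    rwa [(hI₁ _ (hid i (by omega)).le).2.2.1, (hI₁ _ (hid i' h₂).le).2.2.1] at this
  refine (link_ok hP₂ ?_ ?_ hid hinj hp₂ hz₂ (by omega)).bind ?_
  · intro j hj; rw [hs₂.arr .LA, (hI₁ j hj).2.2.2.2.1]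
  · intro j hj; rw [hs₂.arr .LB, (hI₁ j hj).2.2.2.2.2]
  rintro s₃ ⟨ht₃, hrow, hSH, hb₃⟩ hs₃
  have hPX₃ : s₃.arr .PX = s₂.arr .PX := hs₃.arr .PX
  have hPH₃ : s₃.arr .PH = s₂.arr .PH := hs₃.arr .PH
  refine ⟨?_, ?_, ?_, ?_, ?_⟩
  · ring_nf at ht₁ ht₂ ht₃ ⊢
    nlinarith
  · refine Blk.of_link (id := s₂.arr .ID) ?_ hid hsurj ?_ ?_ ?_
    · rw [hPX₃, hPH₃]; exact hP₂
    · intro i i' h₁ h₂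
      rw [hPH₃, hPH₂ _ (hid i (by omega)).le, hPH₂ _ (hid i' h₂).le]
      exact hsort i i' h₁ h₂
    · intro t ht
      rw [hSH t ht, hPH₃, hPH₂ _ (hid t ht).le, hKEY₂ _ (hid t ht).le]
    · rw [hPX₃]; exact hrow
  · exact (hb₁.trans (hs₂.below (by intro A; cases A <;> decide) p) le_rfl).trans hb₃ le_rfl
  · rw [hPX₃]; exact hPX₂ 0 (Nat.zero_le _)
  · rw [hPX₃]; exact hPX₂ z le_rfl

end RectDrop

/-! # The directory of blocks -/

namespace RectDrop

set_option linter.constructorNameAsVariable false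

/-- The directory entries from `k₀` to `k₁` list blocks of fewer than `2 * B` steps, stored below
address `N`, which describe `h` on the interval from `lo` to `hi`. -/
def Dir (A : Arr → ℕ → ℕ) (h : ℕ → ℕ) (N B k₀ k₁ lo hi : ℕ) : Prop :=
  ∃ X : ℕ → ℕ, X k₀ = lo ∧ X k₁ = hi ∧ ∀ d, k₀ ≤ d → d < k₁ →
    A .PX (A .DP d) = X d ∧ A .PX (A .DP d + A .DS d) = X (d + 1) ∧
    Blk A h (A .DP d) (A .DS d) ∧ 0 < A .DS d ∧ A .DS d < 2 * B ∧ A .DP d + A .DS d < N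

/-- The potential of a range of directory entries. -/
def Psi (A : Arr → ℕ → ℕ) (B k₀ k₁ : ℕ) : ℕ := ∑ d ∈ Finset.Ico k₀ k₁, max B (A .DS d)

section Dir
variable {A A' : Arr → ℕ → ℕ} {h h' : ℕ → ℕ} {N N' B k₀ k₁ k₂ lo mid hi : ℕ}

theorem Dir.nil : Dir A h N B k₀ k₀ lo lo := ⟨fun _ => lo, rfl, rfl, by omega⟩

theorem Dir.append (h₁ : Dir A h N B k₀ k₁ lo mid) (h₂ : Dir A h N B k₁ k₂ mid hi)
    (h₀₁ : k₀ ≤ k₁) (h₁₂ : k₁ ≤ k₂) : Dir A h N B k₀ k₂ lo hi := by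
  obtain ⟨X, rfl, hm, hX⟩ := h₁
  obtain ⟨Y, rfl, rfl, hY⟩ := h₂
  refine ⟨fun d => if d < k₁ then X d else Y d, ?_, by simp [h₁₂], fun d hd hd' => ?_⟩
  · rcases h₀₁.lt_or_eq with h | rfl
    · simp [h]
    · simp [hm]
  · by_cases hdk : d < k₁
    · obtain ⟨a, b, c⟩ := hX d hd hdk
      refine ⟨by simp [hdk, a], ?_, c⟩
      rw [b]
      change _ = if _ then _ else _
      split_ifs with h
      · rfl
      · rw [show d + 1 = k₁ by omega, hm]
    · obtain ⟨a, b, c⟩ := hY d (by omega) hd'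
      refine ⟨by simp [hdk, a], ?_, c⟩
      rw [b]; exact (if_neg (by omega)).symm

theorem Dir.single (hB : Blk A h (A .DP k₀) (A .DS k₀)) (hz : 0 < A .DS k₀)
    (hz' : A .DS k₀ < 2 * B) (hN : A .DP k₀ + A .DS k₀ < N) :
    Dir A h N B k₀ (k₀ + 1) (A .PX (A .DP k₀)) (A .PX (A .DP k₀ + A .DS k₀)) := by
  refine ⟨fun d => if d = k₀ then A .PX (A .DP k₀) else A .PX (A .DP k₀ + A .DS k₀), by simp,
    by simp, fun d hd hd' => ?_⟩
  obtain rfl : d = k₀ := by omega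
  exact ⟨by simp, by simp, hB, hz, hz', hN⟩

theorem Dir.congr (hD : Dir A h N B k₀ k₁ lo hi) (hA : Below N A A')
    (hP : ∀ d, k₀ ≤ d → d < k₁ → A' .DP d = A .DP d)
    (hS : ∀ d, k₀ ≤ d → d < k₁ → A' .DS d = A .DS d) : Dir A' h N B k₀ k₁ lo hi := by
  obtain ⟨X, h₁, h₂, hX⟩ := hD
  refine ⟨X, h₁, h₂, fun d hd hd' => ?_⟩
  obtain ⟨a, b, c, d₁, d₂, e⟩ := hX d hd hd'
  rw [hP d hd hd', hS d hd hd', hA .PX rfl _ e, hA .PX rfl _ (by omega)]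
  exact ⟨a, b, c.congr hA e, d₁, d₂, e⟩

theorem Dir.le_N (hD : Dir A h N B k₀ k₁ lo hi) (hN : N ≤ N') : Dir A h N' B k₀ k₁ lo hi := by
  obtain ⟨X, h₁, h₂, hX⟩ := hD
  refine ⟨X, h₁, h₂, fun d hd hd' => ?_⟩
  obtain ⟨a, b, c, d₁, d₂, e⟩ := hX d hd hd'
  exact ⟨a, b, c, d₁, d₂, by omega⟩

theorem Dir.lo_le_hi (hD : Dir A h N B k₀ k₁ lo hi) (hk : k₀ ≤ k₁) : lo ≤ hi := by
  obtain ⟨X, rfl, rfl, hX⟩ := hD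
  induction k₁, hk using Nat.le_induction with
  | base => exact le_rfl
  | succ k hk ih =>
    obtain ⟨a, b, c, -⟩ := hX k hk (by omega)
    have := c.pcs.mono (Nat.zero_le _) le_rfl
    simp only [Nat.add_zero, a, b] at this
    exact (ih fun d hd hd' => hX d hd (by omega)).trans this

theorem Dir.congr_fun (hD : Dir A h N B k₀ k₁ lo hi) (hh : ∀ j, lo ≤ j → j < hi → h' j = h j) :
    Dir A h' N B k₀ k₁ lo hi := by
  obtain ⟨X, rfl, rfl, hX⟩ := hD
  refine ⟨X, rfl, rfl, fun d hd hd' => ?_⟩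
  obtain ⟨a, b, c, e⟩ := hX d hd hd'
  refine ⟨a, b, c.congr_fun fun j h₁ h₂ => hh j ?_ ?_, e⟩
  · have : Dir A h N B k₀ d (X k₀) (X d) :=
      ⟨X, rfl, rfl, fun d' h₁ h₂ => hX d' h₁ (by omega)⟩
    have := this.lo_le_hi hd
    omega
  · have : Dir A h N B (d + 1) k₁ (X (d + 1)) (X k₁) :=
      ⟨X, rfl, rfl, fun d' h₁ h₂ => hX d' (by omega) h₂⟩
    have := this.lo_le_hi hd'
    omega

/-- Moving directory entries. -/
theorem Dir.move {k₀' k₁' : ℕ} (hD : Dir A h N B k₀ k₁ lo hi) (hA : Below N A A')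
    (hk : k₀ ≤ k₁) (hk' : k₀' + (k₁ - k₀) = k₁')
    (hP : ∀ i < k₁ - k₀, A' .DP (k₀' + i) = A .DP (k₀ + i))
    (hS : ∀ i < k₁ - k₀, A' .DS (k₀' + i) = A .DS (k₀ + i)) : Dir A' h N B k₀' k₁' lo hi := by
  obtain ⟨X, h₁, h₂, hX⟩ := hD
  refine ⟨fun d => X (k₀ + (d - k₀')), by simpa using h₁, ?_, fun d hd hd' => ?_⟩
  · rw [← h₂, ← hk']; change X _ = X _; congr 1; omega
  · obtain ⟨a, b, c, d₁, d₂, e⟩ := hX (k₀ + (d - k₀')) (by omega) (by omega)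
    have hP' := hP (d - k₀') (by omega)
    have hS' := hS (d - k₀') (by omega)
    rw [Nat.add_sub_cancel' hd] at hP' hS'
    rw [hP', hS', hA .PX rfl _ e, hA .PX rfl _ (by omega)]
    refine ⟨a, b.trans ?_, c.congr hA e, d₁, d₂, e⟩
    congr 1; omega

theorem Psi.congr (hS : ∀ d, k₀ ≤ d → d < k₁ → A' .DS d = A .DS d) :
    Psi A' B k₀ k₁ = Psi A B k₀ k₁ :=
  Finset.sum_congr rfl fun d hd => by
    rw [Finset.mem_Ico] at hd; rw [hS d hd.1 hd.2]

theorem Psi.append (h₀₁ : k₀ ≤ k₁) (h₁₂ : k₁ ≤ k₂) :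
    Psi A B k₀ k₂ = Psi A B k₀ k₁ + Psi A B k₁ k₂ :=
  (Finset.sum_Ico_consecutive _ h₀₁ h₁₂).symm

@[simp] theorem Psi.nil : Psi A B k₀ k₀ = 0 := by simp [Psi]

@[simp] theorem Psi.single : Psi A B k₀ (k₀ + 1) = max B (A .DS k₀) := by simp [Psi]

theorem Psi.move {k₀' : ℕ} (n : ℕ) (hS : ∀ i < n, A' .DS (k₀' + i) = A .DS (k₀ + i)) :
    Psi A' B k₀' (k₀' + n) = Psi A B k₀ (k₀ + n) := by
  rw [Psi, Psi, Finset.sum_Ico_eq_sum_range, Finset.sum_Ico_eq_sum_range]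
  simp only [Nat.add_sub_cancel_left]
  exact Finset.sum_congr rfl fun i hi => by rw [hS i (Finset.mem_range.1 hi)]

/-- Each directory entry contributes at least B however small its block is, so the potential bounds
the number of blocks without a lower bound on their sizes. -/
theorem Psi.mul_le : (k₁ - k₀) * B ≤ Psi A B k₀ k₁ := by
  have := Finset.card_nsmul_le_sum (Finset.Ico k₀ k₁) (fun d => max B (A .DS d)) B
    fun d _ => le_max_left _ _
  rw [smul_eq_mul, Nat.card_Ico] at this
  exact this

end Dir

/-- Cut the `q` steps in the buffer into blocks, and append these to the directory. -/
def build : Cmd :=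
  set .nch (V .q / V .B + (V .q).lt (V .B)) ;; set .o 0 ;;
  .rep .c .cl (V .nch) (
    .ite ((V .c + 1).lt (V .nch)) (set .z (V .B)) (set .z (V .q - V .o)) ;;
    set .p (V .fp) ;; mkBlk ;;
    put .DP (V .K) (V .p) ;; put .DS (V .K) (V .z) ;;
    set .K (V .K + 1) ;; set .fp (V .fp + V .z + 1) ;; set .o (V .o + V .z))

/-- The invariant of `build` after `c` of `m + 1` rounds. -/
structure BuildInv (h : ℕ → ℕ) (s s' : St) (m c : ℕ) : Prop where
  K : s'.reg .K = s.reg .K + c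
  o : s'.reg .o = if c ≤ m then c * s.reg .B else s.reg .q
  fp : s'.reg .fp = s.reg .fp + s'.reg .o + c
  dir : Dir s'.arr h (s'.reg .fp) (s.reg .B) (s.reg .K) (s.reg .K + c) (s.arr .BX 0)
    (s.arr .BX (s'.reg .o))
  psi : Psi s'.arr (s.reg .B) (s.reg .K) (s.reg .K + c) ≤
    if c ≤ m then c * s.reg .B else max (s.reg .B) (s.reg .q)
  DP : ∀ d < s.reg .K, s'.arr .DP d = s.arr .DP d
  DS : ∀ d < s.reg .K, s'.arr .DS d = s.arr .DS d
  below : Below (s.reg .fp) s.arr s'.arr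

/-- There are max(1, ⌊q / B⌋) chunks. All but the last have B steps, and the last one takes the
rest, which is fewer than 2B steps and at least B unless q < B. Hence no chunk adds surplus
potential beyond max(B, q). -/
theorem build_ok {L : ℕ} {s : St} {h : ℕ → ℕ} (hB : 0 < s.reg .B) (hq : 0 < s.reg .q)
    (hP : Pcs h (s.arr .BX) (s.arr .BH) (s.reg .q))
    (hL : s.reg .fp + 4 * s.reg .q + 10 < L) (hK : s.reg .K + s.reg .q + 2 < L)
    (hBL : s.reg .B < L)
    (hLG : s.reg .LG < L) (hpw : 2 ^ s.reg .LG < L)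
    (hkey : ∀ i < s.reg .q, s.arr .BH i < 2 ^ s.reg .LG) :
    Ok L build s fun s' =>
      s'.t ≤ s.t + ((s.reg .q / s.reg .B + 1) *
        ((s.reg .LG + 3) * (2 * s.reg .B * 150 + 200) + 100) + 30) ∧
      s.reg .K ≤ s'.reg .K ∧ s'.reg .K ≤ s.reg .K + s.reg .q + 1 ∧
      s.reg .fp ≤ s'.reg .fp ∧ s'.reg .fp ≤ s.reg .fp + 2 * s.reg .q + 1 ∧
      Dir s'.arr h (s'.reg .fp) (s.reg .B) (s.reg .K) (s'.reg .K) (s.arr .BX 0)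
        (s.arr .BX (s.reg .q)) ∧
      Psi s'.arr (s.reg .B) (s.reg .K) (s'.reg .K) ≤ max (s.reg .B) (s.reg .q) ∧
      (∀ d < s.reg .K, s'.arr .DP d = s.arr .DP d) ∧
      (∀ d < s.reg .K, s'.arr .DS d = s.arr .DS d) ∧
      Below (s.reg .fp) s.arr s'.arr := by
  -- m is the number of full chunks before the last one: 0 if q < B, and ⌊q / B⌋ - 1 otherwise.
  obtain ⟨m, hm, hmq, hz0, hz2, hmax, hmd⟩ : ∃ m,
      (V .q / V .B + (V .q).lt (V .B)).val s = m + 1 ∧ m * s.reg .B ≤ s.reg .q ∧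
      0 < s.reg .q - m * s.reg .B ∧ s.reg .q - m * s.reg .B < 2 * s.reg .B ∧
      m * s.reg .B + max (s.reg .B) (s.reg .q - m * s.reg .B) ≤ max (s.reg .B) (s.reg .q) ∧
      m ≤ s.reg .q / s.reg .B := by
    by_cases hlt : s.reg .q < s.reg .B
    · refine ⟨0, by simp [hlt, Nat.div_eq_of_lt], by omega, by omega, by omega, by simp,
        Nat.zero_le _⟩
    · have h₁ : 0 < s.reg .q / s.reg .B := Nat.div_pos (by omega) hB
      have h₂ := Nat.div_add_mod (s.reg .q) (s.reg .B)
      have h₃ := Nat.mod_lt (s.reg .q) hB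
      obtain ⟨m, hm⟩ := Nat.exists_eq_succ_of_ne_zero h₁.ne'
      rw [hm, Nat.mul_succ, Nat.mul_comm] at h₂
      exact ⟨m, by simp [hlt, hm], by omega, by omega, by omega, by omega, by omega⟩
  have hmq' : m ≤ s.reg .q := hmd.trans (Nat.div_le_self _ _)
  simp only [build, Ok_seq, Ok_set]
  refine ⟨by simp at hm ⊢; omega, by simp; omega, ?_⟩
  refine (Ok.rep (fun c s' => BuildInv h s s' m c) (m + 1)
    ((s.reg .LG + 3) * (2 * s.reg .B * 150 + 200) + 92) ?_ ?_ ?_ ?_ ?_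
    fun _ _ _ h => ⟨h.1, h.2, h.3, h.4, h.5, h.6, h.7, h.8⟩).mono ?_
  · simp
  · simp only [Ex.val_var, St.setr_reg, reduceCtorEq, if_false, if_true]; exact hm
  · omega
  · refine ⟨by simp, by simp, by simp, ?_, by simp, by simp, by simp, Below.refl _ _⟩
    simpa using Dir.nil
  · intro c hc s' hI hi hs
    have hB' : s'.reg .B = s.reg .B := by simp [hs.reg .B]
    have hq' : s'.reg .q = s.reg .q := by simp [hs.reg .q]
    have hLG' : s'.reg .LG = s.reg .LG := by simp [hs.reg .LG]
    have hnch : s'.reg .nch = m + 1 := by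
      rw [hs.reg .nch]; simp only [St.setr_reg, reduceCtorEq, if_false, if_true]; exact hm
    have hBX : s'.arr .BX = s.arr .BX := by simp [hs.arr .BX]
    have hBH : s'.arr .BH = s.arr .BH := by simp [hs.arr .BH]
    have ho : s'.reg .o = c * s.reg .B := by rw [hI.o, if_pos (by omega)]
    have hcm : c * s.reg .B ≤ m * s.reg .B := Nat.mul_le_mul_right _ (by omega)
    have hfp := hI.fp
    have hKK := hI.K
    obtain ⟨z, hz⟩ : ∃ z, z = if c < m then s.reg .B else s.reg .q - c * s.reg .B := ⟨_, rfl⟩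
    have hcz : c < m → c * s.reg .B + s.reg .B ≤ m * s.reg .B := fun h => by
      rw [← Nat.succ_mul]; exact Nat.mul_le_mul_right _ h
    have hcm' : ¬ c < m → c = m := fun h => by omega
    have hz₁ : 0 < z ∧ z < 2 * s.reg .B ∧ c * s.reg .B + z ≤ s.reg .q := by
      rw [hz]; split_ifs with hlt
      · have := hcz hlt; omega
      · rw [hcm' hlt]; omega
    -- The rest of the round, shared by the two ways of choosing the chunk size z.
    have hgoal : ∀ s₁ : St, Same (.ite ((V .c + 1).lt (V .nch)) (set .z (V .B))
          (set .z (V .q - V .o)) ;; set .p (V .fp)) s' s₁ → s₁.reg .z = z →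
        s₁.reg .p = s'.reg .fp → s₁.t ≤ s'.t + 20 → Ok L (mkBlk ;;
        put .DP (V .K) (V .p) ;; put .DS (V .K) (V .z) ;;
        set .K (V .K + 1) ;; set .fp (V .fp + V .z + 1) ;; set .o (V .o + V .z)) s₁ (fun s'' =>
        s''.t ≤ s'.t + ((s.reg .LG + 3) * (2 * s.reg .B * 150 + 200) + 92) ∧
        BuildInv h s (s''.setr .c (c + 1) 4) m (c + 1)) := by
      intro s₁ hs₁ hz₁' hp₁ ht₁
      have ho₁ : s₁.reg .o = c * s.reg .B := by rw [hs₁.reg .o, ho]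
      have hLG₁ : s₁.reg .LG = s.reg .LG := by rw [hs₁.reg .LG, hLG']
      have hK₁ : s₁.reg .K = s.reg .K + c := by rw [hs₁.reg .K, hKK]
      have hfp₁ : s₁.reg .fp = s'.reg .fp := hs₁.reg .fp
      have hBX₁ : s₁.arr .BX = s.arr .BX := by rw [hs₁.arr .BX, hBX]
      have hBH₁ : s₁.arr .BH = s.arr .BH := by rw [hs₁.arr .BH, hBH]
      refine (mkBlk_ok (h := h) (L := L) hp₁ hz₁' ho₁ (by omega) (by omega) ?_ ?_ ?_ ?_).seq ?_
      · rw [hBX₁, hBH₁]; exact hP.sub hz₁.2.2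
      · rwa [hLG₁]
      · rwa [hLG₁]
      · rw [hLG₁, hBH₁]; exact fun i hi => hkey _ (by omega)
      rintro s₂ ⟨ht₂, hblk, hb₂, hX₀, hX₁⟩ hs₂
      rw [hLG₁] at ht₂
      rw [hBX₁] at hX₀ hX₁
      have htz : (s.reg .LG + 3) * (z * 150 + 200) ≤
        (s.reg .LG + 3) * (2 * s.reg .B * 150 + 200) := Nat.mul_le_mul_left _ (by omega)
      have ho₂ : s₂.reg .o = c * s.reg .B := by rw [hs₂.reg .o, ho₁]
      have hK₂ : s₂.reg .K = s.reg .K + c := by rw [hs₂.reg .K, hK₁]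
      have hfp₂ : s₂.reg .fp = s'.reg .fp := by rw [hs₂.reg .fp, hfp₁]
      have hz₂ : s₂.reg .z = z := by rw [hs₂.reg .z, hz₁']
      have hp₂ : s₂.reg .p = s'.reg .fp := by rw [hs₂.reg .p, hp₁]
      have hDP : s₂.arr .DP = s'.arr .DP := by rw [hs₂.arr .DP, hs₁.arr .DP]
      have hDS : s₂.arr .DS = s'.arr .DS := by rw [hs₂.arr .DS, hs₁.arr .DS]
      have hb : Below (s'.reg .fp) s'.arr s₂.arr :=
        (hs₁.below (by intro A; cases A <;> decide) _).trans hb₂ le_rfl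
      simp [ho₂, hK₂, hfp₂, hz₂, hp₂]
      and_intros
      all_goals try omega
      constructor
      · simp; omega
      · simp
        split_ifs with h1
        · rw [Nat.succ_mul, hz, if_pos (by omega)]
        · rw [hz, if_neg (by omega), hcm' (by omega)]; omega
      · simp; omega
      · simp only [St.setr_arr, St.setr_reg, reduceCtorEq, if_false, if_true, ← Nat.add_assoc]
        refine Dir.append (k₁ := s.reg .K + c) (mid := s.arr .BX (c * s.reg .B)) ?_ ?_ (by omega)
          (by omega)
        · rw [← ho]
          refine (hI.dir.congr ?_ ?_ ?_).le_N (by omega)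
          · exact (hb.put (.inl rfl)).put (.inl rfl)
          · intro d h₁ h₂
            simp [hDP, Function.update_of_ne (show d ≠ s.reg .K + c by omega)]
          · intro d h₁ h₂
            simp [hDS, Function.update_of_ne (show d ≠ s.reg .K + c by omega)]
        · have := Dir.single (A := ((s₂.seta .DP (s.reg .K + c) (s'.reg .fp) 9).seta .DS
            (s.reg .K + c) z 9).arr) (h := h) (N := s'.reg .fp + z + 1) (B := s.reg .B)
            (k₀ := s.reg .K + c)
          simp [hX₀, hX₁] at this
          refine this ?_ hz₁.1 hz₁.2.1
          refine hblk.congr (N := s'.reg .fp + z + 1) ?_ (by omega)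
          exact ((Below.refl _ _).put (.inl rfl)).put (.inl rfl)
      · rw [← Nat.add_assoc, Psi.append (k₁ := s.reg .K + c) (by omega) (by omega), Psi.single,
          Psi.congr (A := s'.arr)]
        · have hpsi := hI.psi
          rw [if_pos (by omega)] at hpsi
          simp
          split_ifs with h1
          · rw [hz, if_pos (by omega), Nat.succ_mul]; omega
          · rw [hz, if_neg (by omega)]
            rw [hcm' (by omega)] at hpsi ⊢; omega
        · intro d h₁ h₂
          simp [hDS, Function.update_of_ne (show d ≠ s.reg .K + c by omega)]
      · intro d hd
        simp [hDP, Function.update_of_ne (show d ≠ s.reg .K + c by omega), hI.DP d hd]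
      · intro d hd
        simp [hDS, Function.update_of_ne (show d ≠ s.reg .K + c by omega), hI.DS d hd]
      · exact ((hI.below.trans hb (by omega)).put (dt := 9) (.inl rfl)).put (dt := 9) (.inl rfl)
    rw [Ok_seq, Ok_ite]
    refine ⟨by simp [hi]; omega, fun hc' => ?_, fun hc' => ?_⟩
    · have hlt : c < m := by simpa [hi, hnch] using hc'
      rw [Ok_set, Ok_seq, Ok_set]
      refine ⟨by simp, by simp, hgoal _ ?_ ?_ ?_ ?_⟩
      · refine ⟨fun v hv => ?_, fun _ _ => rfl, rfl⟩
        simp only [Cmd.mods, Bool.or_eq_false_iff, decide_eq_false_iff_not] at hv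
        simp [hv.1, hv.2]
      · simp [hz, hlt, hB']
      · simp
      · simp
    · have hlt : ¬ c < m := by simpa [hi, hnch] using hc'
      rw [Ok_set, Ok_seq, Ok_set]
      refine ⟨by simp [hq', ho]; omega, by simp, hgoal _ ?_ ?_ ?_ ?_⟩
      · refine ⟨fun v hv => ?_, fun _ _ => rfl, rfl⟩
        simp only [Cmd.mods, Bool.or_eq_false_iff, decide_eq_false_iff_not] at hv
        simp [hv.1, hv.2]
      · simp [hz, hlt, hq', ho]
      · simp
      · simp
  · rintro s' ⟨ht, hI, -⟩
    have ho := hI.o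
    rw [if_neg (by omega)] at ho
    have hfp := hI.fp
    have hKK := hI.K
    have hpsi := hI.psi
    have hdir := hI.dir
    rw [if_neg (by omega)] at hpsi
    rw [ho] at hdir
    rw [hKK]
    refine ⟨?_, by omega, by omega, by omega, by omega, hdir, hpsi, hI.DP, hI.DS, hI.below⟩
    have := Nat.mul_le_mul_right ((s.reg .LG + 3) * (2 * s.reg .B * 150 + 200) + 100)
      (show m + 1 ≤ s.reg .q / s.reg .B + 1 by omega)
    rw [show (s.reg .LG + 3) * (2 * s.reg .B * 150 + 200) + 92 + 8 =
      (s.reg .LG + 3) * (2 * s.reg .B * 150 + 200) + 100 from rfl] at ht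
    simp at ht
    omega

end RectDrop

/-! # Queries -/

namespace RectDrop

set_option linter.constructorNameAsVariable false

@[simp high] theorem Ok_ite_lt {L : ℕ} {e f : Ex} {p q : Cmd} {s : St} {Q : St → Prop} :
    Ok L (.ite (e.lt f) p q) s Q ↔ (e.lt f).safe L s ∧
    (e.val s < f.val s → Ok L p (s.tick ((e.lt f).cost + 1)) Q) ∧
    (f.val s ≤ e.val s → Ok L q (s.tick ((e.lt f).cost + 1)) Q) := by
  rw [Ok_ite, Ex.val_lt]
  by_cases h : e.val s < f.val s <;> simp [h, Nat.not_le.2, Nat.not_lt.1]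

@[simp high] theorem Ok_ite_eq {L : ℕ} {e f : Ex} {p q : Cmd} {s : St} {Q : St → Prop} :
    Ok L (.ite (e.eq f) p q) s Q ↔ (e.eq f).safe L s ∧
    (e.val s = f.val s → Ok L p (s.tick ((e.eq f).cost + 1)) Q) ∧
    (e.val s ≠ f.val s → Ok L q (s.tick ((e.eq f).cost + 1)) Q) := by
  rw [Ok_ite, Ex.val_eq]
  by_cases h : e.val s = f.val s <;> simp [h]

/-- Find the number `l` of heights at most `y` in the block of size `z` at `p`. -/
def bsearch : Cmd :=
  set .l 0 ;; set .r (V .z) ;; .rep .i .il (V .LZ) (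
    .ite ((V .l).lt (V .r)) (
      set .k ((V .l + V .r) / 2) ;;
      .ite ((V .y).lt (get .SH (V .p + V .k))) (set .r (V .k)) (set .l (V .k + 1))) .skip)

/-- The number of rounds is fixed at `LZ`; rounds after the search range is empty do nothing. The
range has length below 2^(LZ - k) after k rounds, so it is empty at the end. -/
theorem bsearch_ok {L p z y : ℕ} {s : St} (hp : s.reg .p = p) (hz : s.reg .z = z)
    (hy : s.reg .y = y) (hL : p + 2 * z + 3 < L) (hLZ : s.reg .LZ < L) (hz2 : z < 2 ^ s.reg .LZ)
    (hsort : ∀ i i', i ≤ i' → i' < z → s.arr .SH (p + i) ≤ s.arr .SH (p + i')) :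
    Ok L bsearch s fun s' => s'.t ≤ s.t + (s.reg .LZ * 50 + 30) ∧ s'.reg .l ≤ z ∧
      (∀ i < s'.reg .l, s.arr .SH (p + i) ≤ y) ∧
      ∀ i, s'.reg .l ≤ i → i < z → y < s.arr .SH (p + i) := by
  simp only [bsearch, Ok_seq, Ok_set]
  refine ⟨by simp; omega, by simp, ?_⟩
  refine (Ok.rep (fun k s' => s'.reg .l ≤ s'.reg .r ∧ s'.reg .r ≤ z ∧
      s'.reg .r - s'.reg .l < 2 ^ (s.reg .LZ - k) ∧
      (∀ i < s'.reg .l, s.arr .SH (p + i) ≤ y) ∧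
      ∀ i, s'.reg .r ≤ i → i < z → y < s.arr .SH (p + i)) (s.reg .LZ) 42 ?_ ?_ ?_ ?_ ?_).mono ?_
  · simp
  · simp
  · exact hLZ
  · simp [hz, hz2]; omega
  · rintro k hk s' ⟨h₁, h₂, h₃, h₄, h₅⟩ hi hs
    have hp' : s'.reg .p = p := by simp [hs.reg .p, hp]
    have hy' : s'.reg .y = y := by simp [hs.reg .y, hy]
    have hSH : s'.arr .SH = s.arr .SH := hs.arr .SH
    have h2k : 2 ^ (s.reg .LZ - k) = 2 * 2 ^ (s.reg .LZ - (k + 1)) := by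
      rw [← pow_succ']; congr 1; omega
    have hpos : 0 < 2 ^ (s.reg .LZ - (k + 1)) := by positivity
    simp [hp', hy', hSH]
    refine ⟨fun hlt => ⟨by omega, by omega, fun hlt' => ?_, fun hle => ?_⟩, fun hle => ?_⟩
    · and_intros
      all_goals first
        | omega
        | exact h₄
        | exact fun i h₆ h₇ => hlt'.trans_le (hsort _ i h₆ h₇)
    · and_intros
      all_goals first
        | omega
        | exact fun i h₆ => (hsort i _ (by omega) (by omega)).trans hle
    · and_intros
      all_goals first
        | omega
  · rintro s' ⟨ht, ⟨h₁, h₂, h₃, h₄, h₅⟩, -⟩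
    simp at ht h₃
    refine ⟨by omega, by omega, h₄, fun i hi hi' => h₅ i (by omega) hi'⟩

/-- Look for an interval of length `a0` on which the function is at most `y`. -/
def scan : Cmd :=
  set .fnd 0 ;; set .rs 0 ;; .rep .d .dl (V .K) (
    set .p (get .DP (V .d)) ;; set .z (get .DS (V .d)) ;; bsearch ;; set .t (V .p + V .l) ;;
    .ite (V .fnd) .skip (
      .ite ((get .TP (V .t)).lt (V .rs + V .a0))
        (.ite ((get .TM (V .t)).lt (V .a0)) .skip (set .fnd 1 ;; set .res (get .TT (V .t))))
        (set .fnd 1 ;; set .res (V .rs))) ;;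
    .ite ((get .TP (V .t)).eq (get .PX (V .p + V .z))) .skip (set .rs (get .TS (V .t))))

/-- The scan up to position `pos` is complete. -/
structure ScanInv (h : ℕ → ℕ) (y a pos fnd rs res : ℕ) : Prop where
  le : rs ≤ pos
  run : ∀ j, rs ≤ j → j < pos → h j ≤ y
  max : 0 < rs → y < h (rs - 1)
  found : fnd ≠ 0 → res + a ≤ pos ∧ ∀ j, res ≤ j → j < res + a → h j ≤ y
  not_found : fnd = 0 → ∀ u, u + a ≤ pos → ∃ j, u ≤ j ∧ j < u + a ∧ y < h j

/-- A suitable interval ending in the current block either starts in an earlier block, and then lies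
between the start `rs` of the incoming run and the end P of the initial run, or lies in the block,
and then M is at least a. The outgoing run continues the incoming one if the whole block is low;
otherwise it is the final run of the block. -/
theorem ScanInv.step {h : ℕ → ℕ} {y a st en fnd rs res P M ST S : ℕ}
    (hI : ScanInv h y a st fnd rs res) (hR : RowOK h st en y P M ST S) :
    ScanInv h y a en
      (if fnd ≠ 0 then fnd else if P < rs + a then if M < a then 0 else 1 else 1)
      (if P = en then rs else S)
      (if fnd ≠ 0 then res else if P < rs + a then if M < a then res else ST else rs) := by
  have h1 := hI.le
  have h2 := hR.st_le_P
  have h3 := hR.P_le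
  have h4 := hR.S_le
  have hST := hR.st_le
  have hSM := hR.le_en
  constructor
  · split_ifs <;> omega
  · split_ifs with hP
    · intro j h₁ h₂
      by_cases hj : j < st
      · exact hI.run j h₁ hj
      · exact hR.P_run j (by omega) (by omega)
    · exact fun j h₁ h₂ => hR.S_run j h₁ h₂
  · split_ifs with hP
    · exact hI.max
    · intro _
      -- The final run cannot start at the left end of the block, since it would then contain the
      -- high position P.
      apply hR.S_max
      by_contra hc
      have h₁ := hR.S_run P (by omega) (by omega)
      have h₂ := hR.P_max (by omega)
      omega
  · by_cases hf : fnd = 0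
    · simp only [hf, ne_eq, not_true, if_false]
      split_ifs with hP hM
      · simp
      · exact fun _ => ⟨by omega, fun j h₁ h₂ => hR.run j h₁ (by omega)⟩
      · refine fun _ => ⟨by omega, fun j h₁ h₂ => ?_⟩
        by_cases hj : j < st
        · exact hI.run j h₁ hj
        · exact hR.P_run j (by omega) (by omega)
    · simp only [hf, ne_eq, not_false_eq_true, if_true]
      intro _
      obtain ⟨h₁, h₂⟩ := hI.found hf
      exact ⟨by omega, h₂⟩
  · by_cases hf : fnd = 0
    · simp only [hf, ne_eq, not_true, if_false]
      split_ifs with hP hM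
      · intro _ u hu
        by_cases hu₁ : u + a ≤ st
        · exact hI.not_found hf u hu₁
        by_contra hne
        have hall : ∀ j, u ≤ j → j < u + a → h j ≤ y := fun j hj hj' => by
          by_contra hc
          exact hne ⟨j, hj, hj', by omega⟩
        -- An interval across the left end of the block: the high positions rs - 1 and P confine it
        -- to the range from rs to P, which is too short.
        by_cases hu₂ : u < st
        · have hrs : rs ≤ u := by
            by_contra hc
            have h₁ := hall (rs - 1) (by omega) (by omega)
            have h₂ := hI.max (by omega)
            omega
          have hPu : u + a ≤ P := by
            by_contra hc
            have h₁ := hall P (by omega) (by omega)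
            have h₂ := hR.P_max (by omega)
            omega
          omega
        · have := hR.max u (u + a) (by omega) (by omega) hu hall
          omega
      · simp
      · simp
    · simp only [hf, ne_eq, not_false_eq_true, if_true]
      exact fun h => absurd h (by simp)

theorem scan_ok {L N w a y : ℕ} {s : St} {h : ℕ → ℕ}
    (hD : Dir s.arr h N (s.reg .B) 0 (s.reg .K) 0 w) (ha : s.reg .a0 = a) (ha0 : 0 < a)
    (hy : s.reg .y = y) (hN : N + 4 * s.reg .B + 4 < L) (hK : s.reg .K < L) (hwa : w + a < L)
    (hLZ : s.reg .LZ < L) (hB2 : 2 * s.reg .B ≤ 2 ^ s.reg .LZ) :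
    Ok L scan s fun s' => s'.t ≤ s.t + (s.reg .K * (s.reg .LZ * 50 + 200) + 20) ∧
      (s'.reg .fnd ≠ 0 → s'.reg .res + a ≤ w ∧
        ∀ j, s'.reg .res ≤ j → j < s'.reg .res + a → h j ≤ y) ∧
      (s'.reg .fnd = 0 → ∀ u, u + a ≤ w → ∃ j, u ≤ j ∧ j < u + a ∧ y < h j) := by
  have hle : ∀ X : ℕ → ℕ, X (s.reg .K) = w → (∀ d, 0 ≤ d → d < s.reg .K →
      s.arr .PX (s.arr .DP d) = X d ∧ s.arr .PX (s.arr .DP d + s.arr .DS d) = X (d + 1) ∧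
      Blk s.arr h (s.arr .DP d) (s.arr .DS d) ∧ 0 < s.arr .DS d ∧ s.arr .DS d < 2 * s.reg .B ∧
      s.arr .DP d + s.arr .DS d < N) → ∀ d ≤ s.reg .K, X d ≤ w := by
    intro X hXK hX d hd
    have : Dir s.arr h N (s.reg .B) d (s.reg .K) (X d) w :=
      ⟨X, rfl, hXK, fun d' _ h₂ => hX d' (Nat.zero_le _) h₂⟩
    exact this.lo_le_hi hd
  obtain ⟨X, hX0, hXK, hX⟩ := hD
  have hXw := hle X hXK hX
  simp only [scan, Ok_seq, Ok_set]
  refine ⟨by simp; omega, by simp; omega, ?_⟩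
  refine (Ok.rep (fun d s' => ScanInv h y a (X d) (s'.reg .fnd) (s'.reg .rs) (s'.reg .res))
    (s.reg .K) (s.reg .LZ * 50 + 192) ?_ ?_ ?_ ?_ ?_).mono ?_
  · simp
  · simp
  · exact hK
  · simp only [hX0]
    refine ⟨by simp, by omega, by simp, by simp, fun _ u hu => by omega⟩
  · intro d hd s' hI hi hs
    obtain ⟨x₁, x₂, hblk, hz0, hz2, hzN⟩ := hX d (Nat.zero_le _) hd
    have ha' : s'.reg .a0 = a := by simp [hs.reg .a0, ha]
    have hy' : s'.reg .y = y := by simp [hs.reg .y, hy]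
    have hLZ' : s'.reg .LZ = s.reg .LZ := by simp [hs.reg .LZ]
    have hrs := hI.le
    have hXd := hXw d hd.le
    simp only [Ok_seq, Ok_set]
    refine ⟨by simp; omega, by simp; omega, ?_⟩
    refine (bsearch_ok (L := L) (p := s.arr .DP d) (z := s.arr .DS d) (y := y) ?_ ?_ ?_ ?_ ?_ ?_
      ?_).bind ?_
    · simp [hi, hs.arr .DP]
    · simp [hi, hs.arr .DS]
    · simp [hy']
    · omega
    · simpa [hLZ'] using hLZ
    · simp [hLZ']; omega
    · simpa [hs.arr .SH] using hblk.sorted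
    simp [hs.arr .SH, hLZ']
    intro s₁ ht₁ hl₁ hle₁ hlt₁ hs₁
    have hrow := hblk.row y _ hl₁ hle₁ hlt₁
    rw [x₁, x₂] at hrow
    have hstep := hI.step hrow
    have hp₁ : s₁.reg .p = s.arr .DP d := by simp [hs₁.reg .p, hi, hs.arr .DP]
    have hz₁ : s₁.reg .z = s.arr .DS d := by simp [hs₁.reg .z, hi, hs.arr .DS]
    have ha₁ : s₁.reg .a0 = a := by simp [hs₁.reg .a0, ha']
    have hrs₁ : s₁.reg .rs = s'.reg .rs := by simp [hs₁.reg .rs]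
    have hf₁ : s₁.reg .fnd = s'.reg .fnd := by simp [hs₁.reg .fnd]
    have hres₁ : s₁.reg .res = s'.reg .res := by simp [hs₁.reg .res]
    have hTP : s₁.arr .TP = s.arr .TP := by simp [hs₁.arr .TP, hs.arr .TP]
    have hTM : s₁.arr .TM = s.arr .TM := by simp [hs₁.arr .TM, hs.arr .TM]
    have hTT : s₁.arr .TT = s.arr .TT := by simp [hs₁.arr .TT, hs.arr .TT]
    have hTS : s₁.arr .TS = s.arr .TS := by simp [hs₁.arr .TS, hs.arr .TS]
    have hPX : s₁.arr .PX = s.arr .PX := by simp [hs₁.arr .PX, hs.arr .PX]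
    simp [hp₁, hz₁, ha₁, hrs₁, hf₁, hres₁, hTP, hTM, hTT, hTS, hPX, x₂]
    refine ⟨by omega, fun hf => ?_, fun hf => ?_⟩
    · simp only [ne_eq, hf, not_false_eq_true, if_true] at hstep
      refine ⟨by omega, fun hP => ⟨by omega, ?_⟩, fun hP => ⟨by omega, by omega, ?_⟩⟩
      · simpa [hP, hres₁, hrs₁, hf₁] using hstep
      · simpa [hP, hres₁, hrs₁, hf₁] using hstep
    · simp only [ne_eq, hf, not_true, if_false] at hstep
      refine ⟨by omega, fun hP => ?_, fun hP => ?_⟩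
      · simp only [hP, if_true] at hstep
        refine ⟨by omega, fun hM => ?_, fun hM => ?_⟩
        · simp only [hM, if_true] at hstep
          and_intros
          all_goals first
            | omega
            | intro hP
              and_intros <;> first | omega | simpa [hP, hres₁, hrs₁, hf₁, hf] using hstep
        · simp only [show ¬ s.arr .TM (s.arr .DP d + s₁.reg .l) < a by omega, if_false] at hstep
          and_intros
          all_goals first
            | omega
            | intro hP
              and_intros <;> first | omega | simpa [hP, hres₁, hrs₁, hf₁, hf] using hstep
      · simp only [show ¬ s.arr .TP (s.arr .DP d + s₁.reg .l) < s'.reg .rs + a by omega,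
          if_false] at hstep
        and_intros
        all_goals first
          | omega
          | intro hP
            and_intros <;> first | omega | simpa [hP, hres₁, hrs₁, hf₁, hf] using hstep
  · rintro s' ⟨ht, hI, -⟩
    simp only [hXK] at hI
    rw [show s.reg .LZ * 50 + 192 + 8 = s.reg .LZ * 50 + 200 from rfl] at ht
    simp at ht
    exact ⟨by omega, hI.found, hI.not_found⟩

/-- The query program. -/
def queryCmd : Cmd :=
  set .lo 0 ;; set .hi (V .top) ;; set .best 0 ;; .size .LG .tmp (V .top) ;;
  .rep .g .gl (V .LG) (
    set .y ((V .lo + V .hi) / 2) ;; scan ;;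
    .ite (V .fnd) (set .hi (V .y) ;; set .best (V .res)) (set .lo (V .y + 1))) ;;
  set .a0 (V .best) ;; set .a1 (V .hi + V .a1) ;;
  .ite ((V .a1).lt (V .top)) (set .a1 (V .top)) .skip

/-- Bisection on the resting height. Throughout, `best` is a position that witnesses `hi`, initially
position 0 with the overall top, and every height below `lo` is infeasible. Size-of-top many rounds
bring `lo` and `hi` together. -/
theorem queryCmd_ok {L N w a b : ℕ} {s : St} {h : ℕ → ℕ}
    (hD : Dir s.arr h N (s.reg .B) 0 (s.reg .K) 0 w) (ha : s.reg .a0 = a) (ha0 : 0 < a)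
    (haw : a ≤ w) (hb : s.reg .a1 = b) (hN : N + 4 * s.reg .B + 4 < L) (hK : s.reg .K < L)
    (hwa : w + a < L) (hLZ : s.reg .LZ < L) (hB2 : 2 * s.reg .B ≤ 2 ^ s.reg .LZ)
    (htop : ∀ j < w, h j ≤ s.reg .top) (htL : 2 * s.reg .top + b + 4 < L) :
    Ok L queryCmd s fun s' => s'.t ≤ s.t + ((Nat.size (s.reg .top) + 1) *
        (s.reg .K * (s.reg .LZ * 50 + 200) + 100)) ∧
      s'.reg .a0 + a ≤ w ∧ ∃ y, (∀ j, s'.reg .a0 ≤ j → j < s'.reg .a0 + a → h j ≤ y) ∧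
      (∀ y' < y, ∀ u, u + a ≤ w → ∃ j, u ≤ j ∧ j < u + a ∧ y' < h j) ∧
      s'.reg .a1 = max (s.reg .top) (y + b) := by
  have hsz : Nat.size (s.reg .top) ≤ s.reg .top :=
    Nat.size_le.2 (Nat.lt_two_pow_self)
  simp only [queryCmd, Ok_seq, Ok_set, Ok_size]
  refine ⟨by simp; omega, by simp, by simp; omega, by simp, by simp; omega, ?_⟩
  refine (Ok.rep (fun k s' => s'.reg .lo ≤ s'.reg .hi ∧ s'.reg .hi ≤ s.reg .top ∧
      s'.reg .hi - s'.reg .lo < 2 ^ (Nat.size (s.reg .top) - k) ∧ s'.reg .best + a ≤ w ∧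
      (∀ j, s'.reg .best ≤ j → j < s'.reg .best + a → h j ≤ s'.reg .hi) ∧
      (∀ y' < s'.reg .lo, ∀ u, u + a ≤ w → ∃ j, u ≤ j ∧ j < u + a ∧ y' < h j))
      (Nat.size (s.reg .top)) (s.reg .K * (s.reg .LZ * 50 + 200) + 52) ?_ ?_ ?_ ?_ ?_).bind ?_
  · simp
  · simp
  · omega
  · simp [Nat.lt_size_self, haw]
    exact fun j hj => htop j (by omega)
  · rintro k hk s' ⟨h₁, h₂, h₃, h₄, h₅, h₆⟩ hi hs
    have hB' : s'.reg .B = s.reg .B := by simp [hs.reg .B]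
    have hK' : s'.reg .K = s.reg .K := by simp [hs.reg .K]
    have hLZ' : s'.reg .LZ = s.reg .LZ := by simp [hs.reg .LZ]
    have ha' : s'.reg .a0 = a := by simp [hs.reg .a0, ha]
    have h2k : 2 ^ (Nat.size (s.reg .top) - k) = 2 * 2 ^ (Nat.size (s.reg .top) - (k + 1)) := by
      rw [← pow_succ']; congr 1; omega
    have hpos : 0 < 2 ^ (Nat.size (s.reg .top) - (k + 1)) := by positivity
    rw [Ok_seq, Ok_set]
    refine ⟨by simp; omega, ?_⟩
    refine (scan_ok (L := L) (N := N) (w := w) (a := a) (h := h)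
      (y := (s'.reg .lo + s'.reg .hi) / 2) ?_ ?_ ha0 ?_ ?_ ?_ hwa ?_ ?_).seq ?_
    · have hDP : s'.arr .DP = s.arr .DP := hs.arr .DP
      have hDS : s'.arr .DS = s.arr .DS := hs.arr .DS
      simp only [St.setr_reg, St.setr_arr, reduceCtorEq, if_false, hB', hK']
      exact hD.congr (hs.below (by intro A; cases A <;> decide) N) (by simp [hDP]) (by simp [hDS])
    · simp [ha']
    · simp
    · simpa [hB'] using hN
    · simpa [hK'] using hK
    · simpa [hLZ'] using hLZ
    · simpa [hLZ', hB'] using hB2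
    simp [hK', hLZ']
    intro s₁ ht₁ hf₁ hn₁ hs₁
    have hy₁ : s₁.reg .y = (s'.reg .lo + s'.reg .hi) / 2 := by simp [hs₁.reg .y]
    have hlo₁ : s₁.reg .lo = s'.reg .lo := by simp [hs₁.reg .lo]
    have hhi₁ : s₁.reg .hi = s'.reg .hi := by simp [hs₁.reg .hi]
    have hbest₁ : s₁.reg .best = s'.reg .best := by simp [hs₁.reg .best]
    simp [hy₁, hlo₁, hhi₁, hbest₁]
    refine ⟨fun hf => ⟨by omega, by omega, by omega, by omega, (hf₁ hf).1, (hf₁ hf).2, h₆⟩,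
      fun hf => ?_⟩
    -- The test cannot fail at height `hi`, because `best` is feasible there. So further rounds
    -- after convergence are harmless, and `lo` never passes `hi`.
    have hmid : (s'.reg .lo + s'.reg .hi) / 2 < s'.reg .hi := by
      by_contra hc
      obtain ⟨j, hj, hj', h₇⟩ := hn₁ hf _ h₄
      have := h₅ j hj hj'
      omega
    refine ⟨by omega, by omega, by omega, h₂, by omega, h₄, h₅, fun y' hy' u hu => ?_⟩
    obtain ⟨j, hj, hj', h₇⟩ := hn₁ hf u hu
    exact ⟨j, hj, hj', by omega⟩
  · rintro s₁ ⟨ht₁, ⟨h₁, h₂, h₃, h₄, h₅, h₆⟩, -⟩ hs₁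
    have hb₁ : s₁.reg .a1 = b := by simp [hs₁.reg .a1, hb]
    have htop₁ : s₁.reg .top = s.reg .top := by simp [hs₁.reg .top]
    simp at h₃ ht₁
    have hlohi : s₁.reg .lo = s₁.reg .hi := by omega
    simp [hb₁, htop₁]
    have e : (Nat.size (s.reg .top) + 1) * (s.reg .K * (s.reg .LZ * 50 + 200) + 100) =
      Nat.size (s.reg .top) * (s.reg .K * (s.reg .LZ * 50 + 200) + 60) +
      (Nat.size (s.reg .top) * 40 + (s.reg .K * (s.reg .LZ * 50 + 200) + 100)) := by ring
    rw [e]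
    rw [show s.reg .K * (s.reg .LZ * 50 + 200) + 52 + 8 =
      s.reg .K * (s.reg .LZ * 50 + 200) + 60 from rfl] at ht₁
    refine ⟨by omega, fun hlt => ⟨by omega, h₄, s₁.reg .hi, h₅, ?_, by omega⟩,
      fun hle => ⟨by omega, h₄, s₁.reg .hi, h₅, ?_, by omega⟩⟩
    · rw [← hlohi]; exact h₆
    · rw [← hlohi]; exact h₆

end RectDrop

/-! # Updates -/

namespace RectDrop

set_option linter.constructorNameAsVariable false

/-- The value `m` is zero, or attained on the interval from `x` to `xe`. -/
def Hit (h : ℕ → ℕ) (x xe m : ℕ) : Prop := m = 0 ∨ ∃ j, x ≤ j ∧ j < xe ∧ h j = m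

/-- Raise `mx` to the maximal height of the steps of a block that meet the window. -/
def maxBlk : Cmd :=
  .rep .i .il (V .z) (
    .ite ((get .PX (V .p + V .i)).lt (V .xe))
      (.ite ((V .a2).lt (get .PX (V .p + V .i + 1)))
        (.ite ((V .mx).lt (get .PH (V .p + V .i))) (set .mx (get .PH (V .p + V .i))) .skip)
        .skip) .skip)

theorem maxBlk_ok {L p z x xe : ℕ} {s : St} {h : ℕ → ℕ} (hp : s.reg .p = p) (hz : s.reg .z = z)
    (hx : s.reg .a2 = x) (hxe : s.reg .xe = xe) (hxx : x < xe)
    (hP : Pcs h (fun i => s.arr .PX (p + i)) (fun i => s.arr .PH (p + i)) z)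
    (hL : p + z + 2 < L) (hm : Hit h x xe (s.reg .mx)) :
    Ok L maxBlk s fun s' => s'.t ≤ s.t + (z * 100 + 20) ∧ s.reg .mx ≤ s'.reg .mx ∧
      Hit h x xe (s'.reg .mx) ∧ ∀ j, x ≤ j → j < xe → s.arr .PX p ≤ j → j < s.arr .PX (p + z) →
        h j ≤ s'.reg .mx := by
  refine (Ok.rep (fun i s' => s.reg .mx ≤ s'.reg .mx ∧ Hit h x xe (s'.reg .mx) ∧
    ∀ j, x ≤ j → j < xe → s.arr .PX p ≤ j → j < s.arr .PX (p + i) → h j ≤ s'.reg .mx)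
    z 92 ?_ ?_ ?_ ?_ ?_).mono ?_
  · simp
  · simp [hz]
  · omega
  · exact ⟨by simp, by simpa using hm, fun j _ _ h₁ h₂ => by simp at h₂; omega⟩
  · rintro i hi s' ⟨h₁, h₂, h₃⟩ hi' hs
    have hp' : s'.reg .p = p := by simp [hs.reg .p, hp]
    have hx' : s'.reg .a2 = x := by simp [hs.reg .a2, hx]
    have hxe' : s'.reg .xe = xe := by simp [hs.reg .xe, hxe]
    have hPX : s'.arr .PX = s.arr .PX := hs.arr .PX
    have hPH : s'.arr .PH = s.arr .PH := hs.arr .PH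
    have hlt : s.arr .PX (p + i) < s.arr .PX (p + i + 1) := hP.lt i hi
    have he : s.arr .PX (p + (i + 1)) = s.arr .PX (p + i + 1) := rfl
    have hval : ∀ j, s.arr .PX (p + i) ≤ j → j < s.arr .PX (p + i + 1) →
      h j = s.arr .PH (p + i) := hP.val i hi
    have hcov : ∀ m, s'.reg .mx ≤ m → (∀ j, x ≤ j → j < xe → s.arr .PX (p + i) ≤ j →
        j < s.arr .PX (p + i + 1) → h j ≤ m) → ∀ j, x ≤ j → j < xe → s.arr .PX p ≤ j →
        j < s.arr .PX (p + (i + 1)) → h j ≤ m := by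
      intro m hm hc j h₄ h₅ h₆ h₇
      by_cases hj : j < s.arr .PX (p + i)
      · exact (h₃ j h₄ h₅ h₆ hj).trans hm
      · exact hc j h₄ h₅ (by omega) h₇
    simp [hp', hx', hxe', hPX, hPH, hi']
    refine ⟨by omega, fun hc₁ => ⟨by omega, fun hc₂ => ⟨by omega, fun hc₃ => ?_, fun hc₃ => ?_⟩,
      fun hc₂ => ?_⟩, fun hc₁ => ?_⟩
    -- The step meets the window, so the later of the two left ends is a position of the window that
    -- attains its height.
    · refine ⟨by omega, by omega, .inr ⟨max x (s.arr .PX (p + i)), by omega, by omega,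
        hval _ (by omega) (by omega)⟩, hcov _ hc₃.le fun j _ _ h₆ h₇ => (hval j h₆ h₇).le⟩
    · exact ⟨by omega, h₂, hcov _ le_rfl fun j _ _ h₆ h₇ => (hval j h₆ h₇).trans_le hc₃⟩
    · exact ⟨by omega, h₂, hcov _ le_rfl fun j _ _ h₆ h₇ => by omega⟩
    · exact ⟨by omega, h₂, hcov _ le_rfl fun j _ _ h₆ h₇ => by omega⟩
  · rintro s' ⟨ht, ⟨h₁, h₂, h₃⟩, -⟩
    simp at ht
    exact ⟨by omega, h₁, h₂, h₃⟩

/-- Write the steps of a block to the left of the window to the buffer. -/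
def pushLeft : Cmd :=
  set .q 0 ;; put .BX 0 (get .PX (V .p)) ;; .rep .i .il (V .z) (
    .ite ((get .PX (V .p + V .i)).lt (V .a2)) (
      put .BH (V .q) (get .PH (V .p + V .i)) ;;
      .ite ((V .a2).lt (get .PX (V .p + V .i + 1))) (put .BX (V .q + 1) (V .a2))
        (put .BX (V .q + 1) (get .PX (V .p + V .i + 1))) ;;
      set .q (V .q + 1)) .skip)

/-- The last step written may be cut at x. The final clause says that all of them start left of x;
when the window lies in one block, this limits how many steps can be written twice. -/
theorem pushLeft_ok {L p z x : ℕ} {s : St} {h : ℕ → ℕ} (hp : s.reg .p = p) (hz : s.reg .z = z)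
    (hx : s.reg .a2 = x)
    (hP : Pcs h (fun i => s.arr .PX (p + i)) (fun i => s.arr .PH (p + i)) z)
    (hL : p + z + 2 < L) (hx₀ : s.arr .PX p ≤ x) (hx₁ : x < s.arr .PX (p + z)) :
    Ok L pushLeft s fun s' => s'.t ≤ s.t + (z * 100 + 50) ∧
      Pcs h (s'.arr .BX) (s'.arr .BH) (s'.reg .q) ∧ s'.arr .BX 0 = s.arr .PX p ∧
      s'.arr .BX (s'.reg .q) = x ∧ s'.reg .q ≤ z ∧
      (0 < s'.reg .q → s.arr .PX (p + (s'.reg .q - 1)) < x) := by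
  simp only [pushLeft, Ok_seq, Ok_set, Ok_put]
  refine ⟨by simp; omega, by simp; omega, by simp [hp]; omega, by simp; omega, ?_⟩
  refine (Ok.rep (fun i s' => Pcs h (s'.arr .BX) (s'.arr .BH) (s'.reg .q) ∧
    s'.arr .BX 0 = s.arr .PX p ∧ s'.arr .BX (s'.reg .q) = min (s.arr .PX (p + i)) x ∧
    s'.reg .q ≤ i ∧ (0 < s'.reg .q → s.arr .PX (p + (s'.reg .q - 1)) < x) ∧
    (s.arr .PX (p + i) ≤ x → s'.reg .q = i)) z 90 ?_ ?_ ?_ ?_ ?_).mono ?_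
  · simp
  · simp [hz]
  · omega
  · simp [hp, hx₀]
    exact ⟨by omega, by omega⟩
  · rintro i hi s' ⟨h₁, h₂, h₃, h₄, h₅, h₆⟩ hi' hs
    have hp' : s'.reg .p = p := by simp [hs.reg .p, hp]
    have hx' : s'.reg .a2 = x := by simp [hs.reg .a2, hx]
    have hPX : s'.arr .PX = s.arr .PX := by simp [hs.arr .PX]
    have hPH : s'.arr .PH = s.arr .PH := by simp [hs.arr .PH]
    have hlt : s.arr .PX (p + i) < s.arr .PX (p + i + 1) := hP.lt i hi
    have he : s.arr .PX (p + (i + 1)) = s.arr .PX (p + i + 1) := rfl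
    have hval : ∀ j, s.arr .PX (p + i) ≤ j → j < s.arr .PX (p + i + 1) →
      h j = s.arr .PH (p + i) := hP.val i hi
    simp [hp', hx', hPX, hPH, hi']
    refine ⟨by omega, fun hc₁ => ?_, fun hc₁ => ?_⟩
    · have hq : s'.reg .q = i := h₆ hc₁.le
      rw [hq, min_eq_left hc₁.le] at h₃
      rw [hq] at h₁
      simp only [hq]
      refine ⟨by omega, by omega, by omega, fun hc₂ => ?_, fun hc₂ => ?_⟩
      · have := h₁.push (en := x) (v := s.arr .PH (p + i)) (by omega)
          fun j h₇ h₈ => hval j (by omega) (by omega)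
        and_intros <;> omega
      · have := h₁.push (en := s.arr .PX (p + i + 1)) (v := s.arr .PH (p + i)) (by omega)
          fun j h₇ h₈ => hval j (by omega) (by omega)
        and_intros <;> first
          | omega
          | exact this
          | exact h₁
          | exact h₂
          | simp
    · and_intros <;> omega
  · rintro s' ⟨ht, ⟨h₁, h₂, h₃, h₄, h₅, -⟩, -⟩
    simp at ht
    exact ⟨by omega, h₁, h₂, by omega, h₄, h₅⟩

/-- Append the steps of a block to the right of the window to the buffer. -/
def pushRight : Cmd :=
  .rep .i .il (V .z) (
    .ite ((V .xe).lt (get .PX (V .p + V .i + 1))) (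
      put .BH (V .q) (get .PH (V .p + V .i)) ;;
      put .BX (V .q + 1) (get .PX (V .p + V .i + 1)) ;; set .q (V .q + 1)) .skip)

/-- The first step that survives needs no explicit cut at the left: the buffer already ends at xe,
which serves as its left breakpoint. The final clause counts the steps that are dropped. -/
theorem pushRight_ok {L p z xe q : ℕ} {s : St} {h h' : ℕ → ℕ} (hp : s.reg .p = p)
    (hz : s.reg .z = z) (hxe : s.reg .xe = xe) (hq : s.reg .q = q)
    (hP : Pcs h (fun i => s.arr .PX (p + i)) (fun i => s.arr .PH (p + i)) z)
    (hL : p + z + 2 < L) (hLq : q + z + 2 < L) (hx₀ : s.arr .PX p ≤ xe)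
    (hx₁ : xe ≤ s.arr .PX (p + z)) (hB : Pcs h' (s.arr .BX) (s.arr .BH) q)
    (hBq : s.arr .BX q = xe) (hh : ∀ j, xe ≤ j → h' j = h j) :
    Ok L pushRight s fun s' => s'.t ≤ s.t + (z * 100 + 20) ∧
      Pcs h' (s'.arr .BX) (s'.arr .BH) (s'.reg .q) ∧ s'.arr .BX 0 = s.arr .BX 0 ∧
      s'.arr .BX (s'.reg .q) = s.arr .PX (p + z) ∧ q ≤ s'.reg .q ∧ s'.reg .q ≤ q + z ∧
      ∀ m < z, s.arr .PX (p + m + 1) ≤ xe → s'.reg .q + (m + 1) ≤ q + z := by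
  refine (Ok.rep (fun i s' => Pcs h' (s'.arr .BX) (s'.arr .BH) (s'.reg .q) ∧
    s'.arr .BX 0 = s.arr .BX 0 ∧ s'.arr .BX (s'.reg .q) = max (s.arr .PX (p + i)) xe ∧
    q ≤ s'.reg .q ∧ s'.reg .q ≤ q + i ∧
    ∀ m < i, s.arr .PX (p + m + 1) ≤ xe → s'.reg .q + (m + 1) ≤ q + i) z 90
    ?_ ?_ ?_ ?_ ?_).mono ?_
  · simp
  · simp [hz]
  · omega
  · simp [hq, hB, hBq, hx₀]
  · rintro i hi s' ⟨h₁, h₂, h₃, h₄, h₅, h₆⟩ hi' hs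
    have hp' : s'.reg .p = p := by simp [hs.reg .p, hp]
    have hxe' : s'.reg .xe = xe := by simp [hs.reg .xe, hxe]
    have hPX : s'.arr .PX = s.arr .PX := by simp [hs.arr .PX]
    have hPH : s'.arr .PH = s.arr .PH := by simp [hs.arr .PH]
    have hlt : s.arr .PX (p + i) < s.arr .PX (p + i + 1) := hP.lt i hi
    have he : s.arr .PX (p + (i + 1)) = s.arr .PX (p + i + 1) := rfl
    have hval : ∀ j, s.arr .PX (p + i) ≤ j → j < s.arr .PX (p + i + 1) →
      h j = s.arr .PH (p + i) := hP.val i hi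
    simp [hp', hxe', hPX, hPH, hi']
    refine ⟨by omega, fun hc₁ => ?_, fun hc₁ => ?_⟩
    · have := h₁.push (en := s.arr .PX (p + i + 1)) (v := s.arr .PH (p + i)) (by omega)
        fun j h₇ h₈ => (hh j (by omega)).trans (hval j (by omega) (by omega))
      and_intros <;> first
        | omega
        | exact this
        | exact h₁
        | exact h₂
        | skip
      · intro m hm hm'
        rcases Nat.lt_or_ge m i with hmi | hmi
        · have := h₆ m hmi hm'; omega
        · obtain rfl : m = i := by omega
          omega
    · and_intros <;> first | omega | exact h₁ | exact h₂ | skip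
      · intro m hm hm'
        -- Step i ends no later than xe, so the steps before it do too, and nothing has been written
        -- yet.
        have : s'.reg .q = q := by
          by_cases h0 : i = 0
          · omega
          · have := h₆ (i - 1) (by omega) (by
              rw [show p + (i - 1) + 1 = p + i by omega]; omega)
            omega
        omega
  · rintro s' ⟨ht, ⟨h₁, h₂, h₃, h₄, h₅, h₆⟩, -⟩
    simp at ht
    exact ⟨by omega, h₁, h₂, by omega, h₄, h₅, h₆⟩

/-- Find the blocks `e` and `f` in which the window starts and ends. -/
def locate : Cmd :=
  set .e 0 ;; set .f 0 ;; .rep .d .dl (V .K) (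
    set .u (get .PX (get .DP (V .d) + get .DS (V .d))) ;;
    .ite ((V .a2).lt (V .u)) .skip (set .e (V .d + 1)) ;;
    .ite ((V .u).lt (V .xe)) (set .f (V .d + 1)) .skip)

/-- Block boundaries increase, so the last successful test determines each block: e is the last one
that starts at or before x, and f the last one that starts before xe. -/
theorem locate_ok {L N w x xe : ℕ} {s : St} {X : ℕ → ℕ} (hx : s.reg .a2 = x)
    (hxe : s.reg .xe = xe) (hxx : x < xe) (hxw : xe ≤ w) (hX0 : X 0 = 0)
    (hXK : X (s.reg .K) = w) (hmono : ∀ d < s.reg .K, X d < X (d + 1))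
    (hX : ∀ d < s.reg .K, s.arr .PX (s.arr .DP d + s.arr .DS d) = X (d + 1))
    (hN : ∀ d < s.reg .K, s.arr .DP d + s.arr .DS d < N) (hNL : N < L) (hK : s.reg .K + 2 < L) :
    Ok L locate s fun s' => s'.t ≤ s.t + (s.reg .K * 80 + 20) ∧ s'.reg .e ≤ s'.reg .f ∧
      s'.reg .f < s.reg .K ∧ X (s'.reg .e) ≤ x ∧ x < X (s'.reg .e + 1) ∧
      X (s'.reg .f) < xe ∧ xe ≤ X (s'.reg .f + 1) := by
  have hm : ∀ d' d, d' ≤ d → d ≤ s.reg .K → X d' ≤ X d := by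
    intro d' d h₁ h₂
    induction d, h₁ using Nat.le_induction with
    | base => exact le_rfl
    | succ d h₁ ih => exact (ih (by omega)).trans (hmono d (by omega)).le
  simp only [locate, Ok_seq, Ok_set]
  refine ⟨by simp; omega, by simp; omega, ?_⟩
  refine (Ok.rep (fun k s' => s'.reg .e ≤ k ∧ s'.reg .f ≤ k ∧ X (s'.reg .e) ≤ x ∧
    X (s'.reg .f) < xe ∧ (∀ d, s'.reg .e ≤ d → d < k → x < X (d + 1)) ∧
    ∀ d, s'.reg .f ≤ d → d < k → xe ≤ X (d + 1)) (s.reg .K) 70 ?_ ?_ ?_ ?_ ?_).mono ?_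
  · simp
  · simp
  · omega
  · simp [hX0]; omega
  · rintro d hd s' ⟨h₁, h₂, h₃, h₄, h₅, h₆⟩ hi hs
    have hx' : s'.reg .a2 = x := by simp [hs.reg .a2, hx]
    have hxe' : s'.reg .xe = xe := by simp [hs.reg .xe, hxe]
    have hPX : s'.arr .PX = s.arr .PX := by simp [hs.arr .PX]
    have hDP : s'.arr .DP = s.arr .DP := by simp [hs.arr .DP]
    have hDS : s'.arr .DS = s.arr .DS := by simp [hs.arr .DS]
    have hNd := hN d hd
    simp [hx', hxe', hPX, hDP, hDS, hi, hX d hd]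
    have hmd := hm
    refine ⟨by omega, fun hc₁ => ?_, fun hc₁ => ⟨by omega, ?_⟩⟩
    all_goals refine ⟨fun hc₂ => ?_, fun hc₂ => ?_⟩
    all_goals and_intros
    all_goals first
      | omega
      | intro d' h₇ h₈
        rcases Nat.lt_or_ge d' d with h₉ | h₉
        · first
          | exact h₅ d' (by omega) h₉
          | exact h₆ d' (by omega) h₉
        · obtain rfl : d' = d := by omega
          omega
  · rintro s' ⟨ht, ⟨h₁, h₂, h₃, h₄, h₅, h₆⟩, -⟩
    simp at ht
    have he : s'.reg .e < s.reg .K := by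
      by_contra hc
      rw [show s'.reg .e = s.reg .K by omega, hXK] at h₃; omega
    have hf : s'.reg .f < s.reg .K := by
      by_contra hc
      rw [show s'.reg .f = s.reg .K by omega, hXK] at h₄; omega
    have h₇ := h₆ _ le_rfl hf
    refine ⟨by omega, ?_, hf, h₃, h₅ _ le_rfl he, h₄, h₇⟩
    by_contra hc
    have := hm (s'.reg .f + 1) (s'.reg .e) (by omega) he.le
    omega

/-- Raise `mx` to the maximal height in the blocks strictly between `e` and `f`. -/
def maxMid : Cmd :=
  .rep .d .dl (V .f) (
    .ite ((V .e).lt (V .d)) (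
      set .u (get .SH (get .DP (V .d) + get .DS (V .d) - 1)) ;;
      .ite ((V .mx).lt (V .u)) (set .mx (V .u)) .skip) .skip)

/-- A block strictly between e and f lies inside the window. Its maximum, the last of its sorted
heights, is therefore attained in the window and is read in constant time. -/
theorem maxMid_ok {L N K e f x xe : ℕ} {s : St} {h X : ℕ → ℕ} (he : s.reg .e = e)
    (hf : s.reg .f = f) (heK : e < K) (hfK : f < K) (hK : K + 2 < L) (hNL : N < L)
    (hmono : ∀ d' d, d' ≤ d → d ≤ K → X d' ≤ X d) (hxe : x < X (e + 1)) (hxf : X f < xe)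
    (hX : ∀ d < K, s.arr .PX (s.arr .DP d) = X d ∧
      s.arr .PX (s.arr .DP d + s.arr .DS d) = X (d + 1) ∧
      Blk s.arr h (s.arr .DP d) (s.arr .DS d) ∧ 0 < s.arr .DS d ∧ s.arr .DP d + s.arr .DS d < N)
    (hm : Hit h x xe (s.reg .mx)) :
    Ok L maxMid s fun s' => s'.t ≤ s.t + (f * 80 + 20) ∧ s.reg .mx ≤ s'.reg .mx ∧
      Hit h x xe (s'.reg .mx) ∧ ∀ j, X (e + 1) ≤ j → j < X f → h j ≤ s'.reg .mx := by
  refine (Ok.rep (fun k s' => s.reg .mx ≤ s'.reg .mx ∧ Hit h x xe (s'.reg .mx) ∧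
    ∀ j, X (e + 1) ≤ j → j < X k → h j ≤ s'.reg .mx) f 72 ?_ ?_ ?_ ?_ ?_).mono ?_
  · simp
  · simp [hf]
  · omega
  · refine ⟨by simp, by simpa using hm, fun j h₁ h₂ => ?_⟩
    have := hmono 0 (e + 1) (Nat.zero_le _) heK
    omega
  · rintro d hd s' ⟨h₁, h₂, h₃⟩ hi hs
    obtain ⟨x₁, x₂, hb, hz, hN⟩ := hX d (by omega)
    have he' : s'.reg .e = e := by simp [hs.reg .e, he]
    have hDP : s'.arr .DP = s.arr .DP := by simp [hs.arr .DP]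
    have hDS : s'.arr .DS = s.arr .DS := by simp [hs.arr .DS]
    have hSH : s'.arr .SH = s.arr .SH := by simp [hs.arr .SH]
    have hle := hb.le_max
    obtain ⟨j₀, hj₀, hj₀', hj₁⟩ := hb.max_mem hz
    rw [x₁, x₂] at hle
    rw [x₁] at hj₀
    rw [x₂] at hj₀'
    have hmd := hmono (d + 1) f hd hfK.le
    simp [he', hDP, hDS, hSH, hi]
    refine ⟨fun hc₁ => ⟨by omega, fun hc₂ => ?_, fun hc₂ => ?_⟩, fun hc₁ => ?_⟩
    · have hmd' := hmono (e + 1) d hc₁ (by omega)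
      refine ⟨by omega, .inr ⟨j₀, by omega, by omega, hj₁⟩, fun j h₄ h₅ => ?_⟩
      by_cases hj : j < X d
      · exact (h₃ j h₄ hj).trans hc₂.le
      · exact hle j (by omega) h₅
    · refine ⟨h₁, h₂, fun j h₄ h₅ => ?_⟩
      by_cases hj : j < X d
      · exact h₃ j h₄ hj
      · exact (hle j (by omega) h₅).trans hc₂
    · have hmd' := hmono (d + 1) (e + 1) (by omega)
      exact ⟨h₁, h₂, fun j h₄ h₅ => by omega⟩
  · rintro s' ⟨ht, ⟨h₁, h₂, h₃⟩, -⟩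
    simp at ht
    exact ⟨by omega, h₁, h₂, h₃⟩

/-- Find the height at which the rectangle lands, and write the steps of the new contour which
replace the blocks from `e` to `f` to the buffer. -/
def gather : Cmd :=
  set .xe (V .a2 + V .a0) ;; locate ;; set .mx 0 ;;
  set .p (get .DP (V .e)) ;; set .z (get .DS (V .e)) ;; maxBlk ;; pushLeft ;; maxMid ;;
  set .p (get .DP (V .f)) ;; set .z (get .DS (V .f)) ;; maxBlk ;;
  set .y (V .mx + V .a1) ;; put .BH (V .q) (V .y) ;; put .BX (V .q + 1) (V .xe) ;;
  set .q (V .q + 1) ;; pushRight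

/-- The window is covered by parts of the blocks e and f and by whole blocks between them, so m is
the maximum of the contour on it. The buffer receives what remains of e on the left, one new step
and what remains of f on the right. The bounds on its length are what the potential argument needs.
-/
theorem gather_ok {L N w a b x : ℕ} {s : St} {h : ℕ → ℕ} (hD : Dir s.arr h N (s.reg .B) 0 (s.reg .K) 0 w)
    (ha : s.reg .a0 = a) (hb : s.reg .a1 = b) (hx : s.reg .a2 = x) (ha0 : 0 < a) (hxw : x + a ≤ w)
    (hN : N + 4 * s.reg .B + 4 < L) (hK : s.reg .K + 2 < L) (hwa : w < L)
    (hh : ∀ j < w, h j + b < L) (hbL : b < L) :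
    Ok L gather s fun s' => s'.t ≤ s.t + (s.reg .K * 160 + s.reg .B * 800 + 500) ∧
      s'.reg .e ≤ s'.reg .f ∧ s'.reg .f < s.reg .K ∧ ∃ m l r, Hit h x (x + a) m ∧
      (∀ j, x ≤ j → j < x + a → h j ≤ m) ∧ s'.reg .y = m + b ∧
      Pcs (fun j => if x ≤ j ∧ j < x + a then m + b else h j) (s'.arr .BX) (s'.arr .BH)
        (s'.reg .q) ∧
      s'.arr .BX 0 = l ∧ s'.arr .BX (s'.reg .q) = r ∧ l ≤ x ∧ x + a ≤ r ∧
      Dir s.arr h N (s.reg .B) 0 (s'.reg .e) 0 l ∧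
      Dir s.arr h N (s.reg .B) (s'.reg .f + 1) (s.reg .K) r w ∧ 0 < s'.reg .q ∧
      (s'.reg .e < s'.reg .f →
        s'.reg .q ≤ s.arr .DS (s'.reg .e) + s.arr .DS (s'.reg .f) + 2) ∧
      (s'.reg .e = s'.reg .f → s'.reg .q ≤ s.arr .DS (s'.reg .e) + 2) ∧ s'.reg .q ≤ 4 * s.reg .B := by
  obtain ⟨X, hX0, hXK, hX⟩ := hD
  have hX' : ∀ d < s.reg .K, s.arr .PX (s.arr .DP d) = X d ∧
      s.arr .PX (s.arr .DP d + s.arr .DS d) = X (d + 1) ∧ Blk s.arr h (s.arr .DP d) (s.arr .DS d) ∧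
      0 < s.arr .DS d ∧ s.arr .DS d < 2 * s.reg .B ∧ s.arr .DP d + s.arr .DS d < N :=
    fun d hd => hX d (Nat.zero_le _) hd
  have hm : ∀ d' d, d' ≤ d → d ≤ s.reg .K → X d' ≤ X d := by
    intro d' d h₁ h₂
    have : Dir s.arr h N (s.reg .B) d' d (X d') (X d) :=
      ⟨X, rfl, rfl, fun d _ h₄ => hX' d (by omega)⟩
    exact this.lo_le_hi h₁
  have hm₁ : ∀ d < s.reg .K, X d < X (d + 1) := by
    intro d hd
    obtain ⟨h₁, h₂, h₃, h₄, -⟩ := hX' d hd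
    have h₅ := h₃.pcs.mono (i := 1) (j := s.arr .DS d) h₄ le_rfl
    have h₆ := h₃.pcs.lt 0 h₄
    simp only [Nat.add_zero, Nat.zero_add, h₁, h₂] at h₅ h₆
    omega
  simp only [gather, Ok_seq, Ok_set, Ok_put]
  refine ⟨by simp; omega, ?_⟩
  refine (locate_ok (L := L) (N := N) (w := w) (x := x) (xe := x + a) (X := X) ?_ ?_ (by omega) hxw
    hX0 ?_ ?_ ?_ ?_ (by omega) ?_).bind ?_
  · simp [hx]
  · simp [ha, hx]
  · simpa using hXK
  · simpa using hm₁
  · simpa using fun d hd => (hX' d hd).2.1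
  · simpa using fun d hd => (hX' d hd).2.2.2.2.2
  · simpa using hK
  rintro s₁ ⟨ht₁, hef, hfK, he₁, he₂, hf₁, hf₂⟩ hs₁
  set e := s₁.reg .e with he
  set f := s₁.reg .f with hf
  simp only [St.setr_reg, reduceCtorEq, if_false] at ht₁ hef hfK he₁ he₂ hf₁ hf₂
  have heK : e < s.reg .K := by omega
  obtain ⟨xe₁, xe₂, be, ze₀, ze₂, Ne⟩ := hX' e heK
  obtain ⟨xf₁, xf₂, bf, zf₀, zf₂, Nf⟩ := hX' f hfK
  have a₁ : s₁.arr = s.arr := by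
    funext A; rw [hs₁.arr' A (by cases A <;> decide)]; rfl
  have hx₁ : s₁.reg .a2 = x := by simp [hs₁.reg .a2, hx]
  have hb₁ : s₁.reg .a1 = b := by simp [hs₁.reg .a1, hb]
  have hxe₁ : s₁.reg .xe = x + a := by simp [hs₁.reg .xe, hx, ha]
  refine ⟨by simp; omega, by simp [← he]; omega, by simp [← he]; omega, ?_⟩
  refine (maxBlk_ok (L := L) (p := s.arr .DP e) (z := s.arr .DS e) (x := x) (xe := x + a) (h := h)
    ?_ ?_ ?_ ?_ (by omega) ?_ (by omega) ?_).bind ?_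
  · simp [a₁, ← he]
  · simp [a₁, ← he]
  · simp [hx₁]
  · simp [hxe₁]
  · simpa [a₁] using be.pcs
  · left; simp
  rintro s₂ ⟨ht₂, -, hit₂, cov₂⟩ hs₂
  have a₂ : s₂.arr = s.arr := by
    funext A; rw [hs₂.arr' A (by cases A <;> decide)]; simp [a₁]
  simp only [St.setr_t, St.setr_arr, a₁, xe₁, xe₂] at ht₂ cov₂
  refine (pushLeft_ok (L := L) (p := s.arr .DP e) (z := s.arr .DS e) (x := x) (h := h)
    ?_ ?_ ?_ ?_ (by omega) ?_ ?_).bind ?_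
  · simp [hs₂.reg .p, a₁, ← he]
  · simp [hs₂.reg .z, a₁, ← he]
  · simp [hs₂.reg .a2, hx₁]
  · simpa [a₂] using be.pcs
  · simpa [a₂, xe₁] using he₁
  · simpa [a₂, xe₂] using he₂
  rintro s₃ ⟨ht₃, P₃, l₃, r₃, q₃, c₃⟩ hs₃
  have p₃ : Below N s.arr s₃.arr := by
    rw [← a₂]; exact hs₃.below (by intro A; cases A <;> decide) _
  have hPX₃ : s₃.arr .PX = s.arr .PX := by rw [hs₃.arr .PX, a₂]
  have hPH₃ : s₃.arr .PH = s.arr .PH := by rw [hs₃.arr .PH, a₂]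
  have hSH₃ : s₃.arr .SH = s.arr .SH := by rw [hs₃.arr .SH, a₂]
  have hDP₃ : s₃.arr .DP = s.arr .DP := by rw [hs₃.arr .DP, a₂]
  have hDS₃ : s₃.arr .DS = s.arr .DS := by rw [hs₃.arr .DS, a₂]
  have hmx₃ : s₃.reg .mx = s₂.reg .mx := hs₃.reg .mx
  have he₃ : s₃.reg .e = e := by simp [hs₃.reg .e, hs₂.reg .e, ← he]
  have hf₃ : s₃.reg .f = f := by simp [hs₃.reg .f, hs₂.reg .f, ← hf]
  rw [a₂] at l₃ c₃
  rw [xe₁] at l₃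
  refine (maxMid_ok (L := L) (N := N) (K := s.reg .K) (e := e) (f := f) (x := x) (xe := x + a)
    (h := h) (X := X) he₃ hf₃ heK hfK hK (by omega) hm he₂ hf₁ ?_ ?_).bind ?_
  · intro d hd
    obtain ⟨h₁, h₂, h₃, h₄, -, h₆⟩ := hX' d hd
    rw [hDP₃, hDS₃, hPX₃]
    exact ⟨h₁, h₂, h₃.congr p₃ h₆, h₄, h₆⟩
  · rwa [hmx₃]
  rintro s₄ ⟨ht₄, le₄, hit₄, cov₄⟩ hs₄
  have a₄ : s₄.arr = s₃.arr := by
    funext A; rw [hs₄.arr' A (by cases A <;> decide)]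
  have he₄ : s₄.reg .e = e := by rw [hs₄.reg .e, he₃]
  have hf₄ : s₄.reg .f = f := by rw [hs₄.reg .f, hf₃]
  refine ⟨by simp [hf₄]; omega, by simp [hf₄, a₄]; omega, ?_⟩
  refine (maxBlk_ok (L := L) (p := s.arr .DP f) (z := s.arr .DS f) (x := x) (xe := x + a) (h := h)
    ?_ ?_ ?_ ?_ (by omega) ?_ (by omega) ?_).bind ?_
  · simp [a₄, hDP₃, hf₄]
  · simp [a₄, hDS₃, hf₄]
  · simp [hs₄.reg .a2, hs₃.reg .a2, hs₂.reg .a2, hx₁]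
  · simp [hs₄.reg .xe, hs₃.reg .xe, hs₂.reg .xe, hxe₁]
  · simpa [a₄, hPX₃, hPH₃] using bf.pcs
  · simpa using hit₄
  rintro s₅ ⟨ht₅, le₅, hit₅, cov₅⟩ hs₅
  have a₅ : s₅.arr = s₃.arr := by
    funext A; rw [hs₅.arr' A (by cases A <;> decide)]; simp [a₄]
  simp only [St.setr_t, St.setr_arr, St.setr_reg, reduceCtorEq, if_false, a₄, hPX₃, xf₁, xf₂]
    at ht₅ cov₅ le₅
  have hq₅ : s₅.reg .q = s₃.reg .q := by simp [hs₅.reg .q, hs₄.reg .q]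
  have hb₅ : s₅.reg .a1 = b := by
    simp [hs₅.reg .a1, hs₄.reg .a1, hs₃.reg .a1, hs₂.reg .a1, hb₁]
  have hxe₅ : s₅.reg .xe = x + a := by
    simp [hs₅.reg .xe, hs₄.reg .xe, hs₃.reg .xe, hs₂.reg .xe, hxe₁]
  have hef₅ : s₅.reg .e = e ∧ s₅.reg .f = f := by simp [hs₅.reg .e, hs₅.reg .f, he₄, hf₄]
  obtain ⟨m, hm₅⟩ : ∃ m, s₅.reg .mx = m := ⟨_, rfl⟩
  rw [hm₅] at hit₅ cov₅ le₅
  have cov : ∀ j, x ≤ j → j < x + a → h j ≤ m := by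
    intro j h₁ h₂
    by_cases h₃ : j < X (e + 1)
    · exact (cov₂ j h₁ h₂ (by omega) h₃).trans (by omega)
    · by_cases h₄ : j < X f
      · exact (cov₄ j (by omega) h₄).trans (by omega)
      · exact cov₅ j h₁ h₂ (by omega) (by omega)
  have hmb : m + b < L := by
    rcases hit₅ with h₁ | ⟨j, h₁, h₂, h₃⟩
    · omega
    · rw [← h₃]; exact hh j (by omega)
  have P₅ : Pcs (fun j => if x ≤ j ∧ j < x + a then m + b else h j)
      (Function.update (s₃.arr .BX) (s₃.reg .q + 1) (x + a))
      (Function.update (s₃.arr .BH) (s₃.reg .q) (m + b)) (s₃.reg .q + 1) := by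
    refine (P₃.congr_fun fun j _ h₂ => if_neg (by omega)).push (by omega) fun j h₁ h₂ => ?_
    exact if_pos (by omega)
  refine ⟨by simp [hm₅, hb₅]; omega, by simp, by simp, by simp [hq₅]; omega,
    by simp [hq₅]; omega, by simp, by simp [hq₅]; omega, by simp [hq₅]; omega, ?_⟩
  refine (pushRight_ok (L := L) (p := s.arr .DP f) (z := s.arr .DS f) (xe := x + a)
    (q := s₃.reg .q + 1) (h := h)
    (h' := fun j => if x ≤ j ∧ j < x + a then m + b else h j) ?_ ?_ ?_ ?_ ?_ (by omega) (by omega)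
    ?_ ?_ ?_ ?_ ?_).bind ?_
  · simp [hs₅.reg .p, a₄, hDP₃, hf₄]
  · simp [hs₅.reg .z, a₄, hDS₃, hf₄]
  · simp [hxe₅]
  · simp [hq₅]
  · simpa [a₅, hPX₃, hPH₃] using bf.pcs
  · simpa [a₅, hPX₃, xf₁] using hf₁.le
  · simpa [a₅, hPX₃, xf₂] using hf₂
  · simpa [a₅, hq₅, hm₅, hb₅, hxe₅] using P₅
  · simp [hq₅, hxe₅]
  · exact fun j hj => if_neg (by omega)
  rintro s₆ ⟨ht₆, P₆, l₆, r₆, q₆, q₆', c₆⟩ hs₆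
  have he₆ : s₆.reg .e = e := by simp [hs₆.reg .e, hef₅]
  have hf₆ : s₆.reg .f = f := by simp [hs₆.reg .f, hef₅]
  have hy₆ : s₆.reg .y = m + b := by simp [hs₆.reg .y, hm₅, hb₅]
  simp [a₅, hq₅, hPX₃, xf₂, l₃] at ht₆ l₆ r₆
  simp at ht₁ ht₂ ht₅
  simp only [St.setr_arr, St.seta_arr, a₅, hPX₃, if_false, reduceCtorEq] at c₆
  -- With a single block, the window can split one step into a left and a right piece. All left
  -- pieces except the last are steps ending before x, and these do not occur on the right, so at
  -- most one step is counted twice. Adding the new step gives the 2.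
  have hqq : e = f → s₆.reg .q ≤ s.arr .DS e + 2 := by
    intro hef'
    rw [← hef'] at c₆ q₆'
    by_cases h0 : s₃.reg .q ≤ 1
    · omega
    · have := c₆ (s₃.reg .q - 2) (by omega) (by
        have := c₃ (by omega)
        rw [show s.arr .DP e + (s₃.reg .q - 2) + 1 = s.arr .DP e + (s₃.reg .q - 1) by omega]
        omega)
      omega
  refine ⟨by omega, by omega, by omega, m, X e, X (f + 1), hit₅, cov, hy₆, P₆, l₆, r₆, he₁, hf₂,
    ?_, ?_, by omega, ?_, ?_, by omega⟩
  · rw [he₆]; exact ⟨X, hX0, rfl, fun d h₁ h₂ => hX' d (by omega)⟩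
  · rw [hf₆]; exact ⟨X, rfl, hXK, fun d h₁ h₂ => hX' d (by omega)⟩
  · rw [he₆, hf₆]; omega
  · rw [he₆, hf₆]; exact hqq

end RectDrop

/-! # The update program -/

namespace RectDrop

set_option linter.constructorNameAsVariable false

/-- Save the `kr` directory entries after entry `f`. -/
def save : Cmd :=
  .rep .i .il (V .kr) (put .NP (V .i) (get .DP (V .f + 1 + V .i)) ;;
    put .NS (V .i) (get .DS (V .f + 1 + V .i)))

theorem save_ok {L : ℕ} {s : St} (hL : s.reg .f + s.reg .kr + 2 < L) :
    Ok L save s fun s' => s'.t ≤ s.t + (s.reg .kr * 60 + 20) ∧ ∀ i < s.reg .kr,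
      s'.arr .NP i = s.arr .DP (s.reg .f + 1 + i) ∧
      s'.arr .NS i = s.arr .DS (s.reg .f + 1 + i) := by
  refine (Ok.rep (fun k s' => ∀ i < k,
      s'.arr .NP i = s.arr .DP (s.reg .f + 1 + i) ∧
      s'.arr .NS i = s.arr .DS (s.reg .f + 1 + i)) (s.reg .kr) 52 ?_ ?_ ?_ ?_ ?_).mono ?_
  · simp
  · simp
  · omega
  · simp
  · intro k hk s' hI hi hs
    have hDP : s'.arr .DP = s.arr .DP := hs.arr .DP
    have hDS : s'.arr .DS = s.arr .DS := hs.arr .DS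
    have hf : s'.reg .f = s.reg .f := hs.reg .f
    simp [hi, hDP, hDS, hf]
    and_intros <;> try omega
    intro i hik
    rcases Nat.lt_or_ge i k with h | h
    · rw [Function.update_of_ne (by omega), Function.update_of_ne (by omega)]; exact hI i h
    · obtain rfl : i = k := by omega
      simp
  · rintro s' ⟨ht, hI, -⟩
    simp at ht
    exact ⟨by omega, hI⟩

/-- Append the saved directory entries. -/
def restore : Cmd :=
  .rep .i .il (V .kr) (put .DP (V .K + V .i) (get .NP (V .i)) ;;
    put .DS (V .K + V .i) (get .NS (V .i)))

theorem restore_ok {L : ℕ} {s : St} (hL : s.reg .K + s.reg .kr + 2 < L) :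
    Ok L restore s fun s' => s'.t ≤ s.t + (s.reg .kr * 60 + 20) ∧
      (∀ i < s.reg .kr, s'.arr .DP (s.reg .K + i) = s.arr .NP i ∧
        s'.arr .DS (s.reg .K + i) = s.arr .NS i) ∧
      ∀ i < s.reg .K, s'.arr .DP i = s.arr .DP i ∧ s'.arr .DS i = s.arr .DS i := by
  refine (Ok.rep (fun k s' => (∀ i < k, s'.arr .DP (s.reg .K + i) = s.arr .NP i ∧
        s'.arr .DS (s.reg .K + i) = s.arr .NS i) ∧
      ∀ i < s.reg .K, s'.arr .DP i = s.arr .DP i ∧ s'.arr .DS i = s.arr .DS i)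
    (s.reg .kr) 52 ?_ ?_ ?_ ?_ ?_).mono ?_
  · simp
  · simp
  · omega
  · simp
  · rintro k hk s' ⟨h₁, h₂⟩ hi hs
    have hNP : s'.arr .NP = s.arr .NP := hs.arr .NP
    have hNS : s'.arr .NS = s.arr .NS := hs.arr .NS
    have hK : s'.reg .K = s.reg .K := hs.reg .K
    simp [hi, hNP, hNS, hK]
    and_intros <;> try omega
    · intro i hik
      rcases Nat.lt_or_ge i k with h | h
      · rw [Function.update_of_ne (by omega), Function.update_of_ne (by omega)]; exact h₁ i h
      · obtain rfl : i = k := by omega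
        simp
    · intro i hik
      rw [Function.update_of_ne (by omega), Function.update_of_ne (by omega)]; exact h₂ i hik
  · rintro s' ⟨ht, ⟨h₁, h₂⟩, -⟩
    simp at ht
    exact ⟨by omega, h₁, h₂⟩

/-- The update program. -/
def updateCmd : Cmd :=
  gather ;; set .kr (V .K - (V .f + 1)) ;; save ;; set .K (V .e) ;;
  .ite ((V .top).lt (V .y)) (set .top (V .y)) .skip ;; .size .LG .tmp (V .top) ;;
  build ;; restore ;; set .K (V .K + V .kr) ;; set .a0 (V .top)

theorem two_pow_size_le (m : ℕ) : 2 ^ Nat.size m ≤ 2 * m + 1 := by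
  rcases Nat.eq_zero_or_pos m with rfl | h
  · simp
  · obtain ⟨k, hk⟩ := Nat.exists_eq_succ_of_ne_zero (Nat.size_pos.2 h).ne'
    have : 2 ^ k ≤ m := Nat.lt_size.1 (by omega)
    rw [hk, pow_succ]; omega

/-- The contour is unchanged outside the window, so the directory entries before e and after f
remain valid. The latter are moved behind the new blocks. The 5 in the time bound is the number of
chunks that at most 4B steps can require. -/
theorem updateCmd_ok {L w a b x : ℕ} {s : St} {h : ℕ → ℕ}
    (hD : Dir s.arr h (s.reg .fp) (s.reg .B) 0 (s.reg .K) 0 w)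
    (ha : s.reg .a0 = a) (hb : s.reg .a1 = b) (hx : s.reg .a2 = x) (ha0 : 0 < a) (hxw : x + a ≤ w)
    (hB : 0 < s.reg .B) (hN : s.reg .fp + 16 * s.reg .B + 20 < L)
    (hK : s.reg .K + 4 * s.reg .B + 10 < L) (hwa : w < L)
    (htop : ∀ j < w, h j ≤ s.reg .top) (htL : 2 * (s.reg .top + b) + 3 < L) :
    Ok L updateCmd s fun s' => s'.t ≤ s.t + (s.reg .K * 400 + 5 *
        ((Nat.size (s.reg .top + b) + 3) * (2 * s.reg .B * 150 + 200) + 100) +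
        s.reg .B * 800 + 10 * Nat.size (s.reg .top + b) + 1000) ∧
      ∃ m, Hit h x (x + a) m ∧ (∀ j, x ≤ j → j < x + a → h j ≤ m) ∧
      Dir s'.arr (fun j => if x ≤ j ∧ j < x + a then m + b else h j) (s'.reg .fp) (s.reg .B) 0
        (s'.reg .K) 0 w ∧
      Psi s'.arr (s.reg .B) 0 (s'.reg .K) ≤ Psi s.arr (s.reg .B) 0 (s.reg .K) + 2 ∧
      s'.reg .fp ≤ s.reg .fp + 8 * s.reg .B + 1 ∧
      s'.reg .top = max (s.reg .top) (m + b) ∧ s'.reg .a0 = max (s.reg .top) (m + b) := by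
  refine (gather_ok (h := h) (L := L) hD ha hb hx ha0 hxw (by omega) (by omega) hwa
    (fun j hj => by have := htop j hj; omega) (by omega)).seq ?_
  rintro s₁ ⟨ht₁, hef, hfK, m, l, r, hit, cov, hy, hP, hl, hr, hlx, hxr, hDl, hDr, hq0, hq₁, hq₂,
    hq₃⟩ hs₁
  set e := s₁.reg .e with he
  set f := s₁.reg .f with hf
  have hK₁ : s₁.reg .K = s.reg .K := hs₁.reg .K
  have hB₁ : s₁.reg .B = s.reg .B := hs₁.reg .B
  have hfp₁ : s₁.reg .fp = s.reg .fp := hs₁.reg .fp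
  have htop₁ : s₁.reg .top = s.reg .top := hs₁.reg .top
  have hDP₁ : s₁.arr .DP = s.arr .DP := hs₁.arr .DP
  have hDS₁ : s₁.arr .DS = s.arr .DS := hs₁.arr .DS
  have hb₁ : Below (s.reg .fp) s.arr s₁.arr := hs₁.below (by intro A; cases A <;> decide) _
  have hrw : r ≤ w := hDr.lo_le_hi (by omega)
  have hm : m ≤ s.reg .top := by
    rcases hit with h₁ | ⟨j, h₁, h₂, h₃⟩
    · omega
    · rw [← h₃]; exact htop j (by omega)
  obtain ⟨kr, hkr⟩ : ∃ kr, kr = s.reg .K - (f + 1) := ⟨_, rfl⟩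
  obtain ⟨top, hto⟩ : ∃ top, top = max (s.reg .top) (m + b) := ⟨_, rfl⟩
  -- Kept and new heights alike are bounded by the new top, so its number of binary digits suffices
  -- for sorting the new blocks.
  have hh : ∀ i < s₁.reg .q, s₁.arr .BH i ≤ top := by
    intro i hi
    have h₁ := hP.lt i hi
    have h₂ := hP.mono (show i + 1 ≤ s₁.reg .q from hi) le_rfl
    rw [← hP.val i hi _ le_rfl h₁]
    have := htop (s₁.arr .BX i) (by omega)
    split_ifs <;> omega
  rw [Ok_seq, Ok_set]
  refine ⟨by simp [hK₁, ← hf]; omega, ?_⟩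
  refine (save_ok ?_).seq ?_
  · simp [hK₁, ← hf]; omega
  rintro s₂ ⟨ht₂, hs⟩ hs₂
  simp [hK₁, ← hf] at ht₂ hs
  rw [← hkr] at ht₂ hs
  -- The rest of the program after the new top has been computed, common to the case where the top
  -- rises and the case where it does not.
  have hmid : ∀ s₃ : St, Same (set .K (V .e) ;;
      .ite ((V .top).lt (V .y)) (set .top (V .y)) .skip ;; .size .LG .tmp (V .top)) s₂ s₃ →
      s₃.reg .K = e → s₃.reg .top = top → s₃.reg .LG = Nat.size top →
      s₃.t ≤ s₂.t + 50 + 10 * Nat.size top → Ok L (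
      build ;; restore ;; set .K (V .K + V .kr) ;; set .a0 (V .top)) s₃ fun s' =>
      s'.t ≤ s.t + (s.reg .K * 400 + 5 *
        ((Nat.size (s.reg .top + b) + 3) * (2 * s.reg .B * 150 + 200) + 100) +
        s.reg .B * 800 + 10 * Nat.size (s.reg .top + b) + 1000) ∧
      ∃ m, Hit h x (x + a) m ∧ (∀ j, x ≤ j → j < x + a → h j ≤ m) ∧
      Dir s'.arr (fun j => if x ≤ j ∧ j < x + a then m + b else h j) (s'.reg .fp) (s.reg .B) 0
        (s'.reg .K) 0 w ∧
      Psi s'.arr (s.reg .B) 0 (s'.reg .K) ≤ Psi s.arr (s.reg .B) 0 (s.reg .K) + 2 ∧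
      s'.reg .fp ≤ s.reg .fp + 8 * s.reg .B + 1 ∧
      s'.reg .top = max (s.reg .top) (m + b) ∧ s'.reg .a0 = max (s.reg .top) (m + b) := by
    intro s₃ hs₃ hK₃ htop₃ hLG₃ ht₃
    have a₃ : s₃.arr = s₂.arr := by
      funext A; rw [hs₃.arr' A (by cases A <;> decide)]
    have hq₃' : s₃.reg .q = s₁.reg .q := by simp [hs₃.reg .q, hs₂.reg .q]
    have hB₃ : s₃.reg .B = s.reg .B := by simp [hs₃.reg .B, hs₂.reg .B, hB₁]
    have hfp₃ : s₃.reg .fp = s.reg .fp := by simp [hs₃.reg .fp, hs₂.reg .fp, hfp₁]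
    have hkr₃ : s₃.reg .kr = kr := by simp [hs₃.reg .kr, hs₂.reg .kr, hK₁, hkr, ← hf]
    have hBX₃ : s₃.arr .BX = s₁.arr .BX := by simp [a₃, hs₂.arr .BX]
    have hBH₃ : s₃.arr .BH = s₁.arr .BH := by simp [a₃, hs₂.arr .BH]
    have hDP₃ : s₃.arr .DP = s.arr .DP := by simp [a₃, hs₂.arr .DP, hDP₁]
    have hDS₃ : s₃.arr .DS = s.arr .DS := by simp [a₃, hs₂.arr .DS, hDS₁]
    have b₃ : Below (s.reg .fp) s.arr s₃.arr := by
      rw [a₃]; exact hb₁.trans (hs₂.below (by intro A; cases A <;> decide) _) le_rfl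
    have hsz : Nat.size top ≤ Nat.size (s.reg .top + b) := Nat.size_le_size (by omega)
    have hpw := two_pow_size_le top
    have hszt : Nat.size top < 2 ^ Nat.size top := Nat.lt_two_pow_self
    refine (build_ok (L := L) (h := fun j => if x ≤ j ∧ j < x + a then m + b else h j)
      ?_ ?_ ?_ ?_ ?_ ?_ ?_ ?_ ?_).seq ?_
    · rwa [hB₃]
    · rwa [hq₃']
    · rwa [hBX₃, hBH₃, hq₃']
    · rw [hfp₃, hq₃']; omega
    · rw [hK₃, hq₃']; omega
    · rw [hB₃]; omega
    · rw [hLG₃]; omega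
    · rw [hLG₃]; omega
    · rw [hq₃', hBH₃, hLG₃]
      exact fun i hi => (hh i hi).trans_lt (Nat.lt_size_self _)
    rintro s₄ ⟨ht₄, hKle, hKle', hfple, hfple', dir₄, psi₄, DP₄, DS₄, b₄⟩ hs₄
    rw [hK₃] at hKle hKle' dir₄ psi₄ DP₄ DS₄
    rw [hfp₃] at hfple hfple' b₄
    rw [hB₃] at dir₄ psi₄ ht₄
    rw [hLG₃] at ht₄
    rw [hq₃'] at hKle' hfple' dir₄ psi₄ ht₄
    rw [hBX₃, hl, hr] at dir₄
    rw [hDP₃] at DP₄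
    rw [hDS₃] at DS₄
    have hkr₄ : s₄.reg .kr = kr := by rw [hs₄.reg .kr, hkr₃]
    have htop₄ : s₄.reg .top = top := by rw [hs₄.reg .top, htop₃]
    have hNP₄ : s₄.arr .NP = s₂.arr .NP := by rw [hs₄.arr .NP, a₃]
    have hNS₄ : s₄.arr .NS = s₂.arr .NS := by rw [hs₄.arr .NS, a₃]
    refine (restore_ok ?_).seq ?_
    · rw [hkr₄]; omega
    rintro s₅ ⟨ht₅, hr₅, hl₅⟩ hs₅
    rw [hkr₄] at ht₅ hr₅
    rw [hNP₄, hNS₄] at hr₅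
    have hK₅ : s₅.reg .K = s₄.reg .K := hs₅.reg .K
    have hkr₅ : s₅.reg .kr = kr := by rw [hs₅.reg .kr, hkr₄]
    have hfp₅ : s₅.reg .fp = s₄.reg .fp := hs₅.reg .fp
    have htop₅ : s₅.reg .top = top := by rw [hs₅.reg .top, htop₄]
    have b₅ : ∀ N, Below N s₄.arr s₅.arr := hs₅.below (by intro A; cases A <;> decide)
    have b₅' : Below (s.reg .fp) s.arr s₅.arr := (b₃.trans b₄ le_rfl).trans (b₅ _) le_rfl
    have hDPl : ∀ d < e, s₅.arr .DP d = s.arr .DP d := fun d hd => by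
      rw [(hl₅ d (by omega)).1, DP₄ d hd]
    have hDSl : ∀ d < e, s₅.arr .DS d = s.arr .DS d := fun d hd => by
      rw [(hl₅ d (by omega)).2, DS₄ d hd]
    have hDPr : ∀ i < kr, s₅.arr .DP (s₄.reg .K + i) = s.arr .DP (f + 1 + i) := fun i hi => by
      rw [(hr₅ i hi).1, (hs i hi).1, hDP₁]
    have hDSr : ∀ i < kr, s₅.arr .DS (s₄.reg .K + i) = s.arr .DS (f + 1 + i) := fun i hi => by
      rw [(hr₅ i hi).2, (hs i hi).2, hDS₁]
    have psil : Psi s₅.arr (s.reg .B) 0 e = Psi s.arr (s.reg .B) 0 e :=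
      Psi.congr fun d _ hd => hDSl d hd
    have psim : Psi s₅.arr (s.reg .B) e (s₄.reg .K) = Psi s₄.arr (s.reg .B) e (s₄.reg .K) :=
      Psi.congr fun d _ hd => (hl₅ d hd).2
    have psir : Psi s₅.arr (s.reg .B) (s₄.reg .K) (s₄.reg .K + kr) =
        Psi s.arr (s.reg .B) (f + 1) (f + 1 + kr) := Psi.move _ hDSr
    have psi : Psi s₅.arr (s.reg .B) 0 (s₄.reg .K + kr) ≤
        Psi s.arr (s.reg .B) 0 (s.reg .K) + 2 := by
      rw [Psi.append (k₁ := s₄.reg .K) (by omega) (by omega), Psi.append (k₁ := e) (by omega) hKle,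
        psil, psim, psir, Psi.append (A := s.arr) (k₂ := s.reg .K) (k₁ := f + 1) (by omega)
        (by omega), Psi.append (A := s.arr) (k₂ := f + 1) (k₁ := e) (by omega) (by omega),
        show f + 1 + kr = s.reg .K by omega]
      -- The potential of the new blocks is paid for by that of the end blocks up to 2. Blocks
      -- strictly between are not needed for this.
      have : max (s.reg .B) (s₁.reg .q) ≤ Psi s.arr (s.reg .B) e (f + 1) + 2 := by
        rcases hef.lt_or_eq with h₁ | h₁
        · have h₂ := hq₁ h₁
          rw [Psi.append (k₁ := f) (by omega) (by omega), Psi.append (k₁ := e + 1) (by omega) h₁,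
            Psi.single, Psi.single]
          omega
        · have h₂ := hq₂ h₁
          rw [← h₁, Psi.single]; omega
      omega
    have dir : Dir s₅.arr (fun j => if x ≤ j ∧ j < x + a then m + b else h j) (s₄.reg .fp)
        (s.reg .B) 0 (s₄.reg .K + kr) 0 w := by
      refine Dir.append (k₁ := s₄.reg .K) (mid := r) (Dir.append (k₁ := e) (mid := l) ?_ ?_
        (by omega) hKle) ?_ (by omega) (by omega)
      · refine ((hDl.congr b₅' (fun d _ hd => hDPl d hd) fun d _ hd => hDSl d hd).le_N
          hfple).congr_fun fun j _ hj => if_neg (by omega)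
      · exact dir₄.congr (b₅ _) (fun d _ hd => (hl₅ d hd).1) fun d _ hd => (hl₅ d hd).2
      · refine ((hDr.move b₅' (by omega) (by omega) (fun i hi => hDPr i (by omega))
          fun i hi => hDSr i (by omega)).le_N hfple).congr_fun fun j hj _ => if_neg (by omega)
    have hqB : s₁.reg .q / s.reg .B ≤ 4 := by
      rw [Nat.div_le_iff_le_mul_add_pred hB]; omega
    have htb : (s₁.reg .q / s.reg .B + 1) *
        ((Nat.size top + 3) * (2 * s.reg .B * 150 + 200) + 100) ≤
        5 * ((Nat.size (s.reg .top + b) + 3) * (2 * s.reg .B * 150 + 200) + 100) := by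
      gcongr
      omega
    simp [hK₅, hkr₅, htop₅, hfp₅]
    refine ⟨by omega, by omega, m, hit, cov, dir, psi, by omega⟩
  have hK₂ : s₂.reg .top = s.reg .top := by simp [hs₂.reg .top, htop₁]
  have hy₂ : s₂.reg .y = m + b := by simp [hs₂.reg .y, hy]
  have he₂ : s₂.reg .e = e := by simp [hs₂.reg .e, ← he]
  have hsz : Nat.size top < 2 ^ Nat.size top := Nat.lt_two_pow_self
  have hpw := two_pow_size_le top
  have hframe : ∀ s₃ : St, (∀ v, v ≠ .K → v ≠ .top → v ≠ .LG → v ≠ .tmp → s₃.reg v = s₂.reg v) →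
      s₃.arr = s₂.arr → s₃.inp = s₂.inp → Same (set .K (V .e) ;;
      .ite ((V .top).lt (V .y)) (set .top (V .y)) .skip ;; .size .LG .tmp (V .top)) s₂ s₃ := by
    refine fun s₃ h₁ h₂ h₃ => ⟨fun v hv => h₁ v ?_ ?_ ?_ ?_, fun A _ => by rw [h₂], h₃⟩ <;>
    · rintro rfl; simp [Cmd.mods] at hv
  rw [Ok_seq, Ok_set, Ok_seq, Ok_ite_lt]
  refine ⟨by simp, by simp, fun h₁ => ?_, fun h₁ => ?_⟩
  · simp [hK₂, hy₂] at h₁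
    have hmax : m + b = top := by omega
    rw [Ok_set, Ok_seq, Ok_size]
    simp only [Ex.val_var, St.setr_reg, St.tick_reg, reduceCtorEq, if_false, if_true, hy₂, hmax]
    refine ⟨by simp, by simp, by omega, hmid _ (hframe _ ?_ ?_ ?_) ?_ ?_ ?_ ?_⟩
    · intro v h₁ h₂ h₃ h₄; simp [h₁, h₂, h₃, h₄]
    all_goals simp [he₂]
  · simp [hK₂, hy₂] at h₁
    have hmax : s.reg .top = top := by omega
    rw [Ok_skip, Ok_seq, Ok_size]
    simp only [Ex.val_var, St.setr_reg, St.tick_reg, reduceCtorEq, if_false, hK₂]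
    refine ⟨by simp, by rw [hmax]; omega, hmid _ (hframe _ ?_ ?_ ?_) ?_ ?_ ?_ ?_⟩
    · intro v h₁ h₂ h₃ h₄; simp [h₁, h₃, h₄]
    all_goals simp [he₂, hK₂, hmax]

end RectDrop

/-! # Maxima over intervals -/

namespace RectDrop

set_option linter.constructorNameAsVariable false

/-- Every positive entry `T k` is the value of one of the `m` intervals from `l i` to `r i`, which
contains the `pw` positions from `k` on. -/
def Sound (l r v : ℕ → ℕ) (m z : ℕ) (T : ℕ → ℕ) (pw : ℕ) : Prop :=
  ∀ k < z, T k = 0 ∨ ∃ i < m, v i = T k ∧ l i ≤ k ∧ k + pw ≤ r i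

/-- The intervals of length at least `b` are covered by entries of length `pw`. -/
def Complete (l r v : ℕ → ℕ) (m z : ℕ) (T : ℕ → ℕ) (pw b : ℕ) : Prop :=
  ∀ i < m, b ≤ r i - l i → ∀ j, l i ≤ j → j < r i → ∃ k < z, k ≤ j ∧ j < k + pw ∧ v i ≤ T k

/-- Raise entry `e` of `T` to at least `f`. -/
def raise (e f : Ex) : Cmd := .ite ((get .T e).lt f) (put .T e f) .skip

theorem raise_ok {L : ℕ} {s : St} {e f : Ex} (he : e.safe L s) (hf : f.safe L s)
    (hL : e.val s < L) (het : ∀ d, e.val (s.tick d) = e.val s) (hft : ∀ d, f.val (s.tick d) = f.val s)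
    (hest : ∀ d, e.safe L (s.tick d)) (hfst : ∀ d, f.safe L (s.tick d)) :
    Ok L (raise e f) s fun s' => s'.t ≤ s.t + (2 * e.cost + 2 * f.cost + 20) ∧
      s'.arr .T = Function.update (s.arr .T) (e.val s) (max (s.arr .T (e.val s)) (f.val s)) := by
  simp [raise, he, hf, hL, het, hft, hest, hfst]
  exact ⟨fun h => ⟨by omega, by rw [max_eq_right h.le]⟩, fun h => ⟨by omega, h⟩⟩

/-- Raise the entries for the two intervals of length `pw` at the ends of a longer interval. -/
def ends : Cmd :=
  .rep .i .il (V .a2) (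
    set .l (get .RK (2 * V .i)) ;; set .r (get .RK (2 * V .i + 1)) ;;
    .ite ((V .r - V .l).lt (V .pw)) .skip (
      raise (V .l) (get .RT (V .i)) ;; raise (V .r - V .pw) (get .RT (V .i))))

/-- An interval of length from pw to 2 pw is the union of its initial and its final interval of
length pw. Longer intervals are covered already and may be entered again without harm. -/
theorem ends_ok {L m z pw b : ℕ} {s : St} {l r v : ℕ → ℕ} (hm : s.reg .a2 = m)
    (hpw : s.reg .pw = pw) (hl : ∀ i < m, s.arr .RK (2 * i) = l i)
    (hr : ∀ i < m, s.arr .RK (2 * i + 1) = r i) (hv : s.arr .RT = v)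
    (hlr : ∀ i < m, l i < r i) (hrz : ∀ i < m, r i < z) (hL : 2 * m + 2 < L) (hz : z < L)
    (hb : b ≤ 2 * pw) (hS : Sound l r v m z (s.arr .T) pw)
    (hC : Complete l r v m z (s.arr .T) pw b) (hpw0 : 0 < pw) :
    Ok L ends s fun s' => s'.t ≤ s.t + (m * 200 + 20) ∧ Sound l r v m z (s'.arr .T) pw ∧
      Complete l r v m z (s'.arr .T) pw pw := by
  refine (Ok.rep (fun k s' => Sound l r v m z (s'.arr .T) pw ∧
    (∀ j, s.arr .T j ≤ s'.arr .T j) ∧ ∀ i < k, pw ≤ r i - l i →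
      v i ≤ s'.arr .T (l i) ∧ v i ≤ s'.arr .T (r i - pw)) m 190 ?_ ?_ ?_ ?_ ?_).mono ?_
  · simp
  · simp [hm]
  · omega
  · exact ⟨hS, fun _ => le_rfl, by omega⟩
  · rintro i hi s' ⟨h₁, h₂, h₃⟩ hi' hs
    have hpw' : s'.reg .pw = pw := by simp [hs.reg .pw, hpw]
    have hRK : s'.arr .RK = s.arr .RK := hs.arr .RK
    have hRT : s'.arr .RT = v := by rw [hs.arr .RT, hv]
    have := hlr i hi
    have := hrz i hi
    have key : ∀ T', (∀ j, T' j = s'.arr .T j ∨ (j < z ∧ s'.arr .T j ≤ T' j ∧ T' j = v i ∧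
        l i ≤ j ∧ j + pw ≤ r i)) → Sound l r v m z T' pw ∧ ∀ j, s'.arr .T j ≤ T' j := by
      intro T' hT
      refine ⟨fun k hk => ?_, fun j => ?_⟩
      · rcases hT k with h | ⟨-, -, h, h'⟩
        · rw [h]; exact h₁ k hk
        · exact .inr ⟨i, hi, h.symm, h'⟩
      · rcases hT j with h | ⟨-, h, -⟩
        · exact h.ge
        · exact h
    have step : ∀ T', (∀ j, T' j = s'.arr .T j ∨ (j < z ∧ s'.arr .T j ≤ T' j ∧ T' j = v i ∧
        l i ≤ j ∧ j + pw ≤ r i)) → (pw ≤ r i - l i → v i ≤ T' (l i) ∧ v i ≤ T' (r i - pw)) →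
        Sound l r v m z T' pw ∧ (∀ j, s.arr .T j ≤ T' j) ∧ ∀ i' < i + 1, pw ≤ r i' - l i' →
        v i' ≤ T' (l i') ∧ v i' ≤ T' (r i' - pw) := by
      intro T' hT hi₁
      obtain ⟨h₄, h₅⟩ := key T' hT
      refine ⟨h₄, fun j => (h₂ j).trans (h₅ j), fun i' hi' hp => ?_⟩
      rcases Nat.lt_or_ge i' i with h | h
      · have := h₃ i' h hp
        exact ⟨this.1.trans (h₅ _), this.2.trans (h₅ _)⟩
      · obtain rfl : i' = i := by omega
        exact hi₁ hp
    simp [hi', hpw', hRK, hl i hi, hr i hi]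
    and_intros <;> try omega
    · intro hlt
      simpa using step _ (fun _ => .inl rfl) (by omega)
    · intro hge
      refine (raise_ok (by simp) ?_ ?_ ?_ ?_ ?_ ?_).bind ?_ <;> simp [hi'] <;> try omega
      intro s₁ ht₁ hT₁ hs₁
      have hi₁ : s₁.reg .i = i := by simp [hs₁.reg .i, hi']
      have hr₁ : s₁.reg .r = r i := by simp [hs₁.reg .r]
      have hp₁ : s₁.reg .pw = pw := by simp [hs₁.reg .pw, hpw']
      have hRT₁ : s₁.arr .RT = v := by simp [hs₁.arr .RT, hRT]
      refine (raise_ok ?_ ?_ ?_ ?_ ?_ ?_ ?_).bind ?_ <;> simp [hi₁, hr₁, hp₁] <;> try omega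
      intro s₂ ht₂ hT₂ hs₂
      rw [hT₂, hT₁, hRT₁, hRT]
      refine ⟨by omega, ?_⟩
      set T₁ := Function.update (s'.arr .T) (l i) (max (s'.arr .T (l i)) (v i)) with hT
      have e₁ : T₁ (l i) = max (s'.arr .T (l i)) (v i) := by simp [hT]
      have e₂ : ∀ j, j ≠ l i → T₁ j = s'.arr .T j := fun j hj => by simp [hT, hj]
      have := step (Function.update T₁ (r i - pw) (max (T₁ (r i - pw)) (v i))) (fun j => ?_)
        fun _ => ?_
      · simpa using this
      · by_cases h₄ : j = r i - pw
        · subst h₄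
          rw [Function.update_self]
          by_cases h₅ : r i - pw = l i
          · rw [h₅, e₁]; omega
          · rw [e₂ _ h₅]; omega
        · rw [Function.update_of_ne h₄]
          by_cases h₅ : j = l i
          · rw [h₅, e₁]; omega
          · rw [e₂ _ h₅]; omega
      · rw [Function.update_self]
        refine ⟨?_, le_max_right _ _⟩
        by_cases h₄ : l i = r i - pw
        · rw [h₄, Function.update_self]; exact le_max_right _ _
        · rw [Function.update_of_ne h₄, e₁]; exact le_max_right _ _
  · rintro s' ⟨ht, ⟨h₁, h₂, h₃⟩, -⟩
    simp at ht
    refine ⟨by omega, h₁, fun i hi hp j hj hj' => ?_⟩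
    by_cases hbi : b ≤ r i - l i
    · obtain ⟨k, hk, h₄, h₅, h₆⟩ := hC i hi hbi j hj hj'
      exact ⟨k, hk, h₄, h₅, h₆.trans (h₂ k)⟩
    · have := hrz i hi
      obtain ⟨h₄, h₅⟩ := h₃ i hi hp
      by_cases hjl : j < l i + pw
      · exact ⟨l i, by omega, hj, hjl, h₄⟩
      · exact ⟨r i - pw, by omega, by omega, by omega, h₅⟩

/-- Halve the length of the intervals that the entries stand for. -/
def halve : Cmd :=
  set .pw (V .pw / 2) ;; .rep .i .il (V .z) (
    set .k (V .z - 1 - V .i) ;;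
    .ite ((V .k).lt (V .pw)) .skip (raise (V .k) (get .T (V .k - V .pw))))

/-- The entry of length 2 pw at k is passed on to the two halves, at k and at k + pw. Positions are
treated from right to left, so that the entry at k - pw is still the old one when position k reads
it. -/
theorem halve_ok {L m z pw : ℕ} {s : St} {l r v : ℕ → ℕ} (hz : s.reg .z = z) (hzL : z + 2 < L)
    (hpw : s.reg .pw = 2 * pw) (hpw0 : 0 < pw) (hrz : ∀ i < m, r i < z)
    (hS : Sound l r v m z (s.arr .T) (2 * pw))
    (hC : Complete l r v m z (s.arr .T) (2 * pw) (2 * pw)) :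
    Ok L halve s fun s' => s'.t ≤ s.t + (z * 100 + 50) ∧ s'.reg .pw = pw ∧
      Sound l r v m z (s'.arr .T) pw ∧ Complete l r v m z (s'.arr .T) pw (2 * pw) := by
  simp only [halve, Ok_seq, Ok_set]
  refine ⟨by simp; omega, ?_⟩
  refine (Ok.rep (fun i s' => ∀ k < z, s'.arr .T k = if k + i < z then s.arr .T k else
    if pw ≤ k then max (s.arr .T k) (s.arr .T (k - pw)) else s.arr .T k) z 80
    ?_ ?_ ?_ ?_ ?_).bind ?_
  · simp
  · simp [hz]
  · omega
  · intro k hk; simp [hk]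
  · intro i hi s' hI hi' hs
    have hz' : s'.reg .z = z := by simp [hs.reg .z, hz]
    have hpw' : s'.reg .pw = pw := by simp [hs.reg .pw, hpw]
    rw [Ok_seq, Ok_set, Ok_ite_lt]
    refine ⟨by simp [hz', hi']; omega, by simp, fun hlt => ?_, fun hge => ?_⟩
    · simp [hz', hi', hpw'] at hlt ⊢
      intro k hk
      rw [hI k hk]
      by_cases h : k + i + 1 = z
      · rw [if_pos (by omega), if_neg (by omega), if_neg (by omega)]
      · by_cases h' : k + i < z
        · rw [if_pos h', if_pos (by omega)]
        · rw [if_neg h', if_neg (show ¬ k + (i + 1) < z by omega)]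
    · simp [hz', hi', hpw'] at hge
      refine (raise_ok (by simp) ?_ ?_ ?_ ?_ ?_ ?_).mono ?_ <;> simp [hz', hi', hpw'] <;>
        try omega
      intro s₁ ht₁ hT₁
      refine ⟨by omega, fun k hk => ?_⟩
      rw [hT₁]
      by_cases h : k = z - 1 - i
      · subst h
        rw [Function.update_self, hI _ hk, hI _ (by omega), if_pos (by omega), if_pos (by omega),
          if_neg (by omega), if_pos hge]
      · rw [Function.update_of_ne h, hI k hk]
        by_cases h' : k + i < z
        · rw [if_pos h', if_pos (by omega)]
        · rw [if_neg h', if_neg (show ¬ k + (i + 1) < z by omega)]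
  · rintro s' ⟨ht, hI, -⟩ hs
    have hpw' : s'.reg .pw = pw := by simp [hs.reg .pw, hpw]
    simp at ht
    refine ⟨by omega, hpw', fun k hk => ?_, fun i hi hp j hj hj' => ?_⟩
    · rw [hI k hk, if_neg (by omega)]
      have h₁ := hS k hk
      have h₂ := hS (k - pw) (by omega)
      have weak : ∀ t, (t = 0 ∨ ∃ i < m, v i = t ∧ l i ≤ k ∧ k + 2 * pw ≤ r i) →
          (t = 0 ∨ ∃ i < m, v i = t ∧ l i ≤ k ∧ k + pw ≤ r i) := by
        rintro t (h | ⟨i, a, b, c, d⟩)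
        · exact .inl h
        · exact .inr ⟨i, a, b, c, by omega⟩
      split_ifs with h
      · rcases max_choice (s.arr .T k) (s.arr .T (k - pw)) with h₃ | h₃ <;> rw [h₃]
        · exact weak _ h₁
        · rcases h₂ with h | ⟨i, a, b, c, d⟩
          · exact .inl h
          · exact .inr ⟨i, a, b, by omega, by omega⟩
      · exact weak _ h₁
    · obtain ⟨k, hk, h₄, h₅, h₆⟩ := hC i hi hp j hj hj'
      have hr := hrz i hi
      by_cases hjk : j < k + pw
      · refine ⟨k, hk, h₄, hjk, h₆.trans ?_⟩
        rw [hI k hk, if_neg (by omega)]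
        split_ifs
        · exact le_max_left _ _
        · exact le_rfl
      · refine ⟨k + pw, by omega, by omega, by omega, h₆.trans ?_⟩
        rw [hI _ (by omega), if_neg (by omega), if_pos (by omega), Nat.add_sub_cancel]
        exact le_max_right _ _

/-- Compute, for every position, the maximal value of an interval that contains it. -/
def cover : Cmd :=
  .size .LG .tmp (V .z) ;; set .pw 1 ;; .rep .i .il (V .LG) (set .pw (V .pw * 2)) ;;
  .rep .g .gl (V .LG) (ends ;; halve) ;; ends

/-- A sparse table for maxima run backwards. At the initial length, a power of two larger than z, no
interval is long enough, so zero entries are complete. At length 1 the entry at k belongs to an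
interval containing k and dominates all of them. -/
theorem cover_ok {L m z : ℕ} {s : St} {l r v : ℕ → ℕ} (hm : s.reg .a2 = m)
    (hz : s.reg .z = z) (hl : ∀ i < m, s.arr .RK (2 * i) = l i)
    (hr : ∀ i < m, s.arr .RK (2 * i + 1) = r i) (hv : s.arr .RT = v)
    (hlr : ∀ i < m, l i < r i) (hrz : ∀ i < m, r i < z) (hL : 2 * m + 2 < L)
    (hzL : 2 * z + 3 < L) (hT : ∀ k < z, s.arr .T k = 0) :
    Ok L cover s fun s' =>
      s'.t ≤ s.t + ((Nat.size z + 1) * (m * 200 + z * 100 + 200)) ∧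
      ∀ k < z, (s'.arr .T k = 0 ∨ ∃ i < m, v i = s'.arr .T k ∧ l i ≤ k ∧ k < r i) ∧
        ∀ i < m, l i ≤ k → k < r i → v i ≤ s'.arr .T k := by
  have hpw := two_pow_size_le z
  have hszt : Nat.size z < 2 ^ Nat.size z := Nat.lt_two_pow_self
  simp only [cover, Ok_seq, Ok_set, Ok_size]
  refine ⟨by simp, by simp [hz]; omega, by simp; omega, ?_⟩
  refine (Ok.rep (fun k s' => s'.reg .pw = 2 ^ k) (Nat.size z) 10 ?_ ?_ ?_ ?_ ?_).bind ?_
  · simp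
  · simp [hz]
  · omega
  · simp
  · intro k hk s' hI hi hs
    have : 2 ^ (k + 1) ≤ 2 ^ Nat.size z := Nat.pow_le_pow_right (by norm_num) hk
    simp [hI]
    rw [pow_succ] at this ⊢
    omega
  rintro s₁ ⟨ht₁, hpw₁, -⟩ hs₁
  have hm₁ : s₁.reg .a2 = m := by simp [hs₁.reg .a2, hm]
  have hz₁ : s₁.reg .z = z := by simp [hs₁.reg .z, hz]
  have hRK₁ : s₁.arr .RK = s.arr .RK := by simp [hs₁.arr .RK]
  have hRT₁ : s₁.arr .RT = v := by simp [hs₁.arr .RT, hv]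
  have hT₁ : s₁.arr .T = s.arr .T := by simp [hs₁.arr .T]
  refine (Ok.rep (fun k s' => s'.reg .pw = 2 ^ (Nat.size z - k) ∧
    Sound l r v m z (s'.arr .T) (2 ^ (Nat.size z - k)) ∧
    Complete l r v m z (s'.arr .T) (2 ^ (Nat.size z - k)) (2 * 2 ^ (Nat.size z - k)))
    (Nat.size z) (m * 200 + z * 100 + 70) ?_ ?_ ?_ ?_ ?_).bind ?_
  · simp
  · simp [hs₁.reg .LG, hz]
  · omega
  · refine ⟨by simpa using hpw₁, fun k hk => .inl (by simp [hT₁, hT k hk]), fun i hi h => ?_⟩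
    have h₁ := hrz i hi
    have h₂ := Nat.lt_size_self z
    simp at h
    omega
  · rintro k hk s' ⟨h₁, h₂, h₃⟩ hi hs
    have h2k : 2 ^ (Nat.size z - k) = 2 * 2 ^ (Nat.size z - (k + 1)) := by
      rw [← pow_succ']; congr 1; omega
    have hpos : 0 < 2 ^ (Nat.size z - (k + 1)) := by positivity
    have hRK : s'.arr .RK = s.arr .RK := by simp [hs.arr .RK, hRK₁]
    refine (ends_ok (L := L) (m := m) (z := z) (pw := 2 ^ (Nat.size z - k))
      (b := 2 * 2 ^ (Nat.size z - k)) (l := l) (r := r) (v := v) ?_ h₁ ?_ ?_ ?_ hlr hrz hL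
      (by omega) le_rfl h₂ h₃ (by positivity)).seq ?_
    · simp [hs.reg .a2, hm₁]
    · rw [hRK]; exact hl
    · rw [hRK]; exact hr
    · simp [hs.arr .RT, hRT₁]
    rintro s₂ ⟨ht₂, h₄, h₅⟩ hs₂
    have hpw₂ : s₂.reg .pw = 2 ^ (Nat.size z - k) := by rw [hs₂.reg .pw, h₁]
    rw [h2k] at h₄ h₅ hpw₂
    refine (halve_ok (L := L) (z := z) ?_ (by omega) hpw₂ hpos hrz h₄ h₅).mono ?_
    · simp [hs₂.reg .z, hs.reg .z, hz₁]
    rintro s₃ ⟨ht₃, h₆, h₇, h₈⟩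
    exact ⟨by omega, by simpa using h₆, by simpa using h₇, by simpa using h₈⟩
  rintro s₂ ⟨ht₂, ⟨h₁, h₂, h₃⟩, -⟩ hs₂
  simp only [Nat.sub_self, pow_zero] at h₁ h₂ h₃
  refine (ends_ok (L := L) (m := m) (z := z) (pw := 1) (b := 2 * 1) (l := l) (r := r) (v := v)
    ?_ h₁ ?_ ?_ ?_ hlr hrz hL (by omega) le_rfl h₂ h₃ one_pos).mono ?_
  · simp [hs₂.reg .a2, hm₁]
  · simpa [hs₂.arr .RK, hRK₁] using hl
  · simpa [hs₂.arr .RK, hRK₁] using hr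
  · simp [hs₂.arr .RT, hRT₁]
  rintro s₃ ⟨ht₃, h₄, h₅⟩
  simp [hz] at ht₁ ht₂
  have e : (Nat.size z + 1) * (m * 200 + z * 100 + 200) = Nat.size z * (m * 200 + z * 100 + 70 + 8)
    + Nat.size z * 122 + (m * 200 + z * 100 + 200) := by ring
  refine ⟨by omega, fun k hk => ⟨?_, fun i hi h₆ h₇ => ?_⟩⟩
  · exact h₄ k hk
  · obtain ⟨k', hk', h₈, h₉, h₁₀⟩ := h₅ i hi (by omega) k h₆ h₇
    obtain rfl : k' = k := by omega
    exact h₁₀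

end RectDrop

/-! # Construction -/

namespace RectDrop

set_option linter.constructorNameAsVariable false

/-- Compute the size `B` of the blocks. -/
def blockSize : Cmd :=
  .size .lg .tmp (V .a0) ;; set .B 1 ;; .rep .i .il (V .a0) (
    .ite ((V .B * V .B).lt (V .a0 * V .lg)) (set .B (V .B + 1)) .skip) ;;
  .size .LZ .tmp (V .B * 2)

/-- B is incremented from 1 until B² reaches n · size n. The n rounds suffice because size n ≤ n.
The bound on B - 1, from the last increment, limits B from above. -/
theorem blockSize_ok {L n : ℕ} {s : St} (hn : s.reg .a0 = n) (hn0 : 0 < n)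
    (hL : (n + 2) * (n + 2) < L) :
    Ok L blockSize s fun s' => s'.t ≤ s.t + (n * 70 + 100) ∧ 0 < s'.reg .B ∧
      n * Nat.size n ≤ s'.reg .B * s'.reg .B ∧
      (s'.reg .B - 1) * (s'.reg .B - 1) < n * Nat.size n ∧ s'.reg .B ≤ n + 1 ∧
      s'.reg .LZ = Nat.size (s'.reg .B * 2) := by
  have hsz : Nat.size n ≤ n := Nat.size_le.2 Nat.lt_two_pow_self
  have hszp : 0 < Nat.size n := Nat.size_pos.2 hn0
  have hnL : n + 2 < L := lt_of_le_of_lt (Nat.le_mul_of_pos_left _ (by omega)) hL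
  have h2n : 2 * (n + 2) ≤ (n + 2) * (n + 2) := Nat.mul_le_mul_right _ (by omega)
  have hnn : n * Nat.size n ≤ n * n := Nat.mul_le_mul_left _ hsz
  have hpos : 0 < n * Nat.size n := Nat.mul_pos hn0 hszp
  have hnL' : n * n < L := lt_of_le_of_lt (Nat.mul_le_mul (by omega) (by omega)) hL
  simp only [blockSize, Ok_seq, Ok_set, Ok_size]
  refine ⟨by simp, by simp [hn]; omega, by simp; omega, ?_⟩
  refine (Ok.rep (fun k s' => 0 < s'.reg .B ∧ s'.reg .B ≤ k + 1 ∧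
    (s'.reg .B = k + 1 ∨ n * Nat.size n ≤ s'.reg .B * s'.reg .B) ∧
    (s'.reg .B - 1) * (s'.reg .B - 1) < n * Nat.size n) n 20 ?_ ?_ ?_ ?_ ?_).bind ?_
  · simp
  · simp [hn]
  · omega
  · simp [hn0, hszp]
  · rintro k hk s' ⟨h₁, h₂, h₃, h₄⟩ hi hs
    have hn' : s'.reg .a0 = n := by simp [hs.reg .a0, hn]
    have hlg' : s'.reg .lg = Nat.size n := by simp [hs.reg .lg, hn]
    have hBL : s'.reg .B * s'.reg .B < L :=
      lt_of_le_of_lt (Nat.mul_le_mul (by omega) (by omega)) hL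
    simp [hn', hlg']
    refine ⟨by omega, fun h₅ => ⟨by omega, h₂, by omega, h₅⟩,
      fun h₅ => ⟨h₁, by omega, .inr h₅, h₄⟩⟩
  rintro s' ⟨ht, ⟨h₁, h₂, h₃, h₄⟩, -⟩ -
  have hBn : n * Nat.size n ≤ s'.reg .B * s'.reg .B := by
    rcases h₃ with h | h
    · rw [h]; exact hnn.trans (Nat.mul_le_mul (by omega) (by omega))
    · exact h
  have hsB : Nat.size (s'.reg .B * 2) ≤ s'.reg .B * 2 := Nat.size_le.2 Nat.lt_two_pow_self
  simp [hn] at ht ⊢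
  exact ⟨by omega, by omega, by omega, h₁, hBn, h₄, h₂⟩

/-- Read the rectangles. -/
def readRects : Cmd :=
  set .top 0 ;; .rep .i .il (V .a2) (
    put .KEY (2 * V .i) (.inp (4 * V .i)) ;;
    put .KEY (2 * V .i + 1) (.inp (4 * V .i) + .inp (4 * V .i + 2)) ;;
    put .RT (V .i) (.inp (4 * V .i + 1) + .inp (4 * V .i + 3)) ;;
    .ite ((V .top).lt (get .RT (V .i))) (set .top (get .RT (V .i))) .skip) ;;
  put .KEY (2 * V .a2) 0 ;; put .KEY (2 * V .a2 + 1) (V .a1) ;; set .z (2 * V .a2 + 2) ;;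
  .rep .i .il (V .z) (put .ID (V .i) (V .i))

/-- Each rectangle supplies the keys of its two vertical sides. The two extra keys 0 and w make the
sorted sequence run from one side of the board to the other. -/
theorem readRects_ok {L m w : ℕ} {s : St} (hm : s.reg .a2 = m) (hw : s.reg .a1 = w)
    (hD : s.reg .D = 4 * m) (hL : 4 * m + 10 < L)
    (hx : ∀ i < m, s.inp (4 * i) + s.inp (4 * i + 2) < L)
    (hy : ∀ i < m, s.inp (4 * i + 1) + s.inp (4 * i + 3) < L) :
    Ok L readRects s fun s' => s'.t ≤ s.t + (m * 300 + 200) ∧ s'.reg .z = 2 * m + 2 ∧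
      (∀ i < m, s'.arr .KEY (2 * i) = s.inp (4 * i) ∧
        s'.arr .KEY (2 * i + 1) = s.inp (4 * i) + s.inp (4 * i + 2) ∧
        s'.arr .RT i = s.inp (4 * i + 1) + s.inp (4 * i + 3) ∧ s'.arr .RT i ≤ s'.reg .top) ∧
      (s'.reg .top = 0 ∨ ∃ i < m, s'.reg .top = s'.arr .RT i) ∧
      s'.arr .KEY (2 * m) = 0 ∧ s'.arr .KEY (2 * m + 1) = w ∧
      ∀ i < 2 * m + 2, s'.arr .ID i = i := by
  simp only [readRects, Ok_seq, Ok_set, Ok_put]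
  refine ⟨by simp; omega, ?_⟩
  refine (Ok.rep (fun k s' => (∀ i < k, s'.arr .KEY (2 * i) = s.inp (4 * i) ∧
        s'.arr .KEY (2 * i + 1) = s.inp (4 * i) + s.inp (4 * i + 2) ∧
        s'.arr .RT i = s.inp (4 * i + 1) + s.inp (4 * i + 3) ∧ s'.arr .RT i ≤ s'.reg .top) ∧
      (s'.reg .top = 0 ∨ ∃ i < k, s'.reg .top = s'.arr .RT i)) m 180 ?_ ?_ ?_ ?_ ?_).bind ?_
  · simp
  · simp [hm]
  · omega
  · simp
  · rintro k hk s' ⟨h₁, h₂⟩ hi hs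
    have hinp : s'.inp = s.inp := by rw [hs.inp]; rfl
    have hD' : s'.reg .D = 4 * m := by simp [hs.reg .D, hD]
    have h₃ := hx k hk
    have h₄ := hy k hk
    simp [hi, hinp, hD']
    have key : ∀ t, s'.reg .top ≤ t → s.inp (4 * k + 1) + s.inp (4 * k + 3) ≤ t → ∀ i ≤ k,
        Function.update (Function.update (s'.arr .KEY) (2 * k) (s.inp (4 * k))) (2 * k + 1)
          (s.inp (4 * k) + s.inp (4 * k + 2)) (2 * i) = s.inp (4 * i) ∧
        Function.update (Function.update (s'.arr .KEY) (2 * k) (s.inp (4 * k))) (2 * k + 1)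
          (s.inp (4 * k) + s.inp (4 * k + 2)) (2 * i + 1) = s.inp (4 * i) + s.inp (4 * i + 2) ∧
        Function.update (s'.arr .RT) k (s.inp (4 * k + 1) + s.inp (4 * k + 3)) i =
          s.inp (4 * i + 1) + s.inp (4 * i + 3) ∧
        Function.update (s'.arr .RT) k (s.inp (4 * k + 1) + s.inp (4 * k + 3)) i ≤ t := by
      intro t ht ht' i hik
      rw [Function.update_of_ne (by omega)]
      rcases hik.lt_or_eq with h | rfl
      · obtain ⟨a, b, c, d⟩ := h₁ i h
        rw [Function.update_of_ne (by omega), Function.update_of_ne (by omega),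
          Function.update_of_ne (by omega), Function.update_of_ne (by omega)]
        exact ⟨a, b, c, d.trans ht⟩
      · simp [ht']
    and_intros <;> first | omega | skip
    · intro hlt
      refine ⟨by omega, key _ hlt.le le_rfl, .inr ⟨k, le_rfl, by simp⟩⟩
    · intro hge
      refine ⟨key _ le_rfl hge, ?_⟩
      rcases h₂ with h | ⟨i, hi, h⟩
      · exact .inl h
      · exact .inr ⟨i, hi.le, by rw [Function.update_of_ne (by omega)]; exact h⟩
  rintro s₁ ⟨ht₁, ⟨h₁, h₂⟩, -⟩ hs₁
  have hm₁ : s₁.reg .a2 = m := by simp [hs₁.reg .a2, hm]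
  have hw₁ : s₁.reg .a1 = w := by simp [hs₁.reg .a1, hw]
  simp only [Ex.safe_mul, Ex.safe_add, Ex.safe_lit, Ex.safe_var, Ex.val_add, Ex.val_mul,
    Ex.val_lit, Ex.val_var, St.seta_reg, hm₁, hw₁]
  refine ⟨by simp; omega, by omega, by omega, by simp; omega, by simp, by omega, by simp; omega, ?_⟩
  refine (Ok.rep (fun k s' => ∀ i < k, s'.arr .ID i = i) (2 * m + 2) 30 ?_ ?_ ?_ ?_ ?_).bind ?_
  · simp
  · simp
  · omega
  · simp
  · intro k hk s' hI hi hs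
    simp [hi]
    refine ⟨by omega, fun i hik => ?_⟩
    rcases hik.lt_or_eq with h | rfl
    · rw [Function.update_of_ne (by omega)]; exact hI i h
    · simp
  rintro s₂ ⟨ht₂, hI, -⟩ hs₂
  have hKEY : ∀ i, s₂.arr .KEY i =
      Function.update (Function.update (s₁.arr .KEY) (2 * m) 0) (2 * m + 1) w i := by
    simp [hs₂.arr .KEY]
  have hRT : s₂.arr .RT = s₁.arr .RT := by simp [hs₂.arr .RT]
  have htop : s₂.reg .top = s₁.reg .top := by simp [hs₂.reg .top]
  simp at ht₁ ht₂
  refine ⟨by omega, by simp [hs₂.reg .z], fun i hi => ?_, by rwa [htop, hRT], ?_, ?_, hI⟩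
  · rw [hKEY, hKEY, hRT, htop, Function.update_of_ne (by omega), Function.update_of_ne (by omega),
      Function.update_of_ne (by omega), Function.update_of_ne (by omega)]
    exact h₁ i hi
  · rw [hKEY, Function.update_of_ne (by omega), Function.update_self]
  · rw [hKEY, Function.update_self]

/-- Sort the coordinates: `RK` gives their ranks, and `XS` the sorted sequence. -/
def rank : Cmd :=
  .size .LG .tmp (V .a1) ;; sort ;; .rep .i .il (V .z) (
    put .RK (get .ID (V .i)) (V .i) ;; put .XS (V .i) (get .KEY (get .ID (V .i))))

/-- The loop inverts the sorting permutation. Its invariant only says that position `RK` j holds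
index j, which needs no injectivity. Equal coordinates receive different ranks; the empty steps
between them are discarded later. -/
theorem rank_ok {L w z : ℕ} {s : St} (hw : s.reg .a1 = w) (hz : s.reg .z = z)
    (hID : ∀ i < z, s.arr .ID i = i) (hkey : ∀ i < z, s.arr .KEY i ≤ w) (hL : 2 * z + 3 < L)
    (hwL : 2 * w + 3 < L) :
    Ok L rank s fun s' =>
      s'.t ≤ s.t + ((Nat.size w + 1) * (z * 250 + 200)) ∧
      (∀ j < z, s'.arr .RK j < z ∧ s'.arr .XS (s'.arr .RK j) = s.arr .KEY j) ∧
      (∀ i < z, s'.arr .XS i ≤ w) ∧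
      ∀ i j, i ≤ j → j < z → s'.arr .XS i ≤ s'.arr .XS j := by
  have hpw := two_pow_size_le w
  have hszt : Nat.size w < 2 ^ Nat.size w := Nat.lt_two_pow_self
  simp only [rank, Ok_seq, Ok_size]
  refine ⟨by simp, by simp [hw]; omega, ?_⟩
  refine (sort_ok (L := L) ?_ ?_ ?_ ?_ (by omega) ?_).bind ?_
  · simp [hz]; omega
  · simp [hz]; exact fun i hi => by rw [hID i hi]; omega
  · simp [hw]; omega
  · simp [hw]; omega
  · simp [hw, hz]
    exact fun i hi => by rw [hID i hi]; exact (hkey i hi).trans_lt (Nat.lt_size_self _)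
  simp [hw, hz]
  intro s₁ ht₁ hperm hpair hs₁
  have hz₁ : s₁.reg .z = z := by simp [hs₁.reg .z, hz]
  have hKEY₁ : s₁.arr .KEY = s.arr .KEY := by simp [hs₁.arr .KEY]
  have hIDz : ∀ i < z, s₁.arr .ID i < z := fun i hi => by
    obtain ⟨j, hj, h⟩ := mem_seg.1 (hperm.subset (mem_seg.2 ⟨i, hi, rfl⟩))
    rw [← h, hID j hj]; exact hj
  have hsurj : ∀ j < z, ∃ i < z, s₁.arr .ID i = j := fun j hj =>
    mem_seg.1 (hperm.symm.subset (mem_seg.2 ⟨j, hj, hID j hj⟩))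
  refine (Ok.rep (fun k s' => ∀ i < k, s'.arr .XS i = s.arr .KEY (s₁.arr .ID i) ∧
      s'.arr .RK (s₁.arr .ID i) < k ∧ s₁.arr .ID (s'.arr .RK (s₁.arr .ID i)) = s₁.arr .ID i)
      z 80 ?_ ?_ ?_ ?_ ?_).bind ?_
  · simp
  · simp [hz₁]
  · omega
  · simp
  · intro k hk s' hI hi hs
    have hID' : s'.arr .ID = s₁.arr .ID := hs.arr .ID
    have hKEY' : s'.arr .KEY = s.arr .KEY := by rw [hs.arr .KEY, hKEY₁]
    have := hIDz k hk
    simp [hi, hID', hKEY']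
    and_intros <;> try omega
    intro i hik
    by_cases h : i = k
    · subst h; simp
    · obtain ⟨h₁, h₂, h₃⟩ := hI i (by omega)
      rw [Function.update_of_ne h]
      by_cases h' : s₁.arr .ID i = s₁.arr .ID k
      · rw [h', Function.update_self, ← h']
        exact ⟨by rw [h₁, h'], by omega, rfl⟩
      · rw [Function.update_of_ne h']
        exact ⟨h₁, by omega, h₃⟩
  rintro s₂ ⟨ht₂, hI, -⟩ hs₂
  simp at ht₂
  have e : (Nat.size w + 1) * (z * 250 + 200) = Nat.size w * (z * 150 + 100) +
    (Nat.size w * (z * 100 + 100) + z * 250 + 200) := by ring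
  have e' : Nat.size w * (z * 100 + 100) = Nat.size w * (z * 100) + Nat.size w * 100 := by ring
  refine ⟨by omega, fun j hj => ?_, fun i hi => ?_, fun i j hij hj => ?_⟩
  · obtain ⟨i, hi, rfl⟩ := hsurj j hj
    obtain ⟨h₁, h₂, h₃⟩ := hI i hi
    refine ⟨h₂, ?_⟩
    rw [(hI _ h₂).1, h₃]
  · rw [(hI i hi).1]; exact hkey _ (hIDz i hi)
  · rw [(hI i (by omega)).1, (hI j hj).1]
    rcases hij.lt_or_eq with h | rfl
    · rw [seg, List.pairwise_map] at hpair
      have := (List.pairwise_iff_getElem.1 hpair) i j (by simp; omega) (by simpa using hj) h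
      simpa using this
    · exact le_rfl

/-- Write the nonempty steps to the buffer. -/
def pieces : Cmd :=
  set .q 0 ;; put .BX 0 0 ;; .rep .i .il (V .z - 1) (
    .ite ((get .XS (V .i)).lt (get .XS (V .i + 1))) (
      put .BH (V .q) (get .T (V .i)) ;; put .BX (V .q + 1) (get .XS (V .i + 1)) ;;
      set .q (V .q + 1)) .skip)

theorem pieces_ok {L w z : ℕ} {s : St} {h : ℕ → ℕ} (hz : s.reg .z = z) (hz0 : 0 < z)
    (hX0 : s.arr .XS 0 = 0) (hXz : s.arr .XS (z - 1) = w) (hw : 0 < w)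
    (hX : ∀ i, i + 1 < z → s.arr .XS i ≤ s.arr .XS (i + 1))
    (hh : ∀ i, i + 1 < z → ∀ j, s.arr .XS i ≤ j → j < s.arr .XS (i + 1) → h j = s.arr .T i)
    (hL : z + 2 < L) :
    Ok L pieces s fun s' => s'.t ≤ s.t + (z * 100 + 50) ∧
      Pcs h (s'.arr .BX) (s'.arr .BH) (s'.reg .q) ∧ s'.arr .BX 0 = 0 ∧
      s'.arr .BX (s'.reg .q) = w ∧ 0 < s'.reg .q ∧ s'.reg .q ≤ z := by
  simp only [pieces, Ok_seq, Ok_set, Ok_put]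
  refine ⟨by simp; omega, by simp; omega, by simp; omega, by simp; omega, ?_⟩
  refine (Ok.rep (fun k s' => Pcs h (s'.arr .BX) (s'.arr .BH) (s'.reg .q) ∧ s'.arr .BX 0 = 0 ∧
    s'.arr .BX (s'.reg .q) = s.arr .XS k ∧ s'.reg .q ≤ k) (z - 1) 80 ?_ ?_ ?_ ?_ ?_).bind ?_
  · simp [hz]; omega
  · simp [hz]
  · omega
  · simp [hX0]; exact ⟨by omega, by omega⟩
  · rintro i hi s' ⟨h₁, h₂, h₃, h₄⟩ hi' hs
    have hXS : s'.arr .XS = s.arr .XS := by simp [hs.arr .XS]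
    have hT : s'.arr .T = s.arr .T := by simp [hs.arr .T]
    have := hX i (by omega)
    simp [hi', hXS, hT]
    refine ⟨by omega, fun hlt => ?_, fun hge => ⟨h₁, h₂, by omega, by omega⟩⟩
    have hp := h₁.push (en := s.arr .XS (i + 1)) (v := s.arr .T i) (by omega)
      fun j hj hj' => hh i (by omega) j (by omega) hj'
    and_intros <;> first
      | omega
  rintro s' ⟨ht, ⟨h₁, h₂, h₃, h₄⟩, -⟩ -
  simp at ht
  rw [hXz] at h₃
  refine ⟨by omega, h₁, h₂, h₃, Nat.pos_of_ne_zero fun h0 => ?_, by omega⟩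
  rw [h0, h₂] at h₃; omega

/-- `h` is the upper contour of the `m` rectangles over the intervals from `x i` to `r i` with
tops at `v i`. -/
def Contour (m : ℕ) (x r v h : ℕ → ℕ) : Prop :=
  ∀ j, (∀ i < m, x i ≤ j → j < r i → v i ≤ h j) ∧
    (h j = 0 ∨ ∃ i < m, v i = h j ∧ x i ≤ j ∧ j < r i)

/-- The construction program. -/
def constructCmd : Cmd :=
  .ite (V .a1) (blockSize ;; readRects ;; rank ;; cover ;; pieces ;; set .K 0 ;; set .fp 0 ;;
    .size .LG .tmp (V .top) ;; build) .skip

/-- Between consecutive sorted coordinates no rectangle starts or ends, so the contour is constant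
there, and its value is the greatest top among the rank intervals containing that rank. `cover`
computes this maximum. -/
theorem constructCmd_ok {L n w m M : ℕ} {s : St} {h : ℕ → ℕ} (hn : s.reg .a0 = n)
    (hw : s.reg .a1 = w) (hm : s.reg .a2 = m) (hn0 : 0 < n) (hw0 : 0 < w)
    (hD : s.reg .D = 4 * m) (hT : ∀ k, s.arr .T k = 0)
    (hpos : ∀ i < m, 0 < s.inp (4 * i + 2))
    (hx : ∀ i < m, s.inp (4 * i) + s.inp (4 * i + 2) ≤ w)
    (hy : ∀ i < m, s.inp (4 * i + 1) + s.inp (4 * i + 3) ≤ M)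
    (hh : Contour m (fun i => s.inp (4 * i)) (fun i => s.inp (4 * i) + s.inp (4 * i + 2))
      (fun i => s.inp (4 * i + 1) + s.inp (4 * i + 3)) h)
    (hnL : (n + 2) * (n + 2) < L) (hmL : 20 * m + 50 < L) (hwL : 2 * w + 3 < L)
    (hML : 2 * M + 3 < L) :
    Ok L constructCmd s fun s' => s'.t ≤ s.t + (n * 70 + m * 300 +
        (Nat.size w + 1) * ((2 * m + 2) * 250 + 200) +
        (Nat.size (2 * m + 2) + 1) * (m * 200 + (2 * m + 2) * 100 + 200) + (2 * m + 2) * 100 +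
        ((2 * m + 2) / s'.reg .B + 1) *
          ((Nat.size M + 3) * (2 * s'.reg .B * 150 + 200) + 100) + 10 * Nat.size M + 600) ∧
      0 < s'.reg .B ∧ n * Nat.size n ≤ s'.reg .B * s'.reg .B ∧
      (s'.reg .B - 1) * (s'.reg .B - 1) < n * Nat.size n ∧ s'.reg .B ≤ n + 1 ∧
      s'.reg .LZ = Nat.size (s'.reg .B * 2) ∧
      (∀ i < m, s.inp (4 * i + 1) + s.inp (4 * i + 3) ≤ s'.reg .top) ∧
      (s'.reg .top = 0 ∨ ∃ i < m, s'.reg .top = s.inp (4 * i + 1) + s.inp (4 * i + 3)) ∧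
      Dir s'.arr h (s'.reg .fp) (s'.reg .B) 0 (s'.reg .K) 0 w ∧
      Psi s'.arr (s'.reg .B) 0 (s'.reg .K) ≤ max (s'.reg .B) (2 * m + 2) ∧
      s'.reg .fp ≤ 4 * m + 5 := by
  have hn2 : n + 2 < L := lt_of_le_of_lt (Nat.le_mul_of_pos_left _ (by omega)) hnL
  rw [constructCmd, Ok_ite]
  refine ⟨by simp, fun _ => ?_, fun h0 => ?_⟩
  swap
  · simp [hw] at h0; omega
  refine (blockSize_ok (L := L) (n := n) (by simpa using hn) hn0 hnL).seq ?_
  rintro s₁ ⟨ht₁, hB, hB₁, hB₂, hB₃, hLZ⟩ hs₁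
  have hinp₁ : s₁.inp = s.inp := by rw [hs₁.inp]; rfl
  refine (readRects_ok (L := L) (m := m) (w := w) ?_ ?_ ?_ (by omega) ?_ ?_).seq ?_
  · simp [hs₁.reg .a2, hm]
  · simp [hs₁.reg .a1, hw]
  · simp [hs₁.reg .D, hD]
  · rw [hinp₁]; exact fun i hi => by have := hx i hi; omega
  · rw [hinp₁]; exact fun i hi => by have := hy i hi; omega
  rintro s₂ ⟨ht₂, hz₂, hr₂, htop₂, hk₂, hk₂', hID₂⟩ hs₂
  rw [hinp₁] at hr₂
  refine (rank_ok (L := L) (w := w) (z := 2 * m + 2) ?_ hz₂ hID₂ ?_ (by omega) hwL).seq ?_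
  · simp [hs₂.reg .a1, hs₁.reg .a1, hw]
  · intro i hi
    rcases Nat.lt_or_ge i (2 * m) with h₁ | h₁
    · have h₂ := hr₂ (i / 2) (by omega)
      have h₃ := hx (i / 2) (by omega)
      rcases Nat.mod_two_eq_zero_or_one i with h₄ | h₄
      · rw [show i = 2 * (i / 2) by omega, h₂.1]; omega
      · rw [show i = 2 * (i / 2) + 1 by omega, h₂.2.1]; exact h₃
    · rcases (show i = 2 * m ∨ i = 2 * m + 1 by omega) with rfl | rfl <;> omega
  rintro s₃ ⟨ht₃, hRK, hXw, hXS⟩ hs₃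
  have hRT₃ : s₃.arr .RT = s₂.arr .RT := hs₃.arr .RT
  have hl₃ : ∀ i < m, s₃.arr .RK (2 * i) < 2 * m + 2 ∧
      s₃.arr .XS (s₃.arr .RK (2 * i)) = s.inp (4 * i) := fun i hi => by
    rw [← (hr₂ i hi).1]; exact hRK _ (by omega)
  have hr₃ : ∀ i < m, s₃.arr .RK (2 * i + 1) < 2 * m + 2 ∧
      s₃.arr .XS (s₃.arr .RK (2 * i + 1)) = s.inp (4 * i) + s.inp (4 * i + 2) := fun i hi => by
    rw [← (hr₂ i hi).2.1]; exact hRK _ (by omega)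
  refine (cover_ok (L := L) (m := m) (z := 2 * m + 2) (l := fun i => s₃.arr .RK (2 * i))
    (r := fun i => s₃.arr .RK (2 * i + 1)) (v := s₃.arr .RT) ?_ ?_ (fun _ _ => rfl)
    (fun _ _ => rfl) rfl ?_ (fun i hi => (hr₃ i hi).1) (by omega) (by omega) ?_).seq ?_
  · simp [hs₃.reg .a2, hs₂.reg .a2, hs₁.reg .a2, hm]
  · rw [hs₃.reg .z, hz₂]
  · intro i hi
    by_contra hc
    have h₁ := hXS _ _ (not_lt.1 hc) (hl₃ i hi).1
    rw [(hl₃ i hi).2, (hr₃ i hi).2] at h₁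
    have := hpos i hi
    omega
  · simp [hs₃.arr .T, hs₂.arr .T, hs₁.arr .T, hT]
  rintro s₄ ⟨ht₄, hT₄⟩ hs₄
  have hXS₄ : s₄.arr .XS = s₃.arr .XS := hs₄.arr .XS
  have hX0 : s₃.arr .XS 0 = 0 := by
    have h₁ := hRK (2 * m) (by omega)
    have h₂ := hXS 0 _ (Nat.zero_le _) h₁.1
    rw [h₁.2, hk₂] at h₂; omega
  have hXz : s₃.arr .XS (2 * m + 1) = w := by
    have h₁ := hRK (2 * m + 1) (by omega)
    have h₂ := hXS _ (2 * m + 1) (Nat.le_of_lt_succ h₁.1) (Nat.lt_succ_self _)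
    rw [h₁.2, hk₂'] at h₂
    exact le_antisymm (hXw _ (Nat.lt_succ_self _)) h₂
  refine (pieces_ok (L := L) (w := w) (z := 2 * m + 2) (h := h) ?_ (by omega) ?_ ?_ hw0 ?_ ?_
    (by omega)).seq ?_
  · rw [hs₄.reg .z, hs₃.reg .z, hz₂]
  · rw [hXS₄, hX0]
  · rw [hXS₄]; exact hXz
  · rw [hXS₄]; exact fun i hi => hXS _ _ (by omega) hi
  · rw [hXS₄]
    intro i hi j hj hj'
    obtain ⟨h₁, h₂⟩ := hT₄ i (by omega)
    -- Since j lies in the nonempty step i, comparing coordinates with j amounts to comparing ranks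
    -- with i, even if coordinates repeat.
    have hiff : ∀ k < 2 * m + 2, s₃.arr .XS k ≤ j ↔ k ≤ i := by
      intro k hk
      constructor
      · intro h₃
        by_contra hc
        have := hXS (i + 1) k (by omega) hk
        omega
      · intro h₃
        exact (hXS k i h₃ (by omega)).trans hj
    obtain ⟨h₃, h₄⟩ := hh j
    simp only at h₃ h₄
    have hL' : ∀ i' < m, s.inp (4 * i') ≤ j ↔ s₃.arr .RK (2 * i') ≤ i := fun i' hi' => by
      rw [← (hl₃ i' hi').2]; exact hiff _ (hl₃ i' hi').1
    have hR' : ∀ i' < m, j < s.inp (4 * i') + s.inp (4 * i' + 2) ↔ i < s₃.arr .RK (2 * i' + 1) :=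
      fun i' hi' => by
        rw [← (hr₃ i' hi').2, ← not_le, hiff _ (hr₃ i' hi').1, not_le]
    rw [hRT₃] at h₁ h₂
    apply le_antisymm
    · rcases h₄ with h₅ | ⟨i', hi', h₅, h₆, h₇⟩
      · omega
      · rw [← h₅, ← (hr₂ i' hi').2.2.1]
        exact h₂ i' hi' ((hL' i' hi').1 h₆) ((hR' i' hi').1 h₇)
    · rcases h₁ with h₅ | ⟨i', hi', h₅, h₆, h₇⟩
      · omega
      · rw [← h₅, (hr₂ i' hi').2.2.1]
        exact h₃ i' hi' ((hL' i' hi').2 h₆) ((hR' i' hi').2 h₇)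
  rintro s₅ ⟨ht₅, hP, hBX0, hBXq, hq0, hqz⟩ hs₅
  have hB₅ : s₅.reg .B = s₁.reg .B := by
    rw [hs₅.reg .B, hs₄.reg .B, hs₃.reg .B, hs₂.reg .B]
  have htop₅ : s₅.reg .top = s₂.reg .top := by
    rw [hs₅.reg .top, hs₄.reg .top, hs₃.reg .top]
  have htopM : s₂.reg .top ≤ M := by
    rcases htop₂ with h₁ | ⟨i, hi, h₁⟩
    · omega
    · rw [h₁, (hr₂ i hi).2.2.1]; exact hy i hi
  have hpw := two_pow_size_le (s₂.reg .top)
  have hszt : Nat.size (s₂.reg .top) < 2 ^ Nat.size (s₂.reg .top) := Nat.lt_two_pow_self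
  have hszM := Nat.size_le_size htopM
  simp only [Ok_seq, Ok_set, Ok_size]
  refine ⟨by simp; omega, by simp; omega, by simp, by simp [htop₅]; omega, ?_⟩
  refine (build_ok (L := L) (h := h) ?_ ?_ ?_ ?_ ?_ ?_ ?_ ?_ ?_).bind ?_
  · simpa [hB₅] using hB
  · simpa using hq0
  · simpa using hP
  · simp; omega
  · simp; omega
  · simp; omega
  · simp [htop₅]; omega
  · simp [htop₅]; omega
  · simp [htop₅]
    intro i hi
    have h₁ := hP.lt i hi
    refine lt_of_le_of_lt ?_ (Nat.lt_size_self _)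
    rw [← hP.val i hi _ le_rfl h₁]
    rcases (hh (s₅.arr .BX i)).2 with h₂ | ⟨i', hi', h₂, -⟩
    · omega
    · rw [← h₂]; exact (hr₂ i' hi').2.2.1.symm.trans_le (hr₂ i' hi').2.2.2
  simp [hB₅, htop₅, hBX0, hBXq]
  rintro s₆ ht₆ - hfp₆ hdir hpsi - hs₆
  have hB₆ : s₆.reg .B = s₁.reg .B := by simp [hs₆.reg .B, hB₅]
  have hLZ₆ : s₆.reg .LZ = s₁.reg .LZ := by
    simp [hs₆.reg .LZ, hs₅.reg .LZ, hs₄.reg .LZ, hs₃.reg .LZ, hs₂.reg .LZ]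
  have htop₆ : s₆.reg .top = s₂.reg .top := by simp [hs₆.reg .top, htop₅]
  rw [hB₆, hLZ₆, htop₆]
  have htb : (s₅.reg .q / s₁.reg .B + 1) *
      ((Nat.size (s₂.reg .top) + 3) * (2 * s₁.reg .B * 150 + 200) + 100) ≤
      ((2 * m + 2) / s₁.reg .B + 1) *
        ((Nat.size M + 3) * (2 * s₁.reg .B * 150 + 200) + 100) := by
    gcongr
  simp at ht₁
  refine ⟨by omega, hB, hB₁, hB₂, hB₃, hLZ, ?_, ?_, hdir, by omega, by omega⟩
  · exact fun i hi => (hr₂ i hi).2.2.1.symm.trans_le (hr₂ i hi).2.2.2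
  · rcases htop₂ with h₁ | ⟨i, hi, h₁⟩
    · exact .inl h₁
    · exact .inr ⟨i, hi, h₁.trans (hr₂ i hi).2.2.1⟩

end RectDrop

/-! # Contours of sets of rectangles -/

namespace RectDrop

/-- The upper contour of a set of rectangles. -/
def contour (S : Finset Rect) (j : ℕ) : ℕ := restHeight S 1 j

section Contours
variable {S : Finset Rect}

theorem contour_le_iff {j y : ℕ} :
    contour S j ≤ y ↔ ∀ r ∈ S, r.x ≤ j → j < r.right → r.top ≤ y := by
  rw [contour, restHeight, Finset.sup_le_iff]
  simp only [Finset.mem_filter]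
  exact ⟨fun h r hr h₁ h₂ => h r ⟨hr, h₂, by omega⟩, fun h r hr => h r hr.1 (by omega) hr.2.1⟩

/-- Coordinates are integers and widths are positive, so a rectangle that meets the window covers a
whole unit cell of it, namely the one at max x r.x. -/
theorem restHeight_le_iff_contour (hS : ∀ r ∈ S, 0 < r.width) {a x y : ℕ} (ha : 0 < a) :
    restHeight S a x ≤ y ↔ ∀ j, x ≤ j → j < x + a → contour S j ≤ y := by
  simp only [contour_le_iff]
  rw [restHeight, Finset.sup_le_iff]
  simp only [Finset.mem_filter]
  constructor
  · exact fun h j h₁ h₂ r hr h₃ h₄ => h r ⟨hr, by omega, by omega⟩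
  · rintro h r ⟨hr, h₁, h₂⟩
    have h₃ := hS r hr
    simp only [Rect.right] at h h₁
    exact h (max x r.x) (by omega) (by omega) r hr (by omega) (by omega)

theorem eq_restHeight (hS : ∀ r ∈ S, 0 < r.width) {a x m : ℕ} (ha : 0 < a)
    (hit : Hit (contour S) x (x + a) m) (cov : ∀ j, x ≤ j → j < x + a → contour S j ≤ m) :
    m = restHeight S a x := by
  apply le_antisymm
  · rcases hit with h | ⟨j, h₁, h₂, h₃⟩
    · omega
    · rw [← h₃]; exact (restHeight_le_iff_contour hS ha).1 le_rfl j h₁ h₂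
  · exact (restHeight_le_iff_contour hS ha).2 cov

theorem contour_drop (hS : ∀ r ∈ S, 0 < r.width) {a b x : ℕ} (ha : 0 < a) (j : ℕ) :
    contour (drop S a b x) j =
      if x ≤ j ∧ j < x + a then restHeight S a x + b else contour S j := by
  apply eq_of_forall_ge_iff
  intro y
  rw [contour_le_iff, drop, Finset.forall_mem_insert, ← contour_le_iff]
  simp only [Rect.right, Rect.top]
  split_ifs with h
  · have := (restHeight_le_iff_contour hS ha).1 le_rfl j h.1 h.2
    exact ⟨fun h' => h'.1 h.1 h.2, fun h' => ⟨fun _ _ => h', by omega⟩⟩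
  · exact ⟨fun h' => h'.2, fun h' => ⟨fun h₁ h₂ => absurd ⟨h₁, h₂⟩ h, h'⟩⟩

theorem highest_drop (a b x : ℕ) :
    highest (drop S a b x) = max (highest S) (restHeight S a x + b) := by
  rw [highest, drop, Finset.sup_insert, max_comm]; rfl

/-- The new rectangle cannot have been in the set, as its top would exceed the maximum that
determined its resting height. Thus the cardinality counts the updates, and bounds linear in it hold
in the worst case over all sequences. -/
theorem card_drop {a b x : ℕ} (ha : 0 < a) (hb : 0 < b) :
    (drop S a b x).card = S.card + 1 := by
  apply Finset.card_insert_of_notMem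
  intro h
  have : Rect.top ⟨x, restHeight S a x, a, b⟩ ≤ restHeight S a x :=
    Finset.le_sup (f := Rect.top) (Finset.mem_filter.2 ⟨h, by simp [Rect.right]; omega, by simp; omega⟩)
  simp [Rect.top] at this
  omega

theorem contour_le_highest (j : ℕ) : contour S j ≤ highest S :=
  contour_le_iff.2 fun _ hr _ _ => Finset.le_sup (f := Rect.top) hr

theorem contour_eq (j : ℕ) :
    contour S j = 0 ∨ ∃ r ∈ S, r.top = contour S j ∧ r.x ≤ j ∧ j < r.right := by
  rw [contour, restHeight]
  rcases (S.filter fun r => j < r.right ∧ r.x < j + 1).eq_empty_or_nonempty with h | h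
  · left; rw [h]; rfl
  · obtain ⟨r, hr, h'⟩ := Finset.exists_mem_eq_sup _ h Rect.top
    rw [Finset.mem_filter] at hr
    exact .inr ⟨r, hr.1, h'.symm, by omega, hr.2.1⟩

end Contours

/-- The four numbers that describe rectangle `i` in the initial memory. -/
theorem startState_mem (n w : ℕ) (l : List Rect) {i : ℕ} (hi : i < l.length) :
    (startState n w l).mem (4 * i) = l[i].x ∧ (startState n w l).mem (4 * i + 1) = l[i].y ∧
    (startState n w l).mem (4 * i + 2) = l[i].width ∧
    (startState n w l).mem (4 * i + 3) = l[i].height := by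
  simp only [startState]
  induction l generalizing i with
  | nil => simp at hi
  | cons r l ih =>
    cases i with
    | zero => simp
    | succ i =>
      have := ih (i := i) (by simpa using hi)
      simpa [Nat.mul_add, Nat.add_assoc] using this

theorem startState_mem_eq_zero (n w : ℕ) (l : List Rect) {i : ℕ} (hi : 4 * l.length ≤ i) :
    (startState n w l).mem i = 0 := by
  simp only [startState]
  rw [List.getD_eq_default]
  simp [List.length_flatMap]
  omega

theorem startState_mem_le (n w : ℕ) (l : List Rect) {M : ℕ}
    (h : ∀ r ∈ l, r.right ≤ M ∧ r.top ≤ M) (i : ℕ) : (startState n w l).mem i ≤ M := by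
  simp only [startState]
  rw [List.getD_eq_getElem?_getD]
  rcases Nat.lt_or_ge i (l.flatMap fun r => [r.x, r.y, r.width, r.height]).length with hi | hi
  · rw [List.getElem?_eq_getElem hi, Option.getD_some]
    have hm := List.getElem_mem hi
    generalize (l.flatMap fun r => [r.x, r.y, r.width, r.height])[i] = v at hm
    obtain ⟨r, hr, hv⟩ := List.mem_flatMap.1 hm
    have := h r hr
    simp only [Rect.right, Rect.top] at this
    simp at hv
    omega
  · rw [List.getElem?_eq_none hi]; simp

theorem startState_contour (n w : ℕ) (l : List Rect) :
    Contour l.length (fun i => (startState n w l).mem (4 * i))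
      (fun i => (startState n w l).mem (4 * i) + (startState n w l).mem (4 * i + 2))
      (fun i => (startState n w l).mem (4 * i + 1) + (startState n w l).mem (4 * i + 3))
      (contour l.toFinset) := by
  intro j
  constructor
  · intro i hi h₁ h₂
    obtain ⟨e₁, e₂, e₃, e₄⟩ := startState_mem n w l hi
    simp only [e₁, e₂, e₃, e₄] at h₁ h₂ ⊢
    exact contour_le_iff.1 le_rfl l[i] (by simp) h₁ h₂
  · rcases contour_eq (S := l.toFinset) j with h | ⟨r, hr, h₁, h₂, h₃⟩
    · exact .inl h
    · obtain ⟨i, hi, rfl⟩ := List.getElem_of_mem (List.mem_toFinset.1 hr)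
      obtain ⟨e₁, e₂, e₃, e₄⟩ := startState_mem n w l hi
      refine .inr ⟨i, hi, ?_⟩
      simp only [e₁, e₂, e₃, e₄]
      exact ⟨h₁, h₂, h₃⟩

/-! ## Estimates -/

theorem size_le_mul {n k x : ℕ} (hk : 0 < k) (hx : x ≤ n ^ k) : Nat.size x ≤ k * Nat.size n := by
  rw [Nat.size_le, mul_comm, pow_mul]
  exact hx.trans_lt (Nat.pow_lt_pow_left (Nat.lt_size_self n) hk.ne')

/-- (size n - 1) log 2 ≤ log n and log 2 ≤ log n give size n · log 2 ≤ 2 log n, and log 2 exceeds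
2/3. -/
theorem size_le_log {n : ℕ} (hn : 2 ≤ n) : (Nat.size n : ℝ) ≤ 3 * Real.log n := by
  have h0 : 0 < Nat.size n := Nat.size_pos.2 (by omega)
  have h₁ : 2 ^ (Nat.size n - 1) ≤ n := Nat.lt_size.1 (by omega)
  have h₂ : ((Nat.size n - 1 : ℕ) : ℝ) * Real.log 2 ≤ Real.log n := by
    rw [← Real.log_pow]
    exact Real.log_le_log (by positivity) (by exact_mod_cast h₁)
  rw [Nat.cast_sub h0] at h₂
  have h₃ : Real.log 2 ≤ Real.log n := Real.log_le_log (by norm_num) (by exact_mod_cast hn)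
  have h₄ := Real.log_two_gt_d9
  push_cast at h₂
  have h₅ : (Nat.size n : ℝ) * Real.log 2 ≤ 2 * Real.log n := by linarith
  have h₆ : (Nat.size n : ℝ) * (2 / 3) ≤ (Nat.size n : ℝ) * Real.log 2 := by gcongr; linarith
  linarith

theorem mul_size_le {n : ℕ} (hn : 2 ≤ n) :
    ((n * Nat.size n : ℕ) : ℝ) ≤ 3 * ((n : ℝ) * Real.log n) := by
  push_cast
  have := mul_le_mul_of_nonneg_left (size_le_log hn) (Nat.cast_nonneg (α := ℝ) n)
  linarith

/-- After squaring: B² ≤ 4 n · size n follows from the minimality of B, and size n ≤ 3 log n. The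
square is thus at most 4 · 27 · n log³ n, and 108 ≤ 12². -/
theorem block_mul_size_le {n B : ℕ} (hn : 2 ≤ n) (hB : 0 < B)
    (hBn : (B - 1) * (B - 1) < n * Nat.size n) :
    ((B * Nat.size n : ℕ) : ℝ) ≤ 12 * ((n : ℝ) ^ (1 / 2 : ℝ) * Real.log n ^ (3 / 2 : ℝ)) := by
  have h0 : 0 < Nat.size n := Nat.size_pos.2 (by omega)
  have hlog : 0 < Real.log n := Real.log_pos (by exact_mod_cast hn)
  have hlg := size_le_log hn
  have hsq : ((B * Nat.size n : ℕ) : ℝ) ^ 2 ≤ 4 * ((n : ℝ) * (Nat.size n : ℝ) ^ 3) := by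
    have h₁ : B * B ≤ 4 * (n * Nat.size n) := by
      obtain ⟨b, rfl⟩ := Nat.exists_eq_succ_of_ne_zero hB.ne'
      simp only [Nat.succ_eq_add_one, Nat.add_sub_cancel] at hBn ⊢
      have : 1 ≤ n * Nat.size n := Nat.mul_pos (by omega) h0
      nlinarith [sq_nonneg ((b : ℤ) - 1)]
    have h₂ : (B * Nat.size n) ^ 2 ≤ 4 * (n * Nat.size n ^ 3) := by
      calc (B * Nat.size n) ^ 2 = B * B * (Nat.size n * Nat.size n) := by ring
        _ ≤ 4 * (n * Nat.size n) * (Nat.size n * Nat.size n) := Nat.mul_le_mul_right _ h₁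
        _ = _ := by ring
    exact_mod_cast h₂
  apply le_of_sq_le_sq _ (by positivity)
  rw [mul_pow, mul_pow, ← Real.rpow_natCast (_ ^ (1 / 2 : ℝ)), ← Real.rpow_natCast (_ ^ (3 / 2 : ℝ)),
    ← Real.rpow_mul (by positivity), ← Real.rpow_mul hlog.le]
  norm_num
  have h₃ : (Nat.size n : ℝ) ^ 3 ≤ (3 * Real.log n) ^ 3 := by gcongr
  have h₄ := mul_le_mul_of_nonneg_left h₃ (Nat.cast_nonneg (α := ℝ) n)
  have h₅ : 0 ≤ (n : ℝ) * Real.log n ^ 3 := by positivity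
  push_cast at hsq
  nlinarith

end RectDrop

/-! # Time bounds -/

namespace RectDrop

section Costs
variable {n B lg : ℕ}

/-- Multiply the bound on K B by lg, use n · lg ≤ B², and cancel B. The lower order terms need lg ≤
B, which the choice of B forces. -/
theorem blocks_mul_le {K P c : ℕ} (hB : 0 < B) (hBn : n * lg ≤ B * B) (hlg : lg ≤ n)
    (hK : K * B ≤ P) (hP : P ≤ B + 4 * (c * n) + 2) : K * lg ≤ (4 * c + 3) * B := by
  have hlB : lg ≤ B := by
    by_contra h
    have : B * B < n * lg := Nat.mul_lt_mul_of_lt_of_le' (by omega) (by omega) (by omega)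
    omega
  refine Nat.le_of_mul_le_mul_right (c := B) ?_ hB
  calc K * lg * B = K * B * lg := by ring
    _ ≤ (B + 4 * (c * n) + 2) * lg := Nat.mul_le_mul_right _ (hK.trans hP)
    _ = B * lg + 4 * c * (n * lg) + 2 * lg := by ring
    _ ≤ B * B + 4 * c * (B * B) + 2 * (B * B) := by
      gcongr
      exact hlB.trans (Nat.le_mul_of_pos_left _ hB)
    _ = (4 * c + 3) * B * B := by ring

theorem update_cost {K κ k sz : ℕ} (hB : 0 < B) (hlg : 0 < lg) (hK : K * lg ≤ κ * B)
    (hsz : sz ≤ k * lg) :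
    K * 400 + 5 * ((sz + 3) * (2 * B * 150 + 200) + 100) + B * 800 + 10 * sz + 1000 ≤
      (400 * κ + 2500 * (k + 3) + 10 * k + 2300) * (B * lg) := by
  have h₁ : K ≤ κ * (B * lg) := calc
    K ≤ K * lg := Nat.le_mul_of_pos_right _ hlg
    _ ≤ κ * B := hK
    _ ≤ κ * (B * lg) := Nat.mul_le_mul_left _ (Nat.le_mul_of_pos_right _ hlg)
  have h₂ : (sz + 3) * (2 * B * 150 + 200) ≤ (k + 3) * lg * (500 * B) :=
    Nat.mul_le_mul (by rw [add_mul]; omega) (by omega)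
  have h₃ : B ≤ B * lg := Nat.le_mul_of_pos_right _ hlg
  have h₄ : k * lg ≤ k * (B * lg) := Nat.mul_le_mul_left _ (Nat.le_mul_of_pos_left _ hB)
  have h₅ : (400 * κ + 2500 * (k + 3) + 10 * k + 2300) * (B * lg) = 400 * (κ * (B * lg)) +
    5 * ((k + 3) * lg * (500 * B)) + 10 * (k * (B * lg)) + 2300 * (B * lg) := by ring
  omega

/-- Of the two logarithmic factors, bisection rounds and search in a block, one is absorbed by K lg
≤ κ B. This balance between K and B dictates the choice of block size. -/
theorem query_cost {K κ k k' sz LZ : ℕ} (hB : 0 < B) (hlg : 0 < lg) (hK : K * lg ≤ κ * B)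
    (hsz : sz ≤ k * lg) (hLZ : LZ ≤ k' * lg) :
    (sz + 1) * (K * (LZ * 50 + 200) + 100) ≤
      (k + 1) * ((50 * k' + 200) * κ + 100) * (B * lg) := by
  have h₁ : K * (LZ * 50 + 200) ≤ (50 * k' + 200) * (κ * B) := calc
    K * (LZ * 50 + 200) ≤ K * ((50 * k' + 200) * lg) := by
      gcongr; rw [add_mul, mul_assoc]; omega
    _ = (50 * k' + 200) * (K * lg) := by ring
    _ ≤ _ := Nat.mul_le_mul_left _ hK
  calc (sz + 1) * (K * (LZ * 50 + 200) + 100)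
      ≤ ((k + 1) * lg) * ((50 * k' + 200) * (κ * B) + 100 * B) := by
        gcongr
        · rw [add_mul]; omega
        · omega
    _ = _ := by ring

/-- X bounds all the logarithmic quantities and Y all the linear ones, so each term is a multiple of
X Y. In the cost of the blocks, the number of chunks times B is again linear. -/
theorem construct_cost {c m k sw sz sM : ℕ} (hn : 0 < n) (hB : 0 < B) (hBn : B ≤ n + 1)
    (hlg : 0 < lg) (hm : m ≤ c * n) (hw : sw ≤ k * lg) (hz : sz ≤ k * lg) (hM : sM ≤ k * lg) :
    n * 70 + m * 300 + (sw + 1) * ((2 * m + 2) * 250 + 200) +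
        (sz + 1) * (m * 200 + (2 * m + 2) * 100 + 200) + (2 * m + 2) * 100 +
        ((2 * m + 2) / B + 1) * ((sM + 3) * (2 * B * 150 + 200) + 100) + 10 * sM + 620 ≤
      ((k + 3) * (5000 * c + 10000)) * (n * lg) := by
  obtain ⟨X, hX⟩ : ∃ X, X = (k + 3) * lg := ⟨_, rfl⟩
  have hX₁ : sw + 3 ≤ X ∧ sz + 3 ≤ X ∧ sM + 3 ≤ X := by
    rw [hX, add_mul]; omega
  obtain ⟨Y, hY⟩ : ∃ Y, Y = (c + 2) * n := ⟨_, rfl⟩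
  have hY₁ : m + n + 1 ≤ Y := by rw [hY, add_mul]; omega
  have hdiv : (2 * m + 2) / B * B ≤ 2 * m + 2 := Nat.div_mul_le_self _ _
  have h₁ : (sw + 1) * ((2 * m + 2) * 250 + 200) ≤ X * (700 * Y) :=
    Nat.mul_le_mul (by omega) (by omega)
  have h₂ : (sz + 1) * (m * 200 + (2 * m + 2) * 100 + 200) ≤ X * (400 * Y) :=
    Nat.mul_le_mul (by omega) (by omega)
  have h₀ : (sM + 3) * (2 * B * 150 + 200) + 100 ≤ X * (600 * B) := by
    have h : (sM + 3) * (2 * B * 150 + 200) ≤ X * (500 * B) :=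
      Nat.mul_le_mul (by omega) (by omega)
    have h' : 1 * 1 ≤ X * B := Nat.mul_le_mul (by omega) hB
    have h'' : X * (600 * B) = X * (500 * B) + 100 * (X * B) := by ring
    linarith
  generalize (2 * m + 2) / B = d at hdiv ⊢
  generalize (sM + 3) * (2 * B * 150 + 200) + 100 = T at h₀ ⊢
  have h₃ : (d + 1) * T ≤ X * (1800 * Y) :=
    calc (d + 1) * T ≤ (d + 1) * (X * (600 * B)) := Nat.mul_le_mul_left _ h₀
      _ = X * (600 * (d * B + B)) := by ring
      _ ≤ X * (600 * (3 * Y)) := Nat.mul_le_mul_left _ (Nat.mul_le_mul_left _ (by omega))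
      _ = X * (1800 * Y) := by ring
  have h₄ : 3 * Y ≤ X * Y := Nat.mul_le_mul_right _ (by omega)
  have h₅ : X * 2 ≤ X * Y := Nat.mul_le_mul_left _ (by omega)
  have h₆ : (k + 3) * (5000 * c + 10000) * (n * lg) = 5000 * (X * Y) := by rw [hX, hY]; ring
  rw [h₆]
  have h₇ : X * (700 * Y) + X * (400 * Y) + X * (1800 * Y) = 2900 * (X * Y) := by ring
  omega

end Costs

end RectDrop

/-! # The data structure -/

namespace RectDrop

open WordRAM

set_option linter.constructorNameAsVariable false

/-- Numbers that occur in a computation stay below `cellBound c n`. -/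
def cellBound (c n : ℕ) : ℕ := n ^ (2 * c + 16)

/-- The constant 128 is absorbed as 2^7 ≤ n^7, and each quantity on the left is at most a power of n
with exponent at most 2c + 9. -/
theorem le_cellBound (c : ℕ) {n : ℕ} (hn : 2 ≤ n) :
    128 * n ≤ cellBound c n ∧ 128 * (n * n) ≤ cellBound c n ∧ 128 * (c * n) ≤ cellBound c n ∧
    128 * (c * n * n) ≤ cellBound c n ∧ 128 * n ^ c ≤ cellBound c n ∧
    128 * (n ^ c * (c * n + 2)) ≤ cellBound c n := by
  have h128 : 128 ≤ n ^ 7 := by simpa using Nat.pow_le_pow_left hn 7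
  have hc : c ≤ n ^ c := (Nat.lt_two_pow_self (n := c)).le.trans (Nat.pow_le_pow_left hn c)
  have hp : 0 < n ^ c := by positivity
  have key : ∀ {x j : ℕ}, x ≤ n ^ j → j ≤ 2 * c + 9 → 128 * x ≤ cellBound c n := fun h hj => calc
    _ ≤ n ^ 7 * n ^ (2 * c + 9) :=
      Nat.mul_le_mul h128 (h.trans (Nat.pow_le_pow_right (by omega) hj))
    _ = cellBound c n := by rw [cellBound, ← pow_add]; congr 1; omega
  have hcn : c * n ≤ n ^ (c + 1) := by rw [pow_succ]; exact Nat.mul_le_mul_right _ hc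
  refine ⟨key (j := 1) (by simp) (by omega), key (j := 2) (by rw [sq]) (by omega),
    key hcn (by omega), key (j := c + 2) ?_ (by omega), key le_rfl (by omega),
    key (j := c + (c + 2)) ?_ (by omega)⟩
  · rw [pow_succ]; exact Nat.mul_le_mul_right _ hcn
  · rw [pow_add]
    refine Nat.mul_le_mul_left _ ?_
    calc c * n + 2 ≤ n ^ (c + 1) + n ^ (c + 1) :=
          Nat.add_le_add hcn (hn.trans (Nat.le_self_pow (by omega) n))
      _ = n ^ (c + 1) * 2 := by ring
      _ ≤ _ := by rw [pow_succ n (c + 1)]; exact Nat.mul_le_mul_left _ hn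

/-- The factor 64 that the compiler requires costs six more powers of n, whence the exponent 2c +
22. -/
theorem cellBound_le {c n W : ℕ} (hn : 2 ≤ n) (hW : n ^ (2 * c + 22) ≤ 2 ^ W) :
    64 * cellBound c n ≤ 2 ^ W := by
  have h64 : 64 ≤ n ^ 6 := by simpa using Nat.pow_le_pow_left hn 6
  refine le_trans ?_ hW
  calc 64 * cellBound c n ≤ n ^ 6 * n ^ (2 * c + 16) := Nat.mul_le_mul_right _ h64
    _ = _ := by rw [← pow_add]; congr 1; omega

theorem size_le_of_le_cellBound {c n x : ℕ} (hx : x ≤ cellBound c n) :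
    Nat.size x ≤ (2 * c + 16) * Nat.size n := size_le_mul (by omega) hx

/-- The state `s` holds the data structure for the set `S`. -/
structure Holds (c n w : ℕ) (S : Finset Rect) (s : St) : Prop where
  w_le : w ≤ n ^ c
  card_le : S.card ≤ c * n
  width_pos : ∀ r ∈ S, 0 < r.width
  B_pos : 0 < s.reg .B
  le_sq : n * Nat.size n ≤ s.reg .B * s.reg .B
  sq_lt : (s.reg .B - 1) * (s.reg .B - 1) < n * Nat.size n
  B_le : s.reg .B ≤ n + 1
  LZ_eq : s.reg .LZ = Nat.size (s.reg .B * 2)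
  dir : Dir s.arr (contour S) (s.reg .fp) (s.reg .B) 0 (s.reg .K) 0 w
  psi_le : Psi s.arr (s.reg .B) 0 (s.reg .K) ≤ s.reg .B + 2 * (c * n) + 2 + 2 * S.card
  fp_le : s.reg .fp ≤ 4 * (c * n) + 5 + S.card * (8 * s.reg .B + 1)
  top_eq : s.reg .top = highest S
  top_le : s.reg .top ≤ n ^ c * (S.card + 1)

section Holds
variable {c n w : ℕ} {S : Finset Rect} {s s' : St}

theorem Holds.congr (h : Holds c n w S s) (ha : s'.arr = s.arr) (hB : s'.reg .B = s.reg .B)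
    (hLZ : s'.reg .LZ = s.reg .LZ) (hK : s'.reg .K = s.reg .K) (hfp : s'.reg .fp = s.reg .fp)
    (htop : s'.reg .top = s.reg .top) : Holds c n w S s' := by
  constructor
  all_goals try rw [ha]
  all_goals try rw [hB]
  all_goals try rw [hLZ]
  all_goals try rw [hK]
  all_goals try rw [hfp]
  all_goals try rw [htop]
  exacts [h.w_le, h.card_le, h.width_pos, h.B_pos, h.le_sq, h.sq_lt, h.B_le, h.LZ_eq, h.dir,
    h.psi_le, h.fp_le, h.top_eq, h.top_le]

/-- The number of blocks is read off the potential, whose bound has grown by 2 for each of at most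
cn rectangles. -/
theorem Holds.blocks (h : Holds c n w S s) :
    s.reg .K ≤ s.reg .B + 4 * (c * n) + 2 ∧
    s.reg .K * Nat.size n ≤ (4 * c + 3) * s.reg .B := by
  have h₁ : (s.reg .K - 0) * s.reg .B ≤ _ := Psi.mul_le (A := s.arr)
  have h₂ := h.psi_le
  have h₃ := h.card_le
  have h₄ : s.reg .K ≤ s.reg .K * s.reg .B := Nat.le_mul_of_pos_right _ h.B_pos
  rw [Nat.sub_zero] at h₁
  refine ⟨by omega, blocks_mul_le h.B_pos h.le_sq ?_ (h₁.trans h₂) (by omega)⟩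
  exact Nat.size_le.2 Nat.lt_two_pow_self

/-- No memory is reclaimed. Each update takes at most 8B + 1 fresh positions, B is at most n + 1 and
at most cn updates occur, so O(n²) positions suffice for fixed c. -/
theorem Holds.fp_lt (h : Holds c n w S s) (hn : 2 ≤ n) :
    s.reg .fp + 16 * s.reg .B + 20 < cellBound c n := by
  obtain ⟨b₁, b₂, b₃, b₄, -, -⟩ := le_cellBound c hn
  have h₁ : S.card * (8 * s.reg .B + 1) ≤ c * n * (8 * (n + 1) + 1) := by
    have := h.card_le
    have := h.B_le
    gcongr
  have h₂ : c * n * (8 * (n + 1) + 1) = 8 * (c * n * n) + 9 * (c * n) := by ring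
  have h₃ : 2 * 2 ≤ n * n := Nat.mul_le_mul hn hn
  have := h.fp_le
  have := h.B_le
  omega

theorem Holds.top_lt (h : Holds c n w S s) {b : ℕ} (hb : b ≤ n ^ c) :
    s.reg .top + b ≤ n ^ c * (c * n + 2) := calc
  _ ≤ n ^ c * (S.card + 1) + n ^ c := Nat.add_le_add h.top_le hb
  _ = n ^ c * (S.card + 2) := by ring
  _ ≤ _ := Nat.mul_le_mul_left _ (Nat.add_le_add_right h.card_le 2)

end Holds

/-- Factors in the time bounds. -/
def constructFactor (c : ℕ) : ℕ := (2 * c + 16 + 3) * (5000 * c + 10000)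

/-- The constant of `update_cost` with κ = 4c + 3 from the number of blocks and k = 2c + 16 from the
size of the numbers; `queryFactor` likewise from `query_cost`. -/
def updateFactor (c : ℕ) : ℕ :=
  400 * (4 * c + 3) + 2500 * (2 * c + 16 + 3) + 10 * (2 * c + 16) + 2300

def queryFactor (c : ℕ) : ℕ :=
  (2 * c + 16 + 1) * ((50 * (2 * c + 16) + 200) * (4 * c + 3) + 100)

/-! ### The three operations in terms of sets of rectangles -/

section Operations
variable {c n w a b x : ℕ} {S : Finset Rect} {s : St}

/-- The m found by the program is the resting height by `eq_restHeight`. The growth by 2 of the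
potential, by 8B + 1 of the memory and by at most n^c of the top is matched by the growth by one of
the cardinality. -/
theorem Holds.update (h : Holds c n w S s) (hn : 2 ≤ n) (hS : S.card < c * n)
    (hp : LegalPiece c n w a b) (hx : x + a ≤ w) (h₀ : s.reg .a0 = a) (h₁ : s.reg .a1 = b)
    (h₂ : s.reg .a2 = x) :
    Ok (cellBound c n) updateCmd s fun s' =>
      s'.t ≤ s.t + updateFactor c * (s.reg .B * Nat.size n) ∧
      s'.reg .a0 = highest (drop S a b x) ∧ s'.reg .B = s.reg .B ∧
      Holds c n w (drop S a b x) s' := by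
  obtain ⟨b₁, b₂, b₃, b₄, b₅, b₆⟩ := le_cellBound c hn
  have h2n : 2 * 2 ≤ n * n := Nat.mul_le_mul hn hn
  have hw := h.w_le
  have hB := h.B_le
  have htop := h.top_lt hp.height_le
  obtain ⟨hK, hKn⟩ := h.blocks
  have hhi : ∀ j < w, contour S j ≤ s.reg .top := fun j _ => h.top_eq ▸ contour_le_highest j
  refine (updateCmd_ok (L := cellBound c n) h.dir h₀ h₁ h₂ hp.width_pos hx h.B_pos (h.fp_lt hn)
    (by omega) (by omega) hhi (by omega)).bind ?_
  rintro s' ⟨ht, m, hit, cov, hD, hPsi, hfp, htop', ha⟩ hs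
  obtain rfl := eq_restHeight h.width_pos hp.width_pos hit cov
  have hB' : s'.reg .B = s.reg .B := hs.reg .B
  have hcard := card_drop (S := S) (x := x) hp.width_pos hp.height_pos
  have hhd := highest_drop (S := S) a b x
  have hm : restHeight S a x ≤ s.reg .top :=
    (restHeight_le_iff_contour h.width_pos hp.width_pos).2 fun j _ hj => hhi j (by omega)
  have hpl := h.psi_le
  have hfl := h.fp_le
  have hsz : Nat.size (s.reg .top + b) ≤ (2 * c + 16) * Nat.size n :=
    size_le_of_le_cellBound (by omega)
  refine ⟨ht.trans (Nat.add_le_add_left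
    (update_cost h.B_pos (Nat.size_pos.2 (by omega)) hKn hsz) _), ?_, hB', ?_⟩
  · rw [ha, hhd, h.top_eq]
  · constructor
    · exact hw
    · omega
    · exact Finset.forall_mem_insert _ _ _ |>.2 ⟨hp.width_pos, h.width_pos⟩
    · rw [hB']; exact h.B_pos
    · rw [hB']; exact h.le_sq
    · rw [hB']; exact h.sq_lt
    · rw [hB']; exact h.B_le
    · rw [hB', hs.reg .LZ]; exact h.LZ_eq
    · rw [hB']
      exact hD.congr_fun fun j _ _ => contour_drop h.width_pos hp.width_pos j
    · rw [hB', hcard]; omega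
    · rw [hB', hcard, Nat.add_mul]; omega
    · rw [htop', hhd, h.top_eq]
    · have h₃ := h.top_le
      have h₄ := hp.height_le
      rw [htop', hcard, Nat.mul_succ]
      omega

/-- The y found by bisection bounds the resting height from above at the returned position and from
below at every admissible one, so the position is greedy and y is its resting height. -/
theorem Holds.query (h : Holds c n w S s) (hn : 2 ≤ n) (hp : LegalPiece c n w a b)
    (h₀ : s.reg .a0 = a) (h₁ : s.reg .a1 = b) :
    Ok (cellBound c n) queryCmd s fun s' =>
      s'.t ≤ s.t + queryFactor c * (s.reg .B * Nat.size n) ∧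
      IsGreedy w S a (s'.reg .a0) ∧ s'.reg .a1 = highest (drop S a b (s'.reg .a0)) ∧
      Holds c n w S s' := by
  obtain ⟨b₁, b₂, b₃, b₄, b₅, b₆⟩ := le_cellBound c hn
  have h2n : 2 * 2 ≤ n * n := Nat.mul_le_mul hn hn
  have hw := h.w_le
  have haw := hp.width_le
  have hB := h.B_le
  have htop := h.top_lt hp.height_le
  have htop₀ := h.top_lt (b := 0) (by omega)
  have hfp := h.fp_lt hn
  obtain ⟨hK, hKn⟩ := h.blocks
  have hLZ : s.reg .LZ ≤ s.reg .B * 2 := by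
    rw [h.LZ_eq]; exact Nat.size_le.2 Nat.lt_two_pow_self
  have hLZ' : s.reg .LZ ≤ (2 * c + 16) * Nat.size n := by
    rw [h.LZ_eq]; exact size_le_of_le_cellBound (by omega)
  have hB2 : 2 * s.reg .B ≤ 2 ^ s.reg .LZ := by
    rw [h.LZ_eq, mul_comm]; exact (Nat.lt_size_self _).le
  have hhi : ∀ j < w, contour S j ≤ s.reg .top := fun j _ => h.top_eq ▸ contour_le_highest j
  refine (queryCmd_ok (L := cellBound c n) h.dir h₀ hp.width_pos haw h₁ (by omega)
    (by omega) (by omega) (by omega) hB2 hhi (by omega)).bind ?_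
  rintro s' ⟨ht, hx, y, cov, low, ha⟩ hs
  have hsz : Nat.size (s.reg .top) ≤ (2 * c + 16) * Nat.size n :=
    size_le_of_le_cellBound (by omega)
  have hiff {x y : ℕ} := restHeight_le_iff_contour h.width_pos (x := x) (y := y) hp.width_pos
  have hle : ∀ x', x' + a ≤ w → y ≤ restHeight S a x' := by
    intro x' hx'
    by_contra hc
    obtain ⟨j, hj, hj', hlt⟩ := low _ (not_le.1 hc) x' hx'
    exact absurd (hiff.1 le_rfl j hj hj') (by omega)
  have hy : restHeight S a (s'.reg .a0) ≤ y := hiff.2 cov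
  refine ⟨ht.trans (Nat.add_le_add_left
    (query_cost h.B_pos (Nat.size_pos.2 (by omega)) hKn hsz hLZ') _),
    ⟨hx, fun x' hx' => hy.trans (hle x' hx')⟩, ?_, ?_⟩
  · rw [ha, highest_drop, ← h.top_eq, le_antisymm hy (hle _ hx)]
  · exact h.congr (funext fun A => hs.arr' A (by cases A <;> rfl)) (hs.reg .B) (hs.reg .LZ)
      (hs.reg .K) (hs.reg .fp) (hs.reg .top)

/-- The extra 4 steps pay for the instruction that sets register D before the compiled program
starts. -/
theorem holds_construct {l : List Rect} (hn : 2 ≤ n) (hl : LegalStart c n w l) (hw : 0 < w)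
    (h₀ : s.reg .a0 = n) (h₁ : s.reg .a1 = w) (h₂ : s.reg .a2 = l.length)
    (hD : s.reg .D = 4 * l.length) (hT : ∀ k, s.arr .T k = 0)
    (hinp : s.inp = (startState n w l).mem) :
    Ok (cellBound c n) constructCmd s fun s' =>
      s'.t + 4 ≤ s.t + constructFactor c * (n * Nat.size n) ∧ Holds c n w l.toFinset s' := by
  obtain ⟨b₁, b₂, b₃, b₄, b₅, b₆⟩ := le_cellBound c hn
  have h2n : 2 * 2 ≤ n * n := Nat.mul_le_mul hn hn
  have hsq : (n + 2) * (n + 2) = n * n + 4 * n + 4 := by ring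
  have hwn := hl.width_le
  have hm := hl.length_le
  have hmem := fun i (hi : i < l.length) => startState_mem n w l hi
  refine (constructCmd_ok (L := cellBound c n) (M := n ^ c) h₀ h₁ h₂ (by omega) hw hD hT
    (fun i hi => ?_) (fun i hi => ?_) (fun i hi => ?_) (by rw [hinp]; exact startState_contour n w l)
    (by omega) (by omega) (by omega) (by omega)).bind ?_
  · rw [hinp, (hmem i hi).2.2.1]; exact hl.width_pos _ (List.getElem_mem hi)
  · rw [hinp, (hmem i hi).1, (hmem i hi).2.2.1]; exact hl.right_le _ (List.getElem_mem hi)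
  · rw [hinp, (hmem i hi).2.1, (hmem i hi).2.2.2]; exact hl.top_le _ (List.getElem_mem hi)
  rintro s' ⟨ht, hB, hB₁, hB₂, hB₃, hLZ, htop, htop', hdir, hPsi, hfp⟩ hs
  have hcard : l.toFinset.card ≤ l.length := l.toFinset_card_le
  have hcost := construct_cost (n := n) (B := s'.reg .B) (lg := Nat.size n) (c := c)
    (m := l.length) (k := 2 * c + 16) (sw := Nat.size w) (sz := Nat.size (2 * l.length + 2))
    (sM := Nat.size (n ^ c)) (by omega) hB hB₃ (Nat.size_pos.2 (by omega)) hm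
    (size_le_of_le_cellBound (by omega)) (size_le_of_le_cellBound (by omega))
    (size_le_of_le_cellBound (by omega))
  have htopEq : s'.reg .top = highest l.toFinset := by
    apply le_antisymm
    · rcases htop' with h | ⟨i, hi, h⟩
      · omega
      · rw [h, hinp, (hmem i hi).2.1, (hmem i hi).2.2.2]
        exact Finset.le_sup (f := Rect.top) (List.mem_toFinset.2 (List.getElem_mem hi))
    · refine Finset.sup_le fun r hr => ?_
      obtain ⟨i, hi, rfl⟩ := List.getElem_of_mem (List.mem_toFinset.1 hr)
      have := htop i hi
      rw [hinp, (hmem i hi).2.1, (hmem i hi).2.2.2] at this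
      exact this
  have hmax : highest l.toFinset ≤ n ^ c :=
    Finset.sup_le fun r hr => hl.top_le r (List.mem_toFinset.1 hr)
  refine ⟨?_, hwn, hcard.trans hm, fun r hr => hl.width_pos r (List.mem_toFinset.1 hr), hB, hB₁,
    hB₂, hB₃, hLZ, hdir, ?_, ?_, htopEq, ?_⟩
  · rw [constructFactor]; omega
  · have := Nat.max_le.2 (⟨by omega, by omega⟩ :
      s'.reg .B ≤ s'.reg .B + 2 * (c * n) + 2 ∧ 2 * l.length + 2 ≤ s'.reg .B + 2 * (c * n) + 2)
    omega
  · exact hfp.trans (by omega)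
  · rw [htopEq]; exact hmax.trans (Nat.le_mul_of_pos_right _ (by omega))

end Operations

theorem cast_le_mul_mul {t N m : ℕ} {k X : ℝ} (ht : t ≤ N * m) (hm : (m : ℝ) ≤ k * X) :
    (t : ℝ) ≤ N * k * X := calc
  (t : ℝ) ≤ N * (m : ℝ) := by exact_mod_cast ht
  _ ≤ N * (k * X) := mul_le_mul_of_nonneg_left hm (Nat.cast_nonneg N)
  _ = N * k * X := (mul_assoc _ _ _).symm

/-- The data structure. -/
def dropCode : Code where
  construct := .seq (.assign 3 (.op .mul (.const 4) (.reg 2))) constructCmd.comp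
  update := updateCmd.comp
  query := queryCmd.comp

/-! ### From states of the loop language to machine states -/

section Machine
variable {c n W w a b x : ℕ} {S : Finset Rect} {σ : State}

/-- The machine state `σ` holds the data structure for the set `S`. -/
def Represents (c n W w : ℕ) (S : Finset Rect) (σ : State) : Prop :=
  ∃ s, Rel W (cellBound c n) s σ ∧ Holds c n w S s

theorem withArgs_two : withArgs σ [a, b] =
    { σ with reg := Function.update (Function.update σ.reg 0 a) 1 b } := by
  rw [withArgs]
  congr 1
  funext i
  match i with
  | 0 => simp
  | 1 => simp
  | i + 2 => simp

theorem withArgs_three : withArgs σ [a, b, x] =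
    { σ with reg := Function.update (Function.update (Function.update σ.reg 0 a) 1 b) 2 x } := by
  rw [withArgs]
  congr 1
  funext i
  match i with
  | 0 => simp
  | 1 => simp
  | 2 => simp
  | i + 3 => simp

theorem LegalPiece.lt (hn : 2 ≤ n) (hL : 64 * cellBound c n ≤ 2 ^ W) (hw : w ≤ n ^ c)
    (hp : LegalPiece c n w a b) : w < 2 ^ W ∧ a < 2 ^ W ∧ b < 2 ^ W := by
  have h₁ := (le_cellBound c hn).2.2.2.2.1
  have h₂ := hp.width_le
  have h₃ := hp.height_le
  have h₄ : 0 < n ^ c := by positivity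
  omega

theorem Represents.update (hn : 2 ≤ n) (hL : 64 * cellBound c n ≤ 2 ^ W)
    (h : Represents c n W w S σ) (hS : S.card < c * n) (hp : LegalPiece c n w a b)
    (hx : x + a ≤ w) : ∃ σ' t, Exec W dropCode.update (withArgs σ [a, b, x]) σ' t ∧
      (t : ℝ) ≤ updateFactor c * 12 * ((n : ℝ) ^ (1 / 2 : ℝ) * Real.log n ^ (3 / 2 : ℝ)) ∧
      σ'.reg 0 = highest (drop S a b x) ∧ Represents c n W w (drop S a b x) σ' := by
  obtain ⟨s, hr, hs⟩ := h
  obtain ⟨hwW, haW, hbW⟩ := hp.lt hn hL hs.w_le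
  have hr' := ((hr.assign (v := .a0) (by decide) haW 0).assign (v := .a1) (by decide) hbW
    0).assign (v := .a2) (x := x) (by decide) (by omega) 0
  have hs' : Holds c n w S (((s.setr .a0 a 0).setr .a1 b 0).setr .a2 x 0) :=
    hs.congr (by simp) (by simp) (by simp) (by simp) (by simp) (by simp)
  obtain ⟨hsafe, ht, h₀, -, hH⟩ := hs'.update hn hS hp hx (by simp) (by simp) (by simp)
  obtain ⟨σ', t, hex, ht', hrel⟩ := updateCmd.exec_comp hL rfl _ _ hr' hsafe
  refine ⟨σ', t, by rw [withArgs_three]; exact hex, ?_, (hrel.reg .a0).trans h₀, _, hrel, hH⟩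
  have h₁ : t ≤ updateFactor c * (s.reg .B * Nat.size n) := by
    rw [ht'] at ht; simpa using ht
  exact cast_le_mul_mul h₁ (block_mul_size_le hn hs.B_pos hs.sq_lt)

theorem Represents.query (hn : 2 ≤ n) (hL : 64 * cellBound c n ≤ 2 ^ W)
    (h : Represents c n W w S σ) (hp : LegalPiece c n w a b) :
    ∃ σ' t, Exec W dropCode.query (withArgs σ [a, b]) σ' t ∧
      (t : ℝ) ≤ queryFactor c * 12 * ((n : ℝ) ^ (1 / 2 : ℝ) * Real.log n ^ (3 / 2 : ℝ)) ∧
      (IsGreedy w S a (σ'.reg 0) ∧ σ'.reg 1 = highest (drop S a b (σ'.reg 0))) ∧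
      Represents c n W w S σ' := by
  obtain ⟨s, hr, hs⟩ := h
  obtain ⟨hwW, haW, hbW⟩ := hp.lt hn hL hs.w_le
  have hr' := (hr.assign (v := .a0) (by decide) haW 0).assign (v := .a1) (by decide) hbW 0
  have hs' : Holds c n w S ((s.setr .a0 a 0).setr .a1 b 0) :=
    hs.congr (by simp) (by simp) (by simp) (by simp) (by simp) (by simp)
  obtain ⟨hsafe, ht, h₀, h₁, hH⟩ := hs'.query hn hp (by simp) (by simp)
  obtain ⟨σ', t, hex, ht', hrel⟩ := queryCmd.exec_comp hL rfl _ _ hr' hsafe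
  have e₀ := hrel.reg .a0
  have e₁ := hrel.reg .a1
  rw [← e₀] at h₀ h₁
  rw [← e₁] at h₁
  refine ⟨σ', t, by rw [withArgs_two]; exact hex, ?_, ⟨h₀, h₁⟩, _, hrel, hH⟩
  have h₁ : t ≤ queryFactor c * (s.reg .B * Nat.size n) := by
    rw [ht'] at ht; simpa using ht
  exact cast_le_mul_mul h₁ (block_mul_size_le hn hs.B_pos hs.sq_lt)

/-- On a board of width 0 the program stops at once and nothing is represented; no legal piece
exists there, so no operation will follow. -/
theorem exec_construct {l : List Rect} (hn : 2 ≤ n) (hL : 64 * cellBound c n ≤ 2 ^ W)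
    (hl : LegalStart c n w l) :
    ∃ σ t, Exec W dropCode.construct (startState n w l) σ t ∧
      (t : ℝ) ≤ constructFactor c * 3 * ((n : ℝ) * Real.log n) ∧
      (0 < w → Represents c n W w l.toFinset σ) := by
  suffices ∃ σ t, Exec W dropCode.construct (startState n w l) σ t ∧
      t ≤ constructFactor c * (n * Nat.size n) ∧
      (0 < w → Represents c n W w l.toFinset σ) by
    obtain ⟨σ, t, hex, ht, h⟩ := this
    exact ⟨σ, t, hex, cast_le_mul_mul ht (mul_size_le hn), h⟩
  obtain ⟨b₁, b₂, b₃, b₄, b₅, b₆⟩ := le_cellBound c hn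
  have hm := hl.length_le
  have hwn := hl.width_le
  have hnc : 0 < n ^ c := by positivity
  have hD : (Expr.op .mul (.const 4) (.reg 2)).eval W (startState n w l) = 4 * l.length := by
    simp only [Expr.eval, BinOp.eval, Nat.mod_eq_of_lt (show 4 < 2 ^ W by omega)]
    exact Nat.mod_eq_of_lt (show 4 * l.length < 2 ^ W by omega)
  have hass := Exec.assign (W := W) (startState n w l) 3 (.op .mul (.const 4) (.reg 2))
  rw [hD] at hass
  set σ₀ : State := { startState n w l with
    reg := Function.update (startState n w l).reg 3 (4 * l.length) } with hσ₀
  rcases Nat.eq_zero_or_pos w with rfl | hw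
  · refine ⟨_, _, hass.seq (.ite_false rfl (.skip _)), ?_, fun h => absurd h (by omega)⟩
    have h₁ : 1 * 1 ≤ n * Nat.size n :=
      Nat.mul_le_mul (by omega) (Nat.size_pos.2 (by omega))
    have h₂ : 1 * 10000 ≤ constructFactor c := Nat.mul_le_mul (by omega) (by omega)
    refine le_trans ?_ (Nat.mul_le_mul h₂ h₁)
    simp [Expr.cost, Ex.comp]
  · set s₀ : St := ⟨fun v => σ₀.reg v.ctorIdx, fun _ _ => 0, (startState n w l).mem, 0⟩ with hs₀
    have hbd : ∀ r ∈ l, r.right ≤ n ^ c ∧ r.top ≤ n ^ c := fun r hr =>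
      ⟨(hl.right_le r hr).trans hwn, hl.top_le r hr⟩
    have hrel : Rel W (cellBound c n) s₀ σ₀ := by
      refine ⟨⟨fun i => ?_, fun i => ?_⟩, ?_, fun _ => rfl, fun A i _ => ?_, fun _ _ => rfl⟩
      · match i with
        | 0 => change n < _; omega
        | 1 => change w < _; omega
        | 2 => change l.length < _; omega
        | 3 => change 4 * l.length < _; omega
        | i + 4 => change 0 < _; omega
      · exact (startState_mem_le n w l hbd i).trans_lt (by omega)
      · change 4 * l.length < _; omega
      · exact startState_mem_eq_zero n w l (by change _ ≤ 4 * l.length + _; omega)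
    have h₀ : s₀.reg .a0 = n ∧ s₀.reg .a1 = w ∧ s₀.reg .a2 = l.length ∧
        s₀.reg .D = 4 * l.length := ⟨rfl, rfl, rfl, rfl⟩
    obtain ⟨hsafe, ht, hH⟩ := holds_construct (s := s₀) hn hl hw h₀.1 h₀.2.1 h₀.2.2.1 h₀.2.2.2
      (fun _ => rfl) rfl
    obtain ⟨σ', t, hex, ht', hrel'⟩ := constructCmd.exec_comp hL rfl _ _ hrel hsafe
    refine ⟨σ', _, hass.seq hex, ?_, fun _ => ⟨_, hrel', hH⟩⟩
    rw [ht'] at ht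
    have h0 : s₀.t = 0 := rfl
    simp only [Expr.cost]
    omega

/-- The operations are shown to have some run that ends in a good state. As runs are unique, the
given run ends in that state too. -/
theorem Reachable.represents (hn : 2 ≤ n) (hL : 64 * cellBound c n ≤ 2 ^ W) (hw : 0 < w)
    (h : Reachable dropCode c n W w S σ) : Represents c n W w S σ := by
  induction h with
  | construct hl hex =>
    obtain ⟨σ', t', hex', -, h⟩ := exec_construct hn hL hl
    exact (hex.unique hex').1 ▸ h hw
  | update _ hS hp hx hex ih =>
    obtain ⟨σ', t', hex', -, -, h⟩ := ih.update hn hL hS hp hx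
    exact (hex.unique hex').1 ▸ h
  | query _ hp hex ih =>
    obtain ⟨σ', t', hex', -, -, h⟩ := ih.query hn hL hp
    exact (hex.unique hex').1 ▸ h

end Machine

end RectDrop

/-! ### Assembling the theorem -/

theorem mainTheorem4 :
    ∃ D : RectDrop.Code, ∀ c : ℕ, ∃ (k : ℕ) (C : ℝ), ∀ n W w : ℕ,
      2 ≤ n → n ^ k ≤ 2 ^ W →
      RectDrop.IsRDDS D c n W w
        (C * ((n : ℝ) * Real.log n))
        (C * ((n : ℝ) ^ (1 / 2 : ℝ) * Real.log n ^ (3 / 2 : ℝ)))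
        (C * ((n : ℝ) ^ (1 / 2 : ℝ) * Real.log n ^ (3 / 2 : ℝ))) := by
  -- A single C serves all three bounds: the sum of the three factors, each times the constant 3 or
  -- 12 lost in passing from `Nat.size` to the real logarithm.
  refine ⟨RectDrop.dropCode, fun c => ⟨2 * c + 22, RectDrop.constructFactor c * 3 +
    RectDrop.updateFactor c * 12 + RectDrop.queryFactor c * 12, fun n W w hn hW => ?_⟩⟩
  have hL := RectDrop.cellBound_le hn hW
  have hlog : 0 ≤ Real.log n := Real.log_natCast_nonneg n
  refine ⟨fun l hl => ?_, fun S s h hS a b x hp hx => ?_, fun S s h a b hp => ?_⟩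
  · obtain ⟨σ, t, hex, ht, -⟩ := RectDrop.exec_construct hn hL hl
    refine ⟨σ, t, hex, ht.trans (mul_le_mul_of_nonneg_right ?_ (by positivity))⟩
    rw [add_assoc]
    exact le_add_of_nonneg_right (by positivity)
  · have hw : 0 < w := hp.width_pos.trans_le hp.width_le
    obtain ⟨σ, t, hex, ht, h₀, -⟩ := (h.represents hn hL hw).update hn hL hS hp hx
    refine ⟨σ, t, hex, ht.trans (mul_le_mul_of_nonneg_right ?_ (by positivity)), h₀⟩
    rw [add_right_comm]
    exact le_add_of_nonneg_left (by positivity)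
  · have hw : 0 < w := hp.width_pos.trans_le hp.width_le
    obtain ⟨σ, t, hex, ht, h₀, -⟩ := (h.represents hn hL hw).query hn hL hp
    refine ⟨σ, t, hex, ht.trans (mul_le_mul_of_nonneg_right ?_ (by positivity)), h₀⟩
    exact le_add_of_nonneg_left (by positivity)
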